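/- Let $\Bbbk$ be $\mathbb R$ or $\mathbb C$, let $G$ be a connected real Lie group with Lie algebra $\mathfrak g$, and let $C^\infty(G)$, $\Omega^k(G)$ be the smooth $\Bbbk$-valued functions and $k$-forms; for $\Bbbk=\mathbb C$ tangent spaces, $\mathfrak g$ and $\mathfrak g^*$ are complexified. Let $G$ be a Poisson–Lie group, i.e. let $\omega=\omega^{[1]}\otimes\omega^{[2]}$ be a smooth antisymmetric bivector field on $G$ with $\omega(gh)=g\,\omega(h)+\omega(g)\,h$ whose bracket $\{a,b\}(g)=a'(g;\omega^{[1]}(g))\,b'(g;\omega^{[2]}(g))$ satisfies the Jacobi identity. Here $a'(g;u)$ is the derivative of $a$ at $g$ along $u\in T_gG$, and $gv$ is the left translate of $v\in\mathfrak g$. Assume that it is quasitriangular: for some $r=r^{[1]}\otimes r^{[2]}\in\mathfrak g\otimes\mathfrak g$ with $[[r,r]]=[r_{12},r_{13}]+[r_{12},r_{23}]+[r_{13},r_{23}]=0$, the cobracket $\delta$ of the tangent Lie bialgebra, defined by $\langle\delta v,d_ea\otimes d_eb\rangle=\{a,b\}'(e;v)$, is $\delta v=\mathrm{ad}_v(r)$.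 Put $r_\pm=\frac12(r\pm r_{21})$ and $(\mathrm{ad}^*_v\psi)(w)=\psi([w,v])$; the quasitriangular structure is triangular if $r_+=0$. A preconnection is a bilinear map $\gamma:C^\infty(G)\times\Omega^1(G)\to\Omega^1(G)$ that is a derivation in the first argument and satisfies $\gamma(x,y\tau)=y\,\gamma(x,\tau)+\{x,y\}\tau$. It is compatible if $d\{x,y\}=\gamma(x,dy)-\gamma(y,dx)$. It is bicovariant if for all $a,\tau,g,h$ $$L_g^*\big(\gamma(a,\tau)(gh)\big)=\gamma(L_g^*a,L_g^*\tau)(h)+\big\{k\mapsto a(kh),\,k\mapsto L_k^*(\tau(kh))\big\}(g),$$ $$R_h^*\big(\gamma(a,\tau)(gh)\big)=\gamma(R_h^*a,R_h^*\tau)(g)+\big\{k\mapsto a(gk),\,k\mapsto R_k^*(\tau(gk))\big\}(h).$$ For $\tau\in\Omega^1(G)$ let $\tilde\tau\in C^\infty(G,\mathfrak g^*)$, $\tilde\tau(g)(v)=\tau(g)(gv)$; put $\hat L_a=\widetilde{da}$ and $\tilde\gamma(a,\tilde\tau)=\widetilde{\gamma(a,\tau)}$. If $\tilde\gamma(a,s)(g)=\{a,s\}(g)+\Xi(\hat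 L_a(g),s(g))$ for a bilinear $\Xi:\mathfrak g^*\times\mathfrak g^*\to\mathfrak g^*$, put $\hat\Xi(\phi,\psi)=\Xi(\phi,\psi)-\phi(r_-^{[1]})\,\mathrm{ad}^*_{r_-^{[2]}}\psi$. Theorem. There is exactly one bilinear $\gamma:C^\infty(G)\times\Omega^1(G)\to\Omega^1(G)$ of this form with $\hat\Xi=0$. It is a compatible bicovariant preconnection, and for all $a\in C^\infty(G)$ and $s\in C^\infty(G,\mathfrak g^*)$ $$\tilde\gamma(a,s)(g)=\{a,s\}(g)+a'(g;g\,r_-^{[1]})\,\mathrm{ad}^*_{r_-^{[2]}}\big(s(g)\big).$$ It extends uniquely to a bilinear map $\gamma:C^\infty(G)\times\Omega^2(G)\to\Omega^2(G)$ with $\gamma(x,\tau\wedge\eta)=\gamma(x,\tau)\wedge\eta+\tau\wedge\gamma(x,\eta)$. If moreover $\mathfrak g$ is semisimple, then the curvature $R(\hat x,\hat y)\tau=\gamma(x,\gamma(y,\tau))-\gamma(y,\gamma(x,\tau))-\gamma(\{x,y\},\tau)$ vanishes for all $x,y,\tau$ if and only if $r_+=0$, and in that case the super-Jacobi obstructions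 $J_i:C^\infty(G)^3\to\Omega^i(G)$ vanish identically for $i=1,2,3$. Here $J_1,J_2,J_3$ are $$[x,[y,dz]]+[dz,[x,y]]+[y,[dz,x]],$$ $$[x,[dy,dz]]-[dz,[x,dy]]+[dy,[dz,x]],$$ $$[dx,[dy,dz]]+[dz,[dx,dy]]+[dy,[dz,dx]]$$ respectively, formed with the first-order coefficients of the super-commutators: $[x,y]=\{x,y\}$, $[x,\xi]=\gamma(x,\xi)=-[\xi,x]$ for forms $\xi$ of degree 1 or 2, $[dx,\tau]=d\gamma(x,\tau)-\gamma(x,d\tau)$ for 1-forms $\tau$, and $[dx,\eta]=d\gamma(x,\eta)$ for closed 2-forms $\eta$. -/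

import Mathlib

open scoped Manifold ContDiff TensorProduct

noncomputable section

namespace PoissonLie

/-! Throughout, `G` is a real Lie group of dimension `n`, and `𝕜` is `ℝ` or `ℂ`: functions, forms
and bivectors are `𝕜`-valued (for `𝕜 = ℝ` the scalar extensions below are the identity). -/

section Tangent

variable (𝕜 : Type*) [RCLike 𝕜] (n : ℕ)
variable {G : Type*} [TopologicalSpace G] [ChartedSpace (EuclideanSpace ℝ (Fin n)) G]

/-- The tangent space of `G` at `g`, with scalars extended to `𝕜`. -/
abbrev TC (g : G) : Type _ := 𝕜 ⊗[ℝ] TangentSpace (𝓡 n) g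

variable (G) in
/-- The Lie algebra `𝔤 = T_e G` with scalars extended to `𝕜`; its bracket is the `𝕜`-bilinear
extension of the bracket of left-invariant vector fields. -/
abbrev LieC [Group G] : Type _ := 𝕜 ⊗[ℝ] GroupLieAlgebra (𝓡 n) G

variable {𝕜}

/-- The derivative of `a` at `g`, as a linear form on `T_g G`. -/
def realDiffAt (a : G → 𝕜) (g : G) : TangentSpace (𝓡 n) g →ₗ[ℝ] 𝕜 where
  toFun v := mfderiv (𝓡 n) 𝓘(ℝ, 𝕜) a g v
  map_add' v w := map_add (mfderiv (𝓡 n) 𝓘(ℝ, 𝕜) a g) v w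
  map_smul' c v := map_smul (mfderiv (𝓡 n) 𝓘(ℝ, 𝕜) a g) c v

/-- The differential of `a` at `g`, as a `𝕜`-linear form on `𝕜 ⊗ T_g G`: `diffAt n a g v` is the
derivative `a'(g; v)`. -/
def diffAt (a : G → 𝕜) (g : G) : TC 𝕜 n g →ₗ[𝕜] 𝕜 :=
  LinearMap.liftBaseChange 𝕜 (realDiffAt n a g)

/-- Smooth `𝕜`-valued functions on `G`. -/
def Smooth (a : G → 𝕜) : Prop := ContMDiff (𝓡 n) 𝓘(ℝ, 𝕜) ∞ a

theorem Smooth.add {a b : G → 𝕜} (ha : Smooth n a) (hb : Smooth n b) :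
    Smooth n (fun g => a g + b g) :=
  (contDiff_add (𝕜 := ℝ) (F := 𝕜) (n := ∞)).comp_contMDiff (ha.prodMk_space hb)

theorem Smooth.sub {a b : G → 𝕜} (ha : Smooth n a) (hb : Smooth n b) :
    Smooth n (fun g => a g - b g) :=
  (ContDiff.sub (𝕜 := ℝ) (F := 𝕜) (n := ∞) contDiff_fst contDiff_snd).comp_contMDiff (ha.prodMk_space hb)

theorem Smooth.mul {a b : G → 𝕜} (ha : Smooth n a) (hb : Smooth n b) :
    Smooth n (fun g => a g * b g) :=
  (contDiff_mul (𝕜 := ℝ) (𝔸 := 𝕜) (n := ∞)).comp_contMDiff (ha.prodMk_space hb)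

theorem Smooth.const (c : 𝕜) : Smooth n (fun _ : G => c) := contMDiff_const

theorem diffAt_add {a b : G → 𝕜} (ha : Smooth n a) (hb : Smooth n b) (g : G) :
    diffAt n (fun h => a h + b h) g = diffAt n a g + diffAt n b g := by
  have key : realDiffAt n (fun h => a h + b h) g = realDiffAt n a g + realDiffAt n b g := by
    ext v
    exact congrArg (fun L => L v) (mfderiv_add (ha.mdifferentiableAt (x := g) (by simp))
      (hb.mdifferentiableAt (x := g) (by simp)))
  ext v
  simp [diffAt, key]

theorem diffAt_const_mul {a : G → 𝕜} (ha : Smooth n a) (c : 𝕜) (g : G) :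
    diffAt n (fun h => c * a h) g = c • diffAt n a g := by
  have key : realDiffAt n (fun h => c * a h) g = c • realDiffAt n a g := by
    ext v
    have h1 := (ha.mdifferentiableAt (x := g) (by simp)).hasMFDerivAt
    have h3 := (ContinuousLinearMap.hasMFDerivAt (ContinuousLinearMap.mul ℝ 𝕜 c)
      (x := a g)).comp g h1
    exact congrArg (fun L => L v) h3.mfderiv
  ext v
  simp [diffAt, key]

/-- The value `(α ⊗ β)(t)` of a tensor `t ∈ V ⊗ V` on two linear forms. -/
def pair {V : Type*} [AddCommGroup V] [Module 𝕜 V] (t : V ⊗[𝕜] V) (α β : V →ₗ[𝕜] 𝕜) : 𝕜 :=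
  LinearMap.mul' 𝕜 𝕜 (TensorProduct.map α β t)

/-- `{a, b}(g) = a'(g; t¹(g)) b'(g; t²(g))` for a field `t = t¹ ⊗ t²` of contravariant
2-tensors. -/
def pbracket (t : ∀ g : G, TC 𝕜 n g ⊗[𝕜] TC 𝕜 n g) (a b : G → 𝕜) (g : G) : 𝕜 :=
  pair (t g) (diffAt n a g) (diffAt n b g)

end Tangent

section Group

variable (𝕜 : Type*) [RCLike 𝕜] (n : ℕ)
variable {G : Type*} [TopologicalSpace G] [ChartedSpace (EuclideanSpace ℝ (Fin n)) G] [Group G]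

/-- The derivative `T_h G → T_{gh} G` of left multiplication by `g`. -/
def leftPush (g h : G) : TC 𝕜 n h →ₗ[𝕜] TC 𝕜 n (g * h) :=
  LinearMap.baseChange 𝕜 (mfderiv (𝓡 n) (𝓡 n) (fun x => g * x) h).toLinearMap

/-- The derivative `T_g G → T_{gh} G` of right multiplication by `h`. -/
def rightPush (g h : G) : TC 𝕜 n g →ₗ[𝕜] TC 𝕜 n (g * h) :=
  LinearMap.baseChange 𝕜 (mfderiv (𝓡 n) (𝓡 n) (fun x => x * h) g).toLinearMap

variable [LieGroup (𝓡 n) ∞ G]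

instance lieGroupMinSmoothness : LieGroup (𝓡 n) (minSmoothness ℝ 3) G := by
  rw [minSmoothness_of_isRCLikeNormedField]
  infer_instance

theorem mfderiv_leftMul_cancel (g h k : G) (hk : k = g * h) (v : EuclideanSpace ℝ (Fin n)) :
    (mfderiv (𝓡 n) (𝓡 n) (fun x => g⁻¹ * x) k)
      ((mfderiv (𝓡 n) (𝓡 n) (fun x => g * x) h) v) = v := by
  subst hk
  have h1 : HasMFDerivAt (𝓡 n) (𝓡 n) (fun x => g * x) h _ :=
    ((contMDiff_mul_left (I := 𝓡 n) (n := ∞) (a := g)).mdifferentiableAt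
      (x := h) (by simp)).hasMFDerivAt
  have h2 : HasMFDerivAt (𝓡 n) (𝓡 n) (fun x => g⁻¹ * x) (g * h) _ :=
    ((contMDiff_mul_left (I := 𝓡 n) (n := ∞) (a := g⁻¹)).mdifferentiableAt
      (x := g * h) (by simp)).hasMFDerivAt
  have h3 := (h2.comp h h1).mfderiv
  have h4 : (fun x => g⁻¹ * x) ∘ (fun x => g * x) = (id : G → G) := by
    funext x; simp
  rw [h4, mfderiv_id] at h3
  exact (congrArg (fun L => L v) h3).symm

/-- The left translation isomorphism `T_e G → T_g G`, `v ↦ g v`, over `ℝ`. -/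
def realLeftTriv (g : G) : GroupLieAlgebra (𝓡 n) G ≃ₗ[ℝ] TangentSpace (𝓡 n) g where
  toFun v := mulInvariantVectorField v g
  map_add' v w := by rw [mulInvariantVectorField_add]; rfl
  map_smul' c v := by rw [mulInvariantVectorField_smul]; rfl
  invFun u := mfderiv (𝓡 n) (𝓡 n) (fun x => g⁻¹ * x) g u
  left_inv v := mfderiv_leftMul_cancel n g 1 g (by simp) v
  right_inv u := by
    have h := mfderiv_leftMul_cancel n g⁻¹ g 1 (by simp) u
    rwa [inv_inv] at h

/-- The left translation isomorphism `v ↦ g v`, with scalars extended to `𝕜`. -/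
def leftTriv (g : G) : LieC 𝕜 n G ≃ₗ[𝕜] TC 𝕜 n g :=
  (realLeftTriv n g).baseChange ℝ 𝕜 _ _

variable {𝕜}

theorem smooth_realDiffAt {a : G → 𝕜} (ha : Smooth n a) (v : GroupLieAlgebra (𝓡 n) G) :
    Smooth n (fun g : G => realDiffAt n a g (realLeftTriv n g v)) := by
  let v₀ : EuclideanSpace ℝ (Fin n) := v
  let f : G × G → 𝕜 := fun p => a (p.1 * p.2)
  have hf : ContMDiff ((𝓡 n).prod (𝓡 n)) 𝓘(ℝ, 𝕜) ∞ f := ha.comp (contMDiff_mul (𝓡 n) ∞)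
  let fg : G → TangentBundle (𝓡 n) G := fun g =>
    Bundle.TotalSpace.mk' (EuclideanSpace ℝ (Fin n)) g 0
  have sfg : ContMDiff (𝓡 n) (𝓡 n).tangent ∞ fg := Bundle.contMDiff_zeroSection _ _
  let fv : G → TangentBundle (𝓡 n) G := fun _ =>
    Bundle.TotalSpace.mk' (EuclideanSpace ℝ (Fin n)) 1 v
  have sfv : ContMDiff (𝓡 n) (𝓡 n).tangent ∞ fv := contMDiff_const
  have S := (contMDiff_snd_tangentBundle_modelSpace (n := ∞) 𝕜 𝓘(ℝ, 𝕜)).comp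
    ((hf.contMDiff_tangentMap (m := ∞) (by simp)).comp
      ((contMDiff_equivTangentBundleProd_symm).comp (sfg.prodMk sfv)))
  refine S.congr fun g => ?_
  have h1 : MDifferentiableAt (𝓡 n) 𝓘(ℝ, 𝕜) a (g * 1) := ha.mdifferentiableAt (by simp)
  have h2 : MDifferentiableAt (𝓡 n) (𝓡 n) (fun x : G => g * x) 1 :=
    (contMDiff_mul_left (I := 𝓡 n) (n := ∞) (a := g)).mdifferentiableAt (by simp)
  have h3 := mfderiv_comp (1 : G) h1 h2
  have h4 := mfderiv_prod_eq_add_apply (hf.mdifferentiableAt (x := (g, (1 : G))) (by simp))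
    (v := ((0 : EuclideanSpace ℝ (Fin n)), v₀))
  have h5 : (mfderiv (𝓡 n) 𝓘(ℝ, 𝕜) (fun z : G => f (g, z)) 1) v =
      (mfderiv (𝓡 n) 𝓘(ℝ, 𝕜) a (g * 1)) ((mfderiv (𝓡 n) (𝓡 n) (fun x : G => g * x) 1) v) :=
    congrArg (fun L => L v) h3
  have h6 : ∀ k : G, k = g → ∀ w : EuclideanSpace ℝ (Fin n),
      ((mfderiv (𝓡 n) 𝓘(ℝ, 𝕜) a k) w : 𝕜) = (mfderiv (𝓡 n) 𝓘(ℝ, 𝕜) a g) w := by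
    rintro k rfl w; rfl
  have h7 : (mfderiv (𝓡 n) 𝓘(ℝ, 𝕜) (fun z : G => f (z, 1)) g)
      (0 : TangentSpace (𝓡 n) g) = 0 := map_zero _
  have h8 := (h4.trans (congrArg₂ (· + ·) h7 h5)).trans (zero_add _)
  exact (h8.trans (h6 _ (mul_one g) _)).symm

/-- The derivative of a smooth function along a left-invariant vector field is smooth. -/
theorem smooth_diffAt {a : G → 𝕜} (ha : Smooth n a) (v : LieC 𝕜 n G) :
    Smooth n (fun g : G => diffAt n a g (leftTriv 𝕜 n g v)) := by
  induction v using TensorProduct.induction_on with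
  | zero => simpa using Smooth.const n (0 : 𝕜)
  | tmul c x =>
    have h := (Smooth.const (G := G) n c).mul n (smooth_realDiffAt n ha x)
    convert h using 2 with g
    simp [leftTriv, diffAt]
  | add x y hx hy => simpa using hx.add n hy

theorem leftPush_leftTriv (g h : G) (v : LieC 𝕜 n G) :
    leftPush 𝕜 n g h (leftTriv 𝕜 n h v) = leftTriv 𝕜 n (g * h) v := by
  have key : ∀ x : GroupLieAlgebra (𝓡 n) G, (mfderiv (𝓡 n) (𝓡 n) (fun y => g * y) h)
      (realLeftTriv n h x) = realLeftTriv n (g * h) x := by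
    intro x
    have h1 : MDifferentiableAt (𝓡 n) (𝓡 n) (fun y : G => g * y) (h * 1) :=
      (contMDiff_mul_left (I := 𝓡 n) (n := ∞) (a := g)).mdifferentiableAt (by simp)
    have h2 : MDifferentiableAt (𝓡 n) (𝓡 n) (fun y : G => h * y) 1 :=
      (contMDiff_mul_left (I := 𝓡 n) (n := ∞) (a := h)).mdifferentiableAt (by simp)
    have h3 := congrArg (fun L => L x) (mfderiv_comp (1 : G) h1 h2)
    have h4 : (fun y : G => g * y) ∘ (fun y => h * y) = fun y => g * h * y := by
      funext y; simp [mul_assoc]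
    rw [h4] at h3
    have h6 : ∀ k : G, k = h → ∀ w : EuclideanSpace ℝ (Fin n),
        (mfderiv (𝓡 n) (𝓡 n) (fun y : G => g * y) k) w =
          (mfderiv (𝓡 n) (𝓡 n) (fun y : G => g * y) h) w := by
      rintro k rfl w; rfl
    exact (h3.trans (h6 _ (mul_one h) _)).symm
  induction v using TensorProduct.induction_on with
  | zero => simp
  | tmul c x => exact congrArg (fun z => c ⊗ₜ[ℝ] z) (key x)
  | add x y hx hy => rw [map_add, map_add, hx, hy, map_add]

/-- The adjoint action of `h⁻¹`, the derivative at `e` of `x ↦ h⁻¹ x h`. -/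
def AdInv (h : G) : LieC 𝕜 n G →ₗ[𝕜] LieC 𝕜 n G :=
  LinearMap.baseChange 𝕜
    { toFun := fun v => mfderiv (𝓡 n) (𝓡 n) (fun x : G => h⁻¹ * x * h) 1 v
      map_add' := fun v w => map_add (mfderiv (𝓡 n) (𝓡 n) (fun x : G => h⁻¹ * x * h) 1) v w
      map_smul' := fun c v => map_smul (mfderiv (𝓡 n) (𝓡 n) (fun x : G => h⁻¹ * x * h) 1) c v }

theorem rightPush_leftTriv (g h : G) (v : LieC 𝕜 n G) :
    rightPush 𝕜 n g h (leftTriv 𝕜 n g v) = leftTriv 𝕜 n (g * h) (AdInv n h v) := by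
  have key : ∀ x : GroupLieAlgebra (𝓡 n) G, (mfderiv (𝓡 n) (𝓡 n) (fun y => y * h) g)
      (realLeftTriv n g x) = realLeftTriv n (g * h)
        (mfderiv (𝓡 n) (𝓡 n) (fun y : G => h⁻¹ * y * h) 1 x) := by
    intro x
    have h1 : MDifferentiableAt (𝓡 n) (𝓡 n) (fun y : G => y * h) (g * 1) :=
      (contMDiff_mul_right (I := 𝓡 n) (n := ∞) (a := h)).mdifferentiableAt (by simp)
    have h2 : MDifferentiableAt (𝓡 n) (𝓡 n) (fun y : G => g * y) 1 :=
      (contMDiff_mul_left (I := 𝓡 n) (n := ∞) (a := g)).mdifferentiableAt (by simp)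
    have h3 := congrArg (fun L => L x) (mfderiv_comp (1 : G) h1 h2)
    have h4 : MDifferentiableAt (𝓡 n) (𝓡 n) (fun y : G => g * h * y) (h⁻¹ * 1 * h) :=
      (contMDiff_mul_left (I := 𝓡 n) (n := ∞) (a := g * h)).mdifferentiableAt (by simp)
    have h5 : MDifferentiableAt (𝓡 n) (𝓡 n) (fun y : G => h⁻¹ * y * h) 1 :=
      ((contMDiff_mul_right (I := 𝓡 n) (n := ∞) (a := h)).comp
        (contMDiff_mul_left (I := 𝓡 n) (n := ∞) (a := h⁻¹))).mdifferentiableAt (by simp)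
    have h6 := congrArg (fun L => L x) (mfderiv_comp (1 : G) h4 h5)
    have h7 : (fun y : G => y * h) ∘ (fun y => g * y) =
        (fun y => g * h * y) ∘ (fun y => h⁻¹ * y * h) := by
      funext y; simp [mul_assoc]
    rw [h7] at h3
    have h8 : ∀ (f : G → G) (k l : G), k = l → ∀ w : EuclideanSpace ℝ (Fin n),
        (mfderiv (𝓡 n) (𝓡 n) f k) w = (mfderiv (𝓡 n) (𝓡 n) f l) w := by
      rintro f k l rfl w; rfl
    exact ((h8 _ _ _ (mul_one g).symm _).trans h3.symm).trans
      (h6.trans (h8 _ _ _ (by simp) _))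
  induction v using TensorProduct.induction_on with
  | zero => simp
  | tmul c x => exact congrArg (fun z => c ⊗ₜ[ℝ] z) (key x)
  | add x y hx hy => simp only [map_add, hx, hy]

/-! ### Functions and differential forms -/

variable (𝕜 G)

/-- The algebra `C^∞(G)` of smooth `𝕜`-valued functions. -/
def Cinf : Subalgebra 𝕜 (G → 𝕜) where
  carrier := {a | Smooth n a}
  mul_mem' ha hb := Smooth.mul n ha hb
  add_mem' ha hb := Smooth.add n ha hb
  algebraMap_mem' c := Smooth.const n c

/-- The space `Ω¹(G)` of smooth `𝕜`-valued 1-forms. Smoothness is expressed by the components in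
a left-invariant frame. -/
def Form1 : Submodule 𝕜 (∀ g : G, TC 𝕜 n g →ₗ[𝕜] 𝕜) where
  carrier := {τ | ∀ v : LieC 𝕜 n G, Smooth n (fun g => τ g (leftTriv 𝕜 n g v))}
  add_mem' hs ht v := (hs v).add n (ht v)
  zero_mem' _ := Smooth.const n 0
  smul_mem' c _ hs v := (Smooth.const n c).mul n (hs v)

/-- The space `Ω²(G)` of smooth `𝕜`-valued 2-forms. -/
def Form2 : Submodule 𝕜 (∀ g : G, TC 𝕜 n g [⋀^Fin 2]→ₗ[𝕜] 𝕜) where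
  carrier := {η | ∀ v w : LieC 𝕜 n G,
    Smooth n (fun g => η g ![leftTriv 𝕜 n g v, leftTriv 𝕜 n g w])}
  add_mem' hs ht v w := (hs v w).add n (ht v w)
  zero_mem' _ _ := Smooth.const n 0
  smul_mem' c _ hs v w := (Smooth.const n c).mul n (hs v w)

/-- An alternating bilinear form as an alternating map, `(u, v) ↦ B(u, v)`. -/
def altOfBilin {V : Type*} [AddCommGroup V] [Module 𝕜 V] (B : V →ₗ[𝕜] V →ₗ[𝕜] 𝕜)
    (hB : ∀ u, B u u = 0) : V [⋀^Fin 2]→ₗ[𝕜] 𝕜 where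
  toFun m := B (m 0) (m 1)
  map_update_add' m i x y := by
    fin_cases i <;> simp [Function.update]
  map_update_smul' m i c x := by
    fin_cases i <;> simp [Function.update]
  map_eq_zero_of_eq' m i j h hij := by
    fin_cases i <;> fin_cases j <;> simp_all

variable {𝕜 n G}

/-- The product `a τ` of a function and a 1-form. -/
def fmul (a : Cinf 𝕜 n G) (τ : Form1 𝕜 n G) : Form1 𝕜 n G :=
  ⟨fun g => a.1 g • τ.1 g, fun v => Smooth.mul n a.2 (τ.2 v)⟩

/-- The wedge product of 1-forms, `(τ ∧ η)(u, v) = τ(u) η(v) - τ(v) η(u)`. -/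
def wedge (τ η : Form1 𝕜 n G) : Form2 𝕜 n G :=
  ⟨fun g => altOfBilin 𝕜 ((τ.1 g).smulRight (η.1 g) - (η.1 g).smulRight (τ.1 g))
      (fun u => by simp [mul_comm]),
    fun v w => ((Smooth.mul n (τ.2 v) (η.2 w)).sub n (Smooth.mul n (η.2 v) (τ.2 w)))⟩

/-- The differential of a function. -/
def d0 (a : Cinf 𝕜 n G) : Form1 𝕜 n G :=
  ⟨fun g => diffAt n a.1 g, fun v => smooth_diffAt n a.2 v⟩

/-- The section `τ̃` of the trivial bundle `G × 𝔤* → G` corresponding to a 1-form: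
`τ̃(g)(v) = τ(g)(g v)`. -/
def tilde (τ : Form1 𝕜 n G) (g : G) : LieC 𝕜 n G →ₗ[𝕜] 𝕜 :=
  τ.1 g ∘ₗ (leftTriv 𝕜 n g).toLinearMap

theorem smooth_tilde (τ : Form1 𝕜 n G) (v : LieC 𝕜 n G) : Smooth n (fun g => tilde τ g v) := τ.2 v

/-- `dτ(g)(g v, g w)` for a 1-form `τ` and `v, w ∈ 𝔤`, by the formula
`dτ(V, W) = V(τ(W)) - W(τ(V)) - τ([V, W])` for the left-invariant vector fields `V`, `W`
generated by `v`, `w`. -/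
def d1Inv (τ : Form1 𝕜 n G) (g : G) : LieC 𝕜 n G →ₗ[𝕜] LieC 𝕜 n G →ₗ[𝕜] 𝕜 :=
  LinearMap.mk₂ 𝕜
    (fun v w => diffAt n (fun h => tilde τ h w) g (leftTriv 𝕜 n g v)
      - diffAt n (fun h => tilde τ h v) g (leftTriv 𝕜 n g w) - tilde τ g ⁅v, w⁆)
    (fun v₁ v₂ w => by
      have h := diffAt_add n (smooth_tilde τ v₁) (smooth_tilde τ v₂) g
      simp only [map_add, add_lie, LinearMap.add_apply, h]
      ring)
    (fun c v w => by
      have h := diffAt_const_mul n (smooth_tilde τ v) c g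
      simp only [map_smul, smul_lie, LinearMap.smul_apply, smul_eq_mul, h]
      ring)
    (fun v w₁ w₂ => by
      have h := diffAt_add n (smooth_tilde τ w₁) (smooth_tilde τ w₂) g
      have hl : ⁅v, w₁ + w₂⁆ = ⁅v, w₁⁆ + ⁅v, w₂⁆ := lie_add v w₁ w₂
      simp only [map_add, hl, LinearMap.add_apply, h]
      ring)
    (fun c v w => by
      have h := diffAt_const_mul n (smooth_tilde τ w) c g
      have hl : ⁅v, c • w⁆ = c • ⁅v, w⁆ := lie_smul c v w
      simp only [map_smul, hl, LinearMap.smul_apply, smul_eq_mul, h]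
      ring)

/-- The exterior derivative of a 1-form. -/
def d1 (τ : Form1 𝕜 n G) : Form2 𝕜 n G :=
  ⟨fun g => altOfBilin 𝕜 ((d1Inv τ g).compl₁₂ (leftTriv 𝕜 n g).symm.toLinearMap
      (leftTriv 𝕜 n g).symm.toLinearMap) (fun u => by simp [d1Inv]),
    fun v w => by
      have h := ((smooth_diffAt n (smooth_tilde τ w) v).sub n
        (smooth_diffAt n (smooth_tilde τ v) w)).sub n (smooth_tilde τ ⁅v, w⁆)
      convert h using 2 with g
      simp [altOfBilin, d1Inv]⟩

/-- The exterior derivative of a 2-form `η`, as a function `dη(g)(u, v, w)` of a point and three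
tangent vectors. It is given by the formula
`dη(U, V, W) = U(η(V, W)) - V(η(U, W)) + W(η(U, V)) - η([U, V], W) + η([U, W], V) - η([V, W], U)`
for left-invariant vector fields `U`, `V`, `W`. -/
def d2 (η : Form2 𝕜 n G) (g : G) (u v w : TC 𝕜 n g) : 𝕜 :=
  let c : LieC 𝕜 n G → LieC 𝕜 n G → G → 𝕜 :=
    fun x y h => η.1 h ![leftTriv 𝕜 n h x, leftTriv 𝕜 n h y]
  let x := (leftTriv 𝕜 n g).symm u
  let y := (leftTriv 𝕜 n g).symm v
  let z := (leftTriv 𝕜 n g).symm w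
  diffAt n (c y z) g u - diffAt n (c x z) g v + diffAt n (c x y) g w
    - c ⁅x, y⁆ z g + c ⁅x, z⁆ y g - c ⁅y, z⁆ x g

/-- The pullback `L_g^* a = (h ↦ a(g h))` of a function under left translation. -/
def leftPull0 (g : G) (a : Cinf 𝕜 n G) : Cinf 𝕜 n G :=
  ⟨fun h => a.1 (g * h), ContMDiff.comp (g := a.1) a.2 contMDiff_mul_left⟩

/-- The pullback `R_h^* a = (g ↦ a(g h))` of a function under right translation. -/
def rightPull0 (h : G) (a : Cinf 𝕜 n G) : Cinf 𝕜 n G :=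
  ⟨fun g => a.1 (g * h), ContMDiff.comp (g := a.1) a.2 contMDiff_mul_right⟩

/-- The pullback `L_g^* τ` of a 1-form under left translation. -/
def leftPull1 (g : G) (τ : Form1 𝕜 n G) : Form1 𝕜 n G :=
  ⟨fun h => τ.1 (g * h) ∘ₗ leftPush 𝕜 n g h, fun v => by
    have h : Smooth n _ := (leftPull0 g ⟨_, smooth_tilde τ v⟩).2
    convert h using 2 with k
    simp [leftPull0, tilde, leftPush_leftTriv]⟩

/-- The pullback `R_h^* τ` of a 1-form under right translation. -/
def rightPull1 (h : G) (τ : Form1 𝕜 n G) : Form1 𝕜 n G :=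
  ⟨fun g => τ.1 (g * h) ∘ₗ rightPush 𝕜 n g h, fun v => by
    have hs : Smooth n _ := (rightPull0 h ⟨_, smooth_tilde τ (AdInv n h v)⟩).2
    convert hs using 2 with k
    simp [rightPull0, tilde, rightPush_leftTriv]⟩

/-! ### Poisson-Lie groups -/

variable (𝕜 n G)

/-- A (`𝕜`-valued) Poisson-Lie structure on `G`: a smooth multiplicative bivector field whose
bracket `{a, b}` satisfies the Jacobi identity. -/
structure PoissonLieStructure where
  /-- The bivector field. -/
  biv : ∀ g : G, TC 𝕜 n g ⊗[𝕜] TC 𝕜 n g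
  skew : ∀ g, TensorProduct.comm 𝕜 _ _ (biv g) = -biv g
  smooth : ∀ a b : G → 𝕜, Smooth n a → Smooth n b → Smooth n (pbracket n biv a b)
  jacobi : ∀ a b c : G → 𝕜, Smooth n a → Smooth n b → Smooth n c → ∀ g,
    pbracket n biv a (pbracket n biv b c) g + pbracket n biv b (pbracket n biv c a) g
      + pbracket n biv c (pbracket n biv a b) g = 0
  multiplicative : ∀ g h, biv (g * h) =
    TensorProduct.map (leftPush 𝕜 n g h) (leftPush 𝕜 n g h) (biv h)
      + TensorProduct.map (rightPush 𝕜 n g h) (rightPush 𝕜 n g h) (biv g)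

variable {𝕜 n G}

/-- The Poisson bracket of smooth functions. -/
def PoissonLieStructure.bracket (P : PoissonLieStructure 𝕜 n G) (a b : Cinf 𝕜 n G) :
    Cinf 𝕜 n G :=
  ⟨pbracket n P.biv a.1 b.1, P.smooth _ _ a.2 b.2⟩

section Algebra

variable {L : Type*} [LieRing L] [LieAlgebra 𝕜 L]

/-- The Lie bracket as a linear map `L ⊗ L → L`. -/
def lieMap : L ⊗[𝕜] L →ₗ[𝕜] L := (LieModule.toModuleHom 𝕜 L L : L ⊗[𝕜] L →ₗ[𝕜] L)

/-- `[r₁₂, s₁₃] = [a, c] ⊗ b ⊗ d` for `r = a ⊗ b`, `s = c ⊗ d`. -/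
def lie1213 (r s : L ⊗[𝕜] L) : L ⊗[𝕜] (L ⊗[𝕜] L) :=
  TensorProduct.map lieMap LinearMap.id
    (TensorProduct.tensorTensorTensorComm 𝕜 L L L L (r ⊗ₜ[𝕜] s))

/-- `[r₁₃, s₂₃] = a ⊗ c ⊗ [b, d]` for `r = a ⊗ b`, `s = c ⊗ d`. -/
def lie1323 (r s : L ⊗[𝕜] L) : L ⊗[𝕜] (L ⊗[𝕜] L) :=
  TensorProduct.assoc 𝕜 L L L (TensorProduct.map LinearMap.id lieMap
    (TensorProduct.tensorTensorTensorComm 𝕜 L L L L (r ⊗ₜ[𝕜] s)))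

/-- `[r₁₂, s₂₃] = a ⊗ [b, c] ⊗ d` for `r = a ⊗ b`, `s = c ⊗ d`. -/
def lie1223 (r s : L ⊗[𝕜] L) : L ⊗[𝕜] (L ⊗[𝕜] L) :=
  TensorProduct.map LinearMap.id
    (TensorProduct.map lieMap LinearMap.id ∘ₗ (TensorProduct.assoc 𝕜 L L L).symm.toLinearMap)
    (TensorProduct.assoc 𝕜 L L (L ⊗[𝕜] L) (r ⊗ₜ[𝕜] s))

/-- `[[r, r]] = [r₁₂, r₁₃] + [r₁₂, r₂₃] + [r₁₃, r₂₃]`. -/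
def schouten (r : L ⊗[𝕜] L) : L ⊗[𝕜] (L ⊗[𝕜] L) :=
  lie1213 r r + lie1223 r r + lie1323 r r

/-- `r₊ = (r + r₂₁) / 2`. -/
def symPart (r : L ⊗[𝕜] L) : L ⊗[𝕜] L := (2 : 𝕜)⁻¹ • (r + TensorProduct.comm 𝕜 L L r)

/-- `r₋ = (r - r₂₁) / 2`. -/
def skewPart (r : L ⊗[𝕜] L) : L ⊗[𝕜] L := (2 : 𝕜)⁻¹ • (r - TensorProduct.comm 𝕜 L L r)

/-- `(φ(r¹) ad*_{r²} ψ)(w)` for `r = r¹ ⊗ r²`, where `(ad*_v ψ)(w) = ψ([w, v])`. -/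
def coadTerm (r : L ⊗[𝕜] L) (φ ψ : L →ₗ[𝕜] 𝕜) (w : L) : 𝕜 :=
  pair r φ (ψ ∘ₗ (LieModule.toEnd 𝕜 L L w))

/-- `Ξ̂(φ, ψ) = Ξ(φ, ψ) - φ(r₋¹) ad*_{r₋²} ψ`, evaluated at `w`. -/
def xiHat (r : L ⊗[𝕜] L)
    (Ξ : (L →ₗ[𝕜] 𝕜) →ₗ[𝕜] (L →ₗ[𝕜] 𝕜) →ₗ[𝕜] (L →ₗ[𝕜] 𝕜)) (φ ψ : L →ₗ[𝕜] 𝕜) (w : L) : 𝕜 :=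
  Ξ φ ψ w - coadTerm (skewPart r) φ ψ w

/-- The adjoint action `ad_v(r) = [v, r¹] ⊗ r² + r¹ ⊗ [v, r²]`. -/
def adTensor (v : L) (r : L ⊗[𝕜] L) : L ⊗[𝕜] L := ⁅v, r⁆

end Algebra

/-- The Poisson-Lie group is quasitriangular with quasitriangular structure `r ∈ 𝔤 ⊗ 𝔤`:
`r` obeys the classical Yang-Baxter equation `[[r, r]] = 0`, and the cobracket `δ` of the tangent
Lie bialgebra, which is given by `⟨δ v, d_e a ⊗ d_e b⟩ = D_{(e; v)} {a, b}`, is `δ v = ad_v(r)`. -/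
structure IsQuasitriangular (P : PoissonLieStructure 𝕜 n G)
    (r : LieC 𝕜 n G ⊗[𝕜] LieC 𝕜 n G) : Prop where
  yangBaxter : schouten r = 0
  cobracket : ∀ (a b : Cinf 𝕜 n G) (v : LieC 𝕜 n G),
    diffAt n (P.bracket a b).1 1 v = pair (adTensor v r) (diffAt n a.1 1) (diffAt n b.1 1)

/-- A quasitriangular structure is triangular if `r₊ = 0`. -/
def IsTriangular (r : LieC 𝕜 n G ⊗[𝕜] LieC 𝕜 n G) : Prop := symPart r = 0

/-! ### Preconnections -/

variable (𝕜 n G) in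
/-- Bilinear maps `γ : C^∞(G) × Ω¹(G) → Ω¹(G)`. -/
abbrev Op1 : Type _ := Cinf 𝕜 n G →ₗ[𝕜] Form1 𝕜 n G →ₗ[𝕜] Form1 𝕜 n G

variable (𝕜 n G) in
/-- Bilinear maps `C^∞(G) × Ω²(G) → Ω²(G)`. -/
abbrev Op2 : Type _ := Cinf 𝕜 n G →ₗ[𝕜] Form2 𝕜 n G →ₗ[𝕜] Form2 𝕜 n G

/-- `γ(-, τ)` is a derivation and `γ(x, y τ) = y γ(x, τ) + {x, y} τ`. -/
structure IsPreconnection (P : PoissonLieStructure 𝕜 n G) (γ : Op1 𝕜 n G) : Prop where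
  derivation : ∀ x y τ, γ (x * y) τ = fmul x (γ y τ) + fmul y (γ x τ)
  connection : ∀ x y τ, γ x (fmul y τ) = fmul y (γ x τ) + fmul (P.bracket x y) τ

/-- Compatibility with the Poisson structure, `d{x, y} = γ(x, dy) - γ(y, dx)`. -/
def IsCompatible (P : PoissonLieStructure 𝕜 n G) (γ : Op1 𝕜 n G) : Prop :=
  ∀ x y, d0 (P.bracket x y) = γ x (d0 y) - γ y (d0 x)

/-- Left covariance (the semiclassical form of covariance under the left coaction `Δ_L`): in
`T_h^* G`, for all `g`, `h`,
`L_g^* (γ(a, τ)(g h)) = γ(L_g^* a, L_g^* τ)(h) + {a(k h), L_k^* (τ(k h))}(k = g)`, the bracket being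
taken in the variable `k`. -/
def IsLeftCovariant (P : PoissonLieStructure 𝕜 n G) (γ : Op1 𝕜 n G) : Prop :=
  ∀ (a : Cinf 𝕜 n G) (τ : Form1 𝕜 n G) (g h : G) (u : TC 𝕜 n h),
    (γ a τ).1 (g * h) (leftPush 𝕜 n g h u) =
      (γ (leftPull0 g a) (leftPull1 g τ)).1 h u
        + pbracket n P.biv (fun k => a.1 (k * h)) (fun k => τ.1 (k * h) (leftPush 𝕜 n k h u)) g

/-- Right covariance (the semiclassical form of covariance under the right coaction `Δ_R`): in
`T_g^* G`, for all `g`, `h`,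
`R_h^* (γ(a, τ)(g h)) = γ(R_h^* a, R_h^* τ)(g) + {a(g k), R_k^* (τ(g k))}(k = h)`, the bracket being
taken in the variable `k`. -/
def IsRightCovariant (P : PoissonLieStructure 𝕜 n G) (γ : Op1 𝕜 n G) : Prop :=
  ∀ (a : Cinf 𝕜 n G) (τ : Form1 𝕜 n G) (g h : G) (u : TC 𝕜 n g),
    (γ a τ).1 (g * h) (rightPush 𝕜 n g h u) =
      (γ (rightPull0 h a) (rightPull1 h τ)).1 g u
        + pbracket n P.biv (fun k => a.1 (g * k)) (fun k => τ.1 (g * k) (rightPush 𝕜 n g k u)) h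

/-- Bicovariance: left and right covariance. -/
def IsBicovariant (P : PoissonLieStructure 𝕜 n G) (γ : Op1 𝕜 n G) : Prop :=
  IsLeftCovariant P γ ∧ IsRightCovariant P γ

/-- `γ` is given by `Ξ : 𝔤* × 𝔤* → 𝔤*` (independent of the point of `G`):
`γ̃(a, s)(g) = {a, s}(g) + Ξ(L̂_a(g), s(g))`, where `s = τ̃` and `L̂_a(g)(v) = a'(g; g v)`. -/
def IsGivenByXi (P : PoissonLieStructure 𝕜 n G) (γ : Op1 𝕜 n G)
    (Ξ : (LieC 𝕜 n G →ₗ[𝕜] 𝕜) →ₗ[𝕜] (LieC 𝕜 n G →ₗ[𝕜] 𝕜) →ₗ[𝕜] (LieC 𝕜 n G →ₗ[𝕜] 𝕜)) : Prop :=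
  ∀ (a : Cinf 𝕜 n G) (τ : Form1 𝕜 n G) (g : G) (v : LieC 𝕜 n G),
    tilde (γ a τ) g v =
      pbracket n P.biv a.1 (fun h => tilde τ h v) g + Ξ (tilde (d0 a) g) (tilde τ g) v

/-- `γ` is the left-invariant map with `Ξ̂ = 0`. -/
def HasXiHatZero (P : PoissonLieStructure 𝕜 n G) (r : LieC 𝕜 n G ⊗[𝕜] LieC 𝕜 n G)
    (γ : Op1 𝕜 n G) : Prop :=
  ∃ Ξ, IsGivenByXi P γ Ξ ∧ ∀ φ ψ w, xiHat r Ξ φ ψ w = 0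

/-- The curvature `R(x̂, ŷ) τ = γ(x, γ(y, τ)) - γ(y, γ(x, τ)) - γ({x, y}, τ)`. -/
def curvature (P : PoissonLieStructure 𝕜 n G) (γ : Op1 𝕜 n G) (x y : Cinf 𝕜 n G)
    (τ : Form1 𝕜 n G) : Form1 𝕜 n G :=
  γ x (γ y τ) - γ y (γ x τ) - γ (P.bracket x y) τ

/-! ### Super-Jacobi obstructions

To first order in `ħ`, super-commutators in the deformed calculus are `[x, y] = ħ {x, y}`,
`[x, τ] = -[τ, x] = ħ γ(x, τ)`, `[x, η] = ħ γ(x, η)` for 2-forms `η`, where `γ` is extended as a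
derivation of the wedge product, and, as `d` is a graded derivation of the super-commutator,
`[dx, τ] = d[x, τ] - [x, dτ]` and `[dx, η] = d[x, η] - [x, dη]`. The definitions below are the
coefficients of `ħ²` in the super-Jacobi expressions. -/

/-- `Γ` is the extension of `γ` to 2-forms,
`γ(x, τ ∧ η) = γ(x, τ) ∧ η + τ ∧ γ(x, η)`. -/
def IsExtension (γ : Op1 𝕜 n G) (Γ : Op2 𝕜 n G) : Prop :=
  ∀ x τ η, Γ x (wedge τ η) = wedge (γ x τ) η + wedge τ (γ x η)

/-- The coefficient of `ħ` in `[dx, τ] = d[x, τ] - [x, dτ]`, for a 1-form `τ`. -/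
def comm11 (γ : Op1 𝕜 n G) (Γ : Op2 𝕜 n G) (x : Cinf 𝕜 n G) (τ : Form1 𝕜 n G) : Form2 𝕜 n G :=
  d1 (γ x τ) - Γ x (d1 τ)

/-- The coefficient of `ħ` in `[dx, η] = d[x, η]`, for a closed 2-form `η`. -/
def comm12 (Γ : Op2 𝕜 n G) (x : Cinf 𝕜 n G) (η : Form2 𝕜 n G) (g : G) (u v w : TC 𝕜 n g) : 𝕜 :=
  d2 (Γ x η) g u v w

/-- `[x, [y, dz]] + [dz, [x, y]] + [y, [dz, x]] = ħ² J₁(x, y, z) + O(ħ³)`. -/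
def J1 (P : PoissonLieStructure 𝕜 n G) (γ : Op1 𝕜 n G) (x y z : Cinf 𝕜 n G) : Form1 𝕜 n G :=
  γ x (γ y (d0 z)) + -γ (P.bracket x y) (d0 z) + γ y (-γ x (d0 z))

/-- `[x, [dy, dz]] - [dz, [x, dy]] + [dy, [dz, x]] = ħ² J₂(x, y, z) + O(ħ³)`. -/
def J2 (γ : Op1 𝕜 n G) (Γ : Op2 𝕜 n G) (x y z : Cinf 𝕜 n G) : Form2 𝕜 n G :=
  Γ x (comm11 γ Γ y (d0 z)) - comm11 γ Γ z (γ x (d0 y)) + comm11 γ Γ y (-γ x (d0 z))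

/-- `[dx, [dy, dz]] + [dz, [dx, dy]] + [dy, [dz, dx]] = ħ² J₃(x, y, z) + O(ħ³)`, a 3-form; the inner
super-commutators are exact. -/
def J3 (γ : Op1 𝕜 n G) (Γ : Op2 𝕜 n G) (x y z : Cinf 𝕜 n G) (g : G) (u v w : TC 𝕜 n g) : 𝕜 :=
  comm12 Γ x (comm11 γ Γ y (d0 z)) g u v w + comm12 Γ z (comm11 γ Γ x (d0 y)) g u v w
    + comm12 Γ y (comm11 γ Γ z (d0 x)) g u v w

end Group

end PoissonLie

end

/-!
Choose a presentation `r₋ = ∑ pᵢ ⊗ qᵢ`. The required formula for `γ̃` determines `γ` completely: in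
the left-invariant frame its components are
`γ(a, τ)(v) = {a, τ(v)} + ∑ (pᵢ a) τ([v, qᵢ])`, where `pᵢ` acts as a left-invariant vector field.
This is `conn`; its extension `conn2` to 2-forms is forced because 2-forms are sums of wedge
products (`IsExtension.unique`).

Differentiating the multiplicativity of the bivector field gives the basic identity `leftDer_ham`: a
left-invariant field `v` fails to be a derivation of the Poisson bracket by `ad_v(r) = ad_v(r₋)`.
The two terms of `ad_v(r₋)` are the two coadjoint terms in `γ(x, dy) - γ(y, dx)`, which is
compatibility. The identity also shows that the difference of the Poisson bracket and of the bracket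
of `r₋ᴸ - r₋ᴿ` is a left-invariant bidifferential operator that vanishes at `e`; on a connected
group it is zero (`bidifferential_eq_zero`), so the bracket is the coboundary `r₋ᴸ - r₋ᴿ`
(`ham_eq_sum`). Left covariance is immediate from multiplicativity. Right covariance follows from
the coboundary formula, applied to the matrix coefficients of `Ad` by which the left-invariant frame
is twisted under right translations.

By the Jacobi identity and `leftDer_ham`, the curvature is given by the Schouten square `[[r₋, r₋]]`
(`comp1_curvature`), and invariance of `r₊` together with the Yang-Baxter equation for `r` gives
`[[r₋, r₋]] = -[(r₊)₁₃, (r₊)₂₃]` (`schouten_skewPart`). So the curvature vanishes if `r₊ = 0`.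
Conversely, if it vanishes, all `[v, [K φ, K χ]]` vanish, where `K φ = φ(r₊¹) r₊²`; if `𝔤` is
semisimple, its center is zero, so that the image of `K`, an ideal because `r₊` is invariant, is
abelian, hence zero (`eq_zero_of_lie_lie_eq_zero`). Semisimplicity is used through the Killing form,
whose nondegeneracy survives the extension of scalars to `𝕜`.

For triangular `r`, the obstruction `J₁` is the curvature on exact forms. Moreover the tensor
`∑ U ⊗ W = rᴸ - rᴿ` of derivations of `C^∞(G)` is itself an antisymmetric solution of the classical
Yang-Baxter equation, since left- and right-invariant fields commute, and
`γ(x, da) = ∑ (U x) d(W a)`. With this form of `γ` the vanishing of `J₂` is the Yang-Baxter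
equation applied to three functions (`sum_sum_eq_zero_of_yangBaxter`). Finally `J₃` is `d` of a
2-form which, by `J₂ = 0` and compatibility, is exact.
-/

open scoped Manifold ContDiff TensorProduct

noncomputable section

namespace PoissonLie

/-! ### Derivatives of smooth functions on a manifold -/

section Analysis

variable {𝕜 : Type*} [RCLike 𝕜] {n : ℕ}
variable {G : Type*} [TopologicalSpace G] [ChartedSpace (EuclideanSpace ℝ (Fin n)) G]

theorem diffAt_tmul (a : G → 𝕜) (g : G) (c : 𝕜) (v : TangentSpace (𝓡 n) g) :
    diffAt n a g (c ⊗ₜ[ℝ] v) = c * realDiffAt n a g v := by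
  simp [diffAt]

theorem diffAt_one_tmul (a : G → 𝕜) (g : G) (v : TangentSpace (𝓡 n) g) :
    diffAt n a g ((1 : 𝕜) ⊗ₜ[ℝ] v) = realDiffAt n a g v := by
  simp [diffAt]

theorem diffAt_mul {a b : G → 𝕜} (ha : Smooth n a) (hb : Smooth n b) (g : G) :
    diffAt n (fun h => a h * b h) g = a g • diffAt n b g + b g • diffAt n a g := by
  have key : realDiffAt n (fun h => a h * b h) g
      = a g • realDiffAt n b g + b g • realDiffAt n a g := by
    ext v
    have h1 := (ha.mdifferentiableAt (x := g) (by simp)).hasMFDerivAt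
    have h2 := (hb.mdifferentiableAt (x := g) (by simp)).hasMFDerivAt
    exact congrArg (fun L => L v) (h1.mul h2).mfderiv
  ext v
  simp [diffAt, key]

theorem diffAt_const (c : 𝕜) (g : G) : diffAt n (fun _ : G => c) g = 0 := by
  have key : realDiffAt n (fun _ : G => c) g = 0 := by
    ext v
    have h := mfderiv_const (I := 𝓡 n) (I' := 𝓘(ℝ, 𝕜)) (M := G) (M' := 𝕜) (c := c) (x := g)
    exact congrArg (fun L => L v) h
  ext v
  simp [diffAt, key]

/-- The chain rule. -/
theorem diffAt_comp {a : G → 𝕜} (ha : Smooth n a) {f : G → G} (hf : ContMDiff (𝓡 n) (𝓡 n) ∞ f)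
    (g : G) : diffAt n (fun x => a (f x)) g =
      diffAt n a (f g) ∘ₗ LinearMap.baseChange 𝕜 (mfderiv (𝓡 n) (𝓡 n) f g).toLinearMap := by
  have key : realDiffAt n (fun x => a (f x)) g
      = realDiffAt n a (f g) ∘ₗ (mfderiv (𝓡 n) (𝓡 n) f g).toLinearMap := by
    ext v
    exact congrArg (fun L => L v) (mfderiv_comp (I := 𝓡 n) (I' := 𝓡 n) (I'' := 𝓘(ℝ, 𝕜)) g
      (ha.mdifferentiableAt (x := f g) (by simp)) (hf.mdifferentiableAt (x := g) (by simp)))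
  ext v
  simp [diffAt, key]

/-- The derivative in the second variable, along a fixed vector, is smooth in the first one. -/
theorem smooth_realDiffAt_snd [IsManifold (𝓡 n) ∞ G] {F : G × G → 𝕜}
    (hF : ContMDiff ((𝓡 n).prod (𝓡 n)) 𝓘(ℝ, 𝕜) ∞ F) (k : G) (v : TangentSpace (𝓡 n) k) :
    Smooth n (fun g : G => realDiffAt n (fun x => F (g, x)) k v) := by
  let v₀ : EuclideanSpace ℝ (Fin n) := v
  let fg : G → TangentBundle (𝓡 n) G := fun g =>
    Bundle.TotalSpace.mk' (EuclideanSpace ℝ (Fin n)) g 0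
  have sfg : ContMDiff (𝓡 n) (𝓡 n).tangent ∞ fg := Bundle.contMDiff_zeroSection _ _
  let fv : G → TangentBundle (𝓡 n) G := fun _ =>
    Bundle.TotalSpace.mk' (EuclideanSpace ℝ (Fin n)) k v
  have sfv : ContMDiff (𝓡 n) (𝓡 n).tangent ∞ fv := contMDiff_const
  have S := (contMDiff_snd_tangentBundle_modelSpace (n := ∞) 𝕜 𝓘(ℝ, 𝕜)).comp
    ((hF.contMDiff_tangentMap (m := ∞) (by simp)).comp
      ((contMDiff_equivTangentBundleProd_symm).comp (sfg.prodMk sfv)))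
  refine S.congr fun g => ?_
  have h4 := mfderiv_prod_eq_add_apply (hF.mdifferentiableAt (x := (g, k)) (by simp))
    (v := ((0 : EuclideanSpace ℝ (Fin n)), v₀))
  have h7 : (mfderiv (𝓡 n) 𝓘(ℝ, 𝕜) (fun z : G => F (z, k)) g)
      (0 : TangentSpace (𝓡 n) g) = 0 := map_zero _
  have h8 := (h4.trans (congrArg₂ (· + ·) h7 rfl)).trans (zero_add _)
  exact h8.symm

theorem smooth_diffAt_snd [IsManifold (𝓡 n) ∞ G] {F : G × G → 𝕜}
    (hF : ContMDiff ((𝓡 n).prod (𝓡 n)) 𝓘(ℝ, 𝕜) ∞ F) (k : G) (v : TC 𝕜 n k) :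
    Smooth n (fun g : G => diffAt n (fun x => F (g, x)) k v) := by
  induction v using TensorProduct.induction_on with
  | zero => simpa using Smooth.const n (0 : 𝕜)
  | tmul c x =>
    have h := (Smooth.const (G := G) n c).mul n (smooth_realDiffAt_snd hF k x)
    convert h using 2 with g
    simp [diffAt]
  | add x y hx hy => simpa using hx.add n hy

theorem smooth_diffAt_fst [IsManifold (𝓡 n) ∞ G] {F : G × G → 𝕜}
    (hF : ContMDiff ((𝓡 n).prod (𝓡 n)) 𝓘(ℝ, 𝕜) ∞ F) (k : G) (v : TC 𝕜 n k) :
    Smooth n (fun g : G => diffAt n (fun x => F (x, g)) k v) :=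
  smooth_diffAt_snd (F := fun p => F (p.2, p.1))
    (hF.comp (contMDiff_snd.prodMk contMDiff_fst)) k v

/-- Symmetry of the second derivative, for the two factors of a product. -/
theorem fderiv_fderiv_snd_fst {E F : Type*} [NormedAddCommGroup E] [NormedSpace ℝ E]
    [NormedAddCommGroup F] [NormedSpace ℝ F] {f : E × E → F} {p q : E}
    (hf : ContDiffAt ℝ 2 f (p, q)) (u v : E) :
    fderiv ℝ (fun x => fderiv ℝ (fun y => f (x, y)) q v) p u =
      fderiv ℝ (fun y => fderiv ℝ (fun x => f (x, y)) p u) q v := by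
  have hd : ∀ᶠ z in nhds (p, q), DifferentiableAt ℝ f z :=
    (hf.eventually (by simp)).mono fun z hz => hz.differentiableAt (by simp)
  have hdd : DifferentiableAt ℝ (fderiv ℝ f) (p, q) :=
    (hf.fderiv_right (m := 1) (by norm_num)).differentiableAt (by simp)
  have hsym := hf.isSymmSndFDerivAt (by simp)
  have c1 : ContinuousAt (fun x : E => (x, q)) p := by fun_prop
  have c2 : ContinuousAt (fun y : E => (p, y)) q := by fun_prop
  have p1 : ∀ x y : E, HasFDerivAt (fun y : E => (x, y)) (ContinuousLinearMap.inr ℝ E E) y :=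
    fun x y => hasFDerivAt_prodMk_right x y
  have p2 : ∀ x y : E, HasFDerivAt (fun x : E => (x, y)) (ContinuousLinearMap.inl ℝ E E) x :=
    fun x y => hasFDerivAt_prodMk_left x y
  have e1 : (fun x => fderiv ℝ (fun y => f (x, y)) q v) =ᶠ[nhds p]
      fun x => fderiv ℝ f (x, q) (0, v) := by
    filter_upwards [c1.eventually hd] with x hx
    have h : HasFDerivAt (fun y => f (x, y)) _ q := hx.hasFDerivAt.comp q (p1 x q)
    rw [h.fderiv]
    simp
  have e2 : (fun y => fderiv ℝ (fun x => f (x, y)) p u) =ᶠ[nhds q]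
      fun y => fderiv ℝ f (p, y) (u, 0) := by
    filter_upwards [c2.eventually hd] with y hy
    have h : HasFDerivAt (fun x => f (x, y)) _ p := hy.hasFDerivAt.comp p (p2 p y)
    rw [h.fderiv]
    simp
  rw [e1.fderiv_eq, e2.fderiv_eq]
  have h1 : fderiv ℝ (fun x => fderiv ℝ f (x, q) (0, v)) p u
      = fderiv ℝ (fderiv ℝ f) (p, q) (u, 0) (0, v) := by
    have h' : HasFDerivAt (fun x => fderiv ℝ f (x, q)) _ p := hdd.hasFDerivAt.comp p (p2 p q)
    rw [(h'.clm_apply (hasFDerivAt_const ((0 : E), v) p)).fderiv]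
    simp
  have h2 : fderiv ℝ (fun y => fderiv ℝ f (p, y) (u, 0)) q v
      = fderiv ℝ (fderiv ℝ f) (p, q) (0, v) (u, 0) := by
    have h' : HasFDerivAt (fun y => fderiv ℝ f (p, y)) _ q := hdd.hasFDerivAt.comp q (p1 p q)
    rw [(h'.clm_apply (hasFDerivAt_const (u, (0 : E)) q)).fderiv]
    simp
  rw [h1, h2]
  exact hsym _ _

/-- The derivative of a function at `g` is computed in the preferred chart at `g`. -/
theorem realDiffAt_eq_fderiv {a : G → 𝕜} {g : G}
    (ha : MDifferentiableAt (𝓡 n) 𝓘(ℝ, 𝕜) a g) (v : TangentSpace (𝓡 n) g) :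
    realDiffAt n a g v =
      fderiv ℝ (fun y => a ((extChartAt (𝓡 n) g).symm y)) (extChartAt (𝓡 n) g g) v := by
  refine (congrArg (fun L => L v) ha.mfderiv).trans ?_
  rw [ModelWithCorners.Boundaryless.range_eq_univ, fderivWithin_univ]
  rfl

/-- Mixed partial derivatives of a function on `G × G` commute: the real case, in charts. -/
theorem realDiffAt_comm {F : G × G → 𝕜} [IsManifold (𝓡 n) ∞ G]
    (hF : ContMDiff ((𝓡 n).prod (𝓡 n)) 𝓘(ℝ, 𝕜) ∞ F) (g k : G)
    (u : TangentSpace (𝓡 n) g) (v : TangentSpace (𝓡 n) k) :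
    realDiffAt n (fun x => realDiffAt n (fun y => F (x, y)) k v) g u =
      realDiffAt n (fun y => realDiffAt n (fun x => F (x, y)) g u) k v := by
  have s1 := smooth_realDiffAt_snd hF k v
  have s2 := smooth_realDiffAt_snd (F := fun p => F (p.2, p.1))
    (hF.comp (contMDiff_snd.prodMk contMDiff_fst)) g u
  rw [realDiffAt_eq_fderiv (s1.mdifferentiableAt (by simp)),
    realDiffAt_eq_fderiv (s2.mdifferentiableAt (by simp))]
  have t1 : ∀ x, MDifferentiableAt (𝓡 n) 𝓘(ℝ, 𝕜) (fun y => F (x, y)) k := fun x =>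
    (hF.comp (contMDiff_const.prodMk contMDiff_id)).mdifferentiableAt (by simp)
  have t2 : ∀ y, MDifferentiableAt (𝓡 n) 𝓘(ℝ, 𝕜) (fun x => F (x, y)) g := fun y =>
    (hF.comp (contMDiff_id.prodMk contMDiff_const)).mdifferentiableAt (by simp)
  have e1 : ∀ x, realDiffAt n (fun y => F (x, y)) k v = _ :=
    fun x => realDiffAt_eq_fderiv (t1 x) v
  have e2 : ∀ y, realDiffAt n (fun x => F (x, y)) g u = _ :=
    fun y => realDiffAt_eq_fderiv (t2 y) u
  simp only [e1, e2]
  refine fderiv_fderiv_snd_fst (f := fun p => F ((extChartAt (𝓡 n) g).symm p.1,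
    (extChartAt (𝓡 n) k).symm p.2)) ?_ _ _
  have c1 : ContMDiffAt 𝓘(ℝ, EuclideanSpace ℝ (Fin n)) (𝓡 n) ∞ (extChartAt (𝓡 n) g).symm
      (extChartAt (𝓡 n) g g) := by
    have := contMDiffWithinAt_extChartAt_symm_range (I := 𝓡 n) (n := ∞) g
      (mem_extChartAt_target g)
    rwa [ModelWithCorners.Boundaryless.range_eq_univ, contMDiffWithinAt_univ] at this
  have c2 : ContMDiffAt 𝓘(ℝ, EuclideanSpace ℝ (Fin n)) (𝓡 n) ∞ (extChartAt (𝓡 n) k).symm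
      (extChartAt (𝓡 n) k k) := by
    have := contMDiffWithinAt_extChartAt_symm_range (I := 𝓡 n) (n := ∞) k
      (mem_extChartAt_target k)
    rwa [ModelWithCorners.Boundaryless.range_eq_univ, contMDiffWithinAt_univ] at this
  have c3 : ContMDiffAt 𝓘(ℝ, EuclideanSpace ℝ (Fin n) × EuclideanSpace ℝ (Fin n)) 𝓘(ℝ, 𝕜) ∞
      (fun p : EuclideanSpace ℝ (Fin n) × EuclideanSpace ℝ (Fin n) =>
        F ((extChartAt (𝓡 n) g).symm p.1, (extChartAt (𝓡 n) k).symm p.2))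
      (extChartAt (𝓡 n) g g, extChartAt (𝓡 n) k k) := by
    have d1 := ContMDiffAt.comp (extChartAt (𝓡 n) g g, extChartAt (𝓡 n) k k)
      (I' := 𝓘(ℝ, EuclideanSpace ℝ (Fin n)))
      (f := fun p : EuclideanSpace ℝ (Fin n) × EuclideanSpace ℝ (Fin n) => p.1) c1
      (contDiff_fst.contMDiff.contMDiffAt)
    have d2 := ContMDiffAt.comp (extChartAt (𝓡 n) g g, extChartAt (𝓡 n) k k)
      (I' := 𝓘(ℝ, EuclideanSpace ℝ (Fin n)))
      (f := fun p : EuclideanSpace ℝ (Fin n) × EuclideanSpace ℝ (Fin n) => p.2) c2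
      (contDiff_snd.contMDiff.contMDiffAt)
    exact ContMDiffAt.comp (g := F) _ hF.contMDiffAt (d1.prodMk d2)
  exact (contMDiffAt_iff_contDiffAt.1 c3).of_le (WithTop.coe_le_coe.2 (le_top (a := (2 : ℕ∞))))

/-- Mixed partial derivatives of a function on `G × G` commute. -/
theorem diffAt_comm {F : G × G → 𝕜} [IsManifold (𝓡 n) ∞ G]
    (hF : ContMDiff ((𝓡 n).prod (𝓡 n)) 𝓘(ℝ, 𝕜) ∞ F) (g k : G)
    (u : TC 𝕜 n g) (v : TC 𝕜 n k) :
    diffAt n (fun x => diffAt n (fun y => F (x, y)) k v) g u =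
      diffAt n (fun y => diffAt n (fun x => F (x, y)) g u) k v := by
  induction u using TensorProduct.induction_on with
  | zero => simp [diffAt_const]
  | add u₁ u₂ h1 h2 =>
    simp only [map_add, h1, h2]
    rw [diffAt_add n (smooth_diffAt_fst hF g u₁) (smooth_diffAt_fst hF g u₂)]
    rfl
  | tmul c u =>
    induction v using TensorProduct.induction_on with
    | zero => simp [diffAt_const]
    | add v₁ v₂ h1 h2 =>
      simp only [map_add]
      rw [diffAt_add n (smooth_diffAt_snd hF k v₁) (smooth_diffAt_snd hF k v₂),
        LinearMap.add_apply, h1, h2]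
    | tmul d v =>
      simp only [diffAt_tmul]
      have e1 := diffAt_const_mul n (smooth_realDiffAt_snd hF k v) d g
      have e2 := diffAt_const_mul n (smooth_realDiffAt_snd (F := fun p => F (p.2, p.1))
        (hF.comp (contMDiff_snd.prodMk contMDiff_fst)) g u) c k
      have e3 : realDiffAt n (fun x => d * realDiffAt n (fun y => F (x, y)) k v) g u
          = d * realDiffAt n (fun x => realDiffAt n (fun y => F (x, y)) k v) g u := by
        simpa [diffAt_one_tmul] using congrArg (fun L => L ((1 : 𝕜) ⊗ₜ[ℝ] u)) e1
      have e4 : realDiffAt n (fun x => c * realDiffAt n (fun y => F (y, x)) g u) k v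
          = c * realDiffAt n (fun x => realDiffAt n (fun y => F (y, x)) g u) k v := by
        simpa [diffAt_one_tmul] using congrArg (fun L => L ((1 : 𝕜) ⊗ₜ[ℝ] v)) e2
      rw [e3, e4, realDiffAt_comm hF]
      ring

end Analysis

/-! ### Derivatives along commutators of vector fields -/

section Commutator

variable {𝕜 : Type*} [RCLike 𝕜] {n : ℕ}
variable {G : Type*} [TopologicalSpace G] [ChartedSpace (EuclideanSpace ℝ (Fin n)) G]

open VectorField

/-- The derivative along a commutator of vector fields is the commutator of the derivatives. Mathlib
defines the commutator in the chart at `g`, so the proof reduces to the formula on a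
vector space. -/
theorem realDiffAt_mlieBracket [IsManifold (𝓡 n) ∞ G] {a : G → 𝕜} (ha : Smooth n a)
    {V W : ∀ g : G, TangentSpace (𝓡 n) g} (g : G)
    (hV : MDifferentiableAt (𝓡 n) (𝓡 n).tangent
      (fun x => (Bundle.TotalSpace.mk' (EuclideanSpace ℝ (Fin n)) x (V x) :
        TangentBundle (𝓡 n) G)) g)
    (hW : MDifferentiableAt (𝓡 n) (𝓡 n).tangent
      (fun x => (Bundle.TotalSpace.mk' (EuclideanSpace ℝ (Fin n)) x (W x) :
        TangentBundle (𝓡 n) G)) g)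
    (hVa : Smooth n (fun x => realDiffAt n a x (V x)))
    (hWa : Smooth n (fun x => realDiffAt n a x (W x))) :
    realDiffAt n a g (mlieBracket (𝓡 n) V W g) =
      realDiffAt n (fun x => realDiffAt n a x (W x)) g (V g) -
        realDiffAt n (fun x => realDiffAt n a x (V x)) g (W g) := by
  have : IsManifold (𝓡 n) (minSmoothness ℝ 2) G := by
    rw [minSmoothness_of_isRCLikeNormedField]
    exact IsManifold.of_le (n := ∞) (WithTop.coe_le_coe.2 (le_top (a := (2 : ℕ∞))))
  have : IsManifold (𝓡 n) 2 G :=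
    IsManifold.of_le (n := ∞) (WithTop.coe_le_coe.2 (le_top (a := (2 : ℕ∞))))
  have : IsManifold (𝓡 n) 1 G :=
    IsManifold.of_le (n := ∞) (WithTop.coe_le_coe.2 (le_top (a := (1 : ℕ∞))))
  have hu : Set.range (𝓡 n) = Set.univ := ModelWithCorners.Boundaryless.range_eq_univ
  set φ := extChartAt (𝓡 n) g with hφ
  let V' := mpullbackWithin 𝓘(ℝ, EuclideanSpace ℝ (Fin n)) (𝓡 n) φ.symm V (Set.range (𝓡 n))
  let W' := mpullbackWithin 𝓘(ℝ, EuclideanSpace ℝ (Fin n)) (𝓡 n) φ.symm W (Set.range (𝓡 n))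
  let f : EuclideanSpace ℝ (Fin n) → 𝕜 := fun y => a (φ.symm y)
  have hV' : DifferentiableAt ℝ V' (φ g) := by
    have := MDifferentiableWithinAt.differentiableWithinAt_mpullbackWithin_vectorField
      hV.mdifferentiableWithinAt (s := Set.univ)
    rw [Set.preimage_univ, Set.univ_inter] at this
    exact this.differentiableAt (by rw [hu]; exact Filter.univ_mem)
  have hW' : DifferentiableAt ℝ W' (φ g) := by
    have := MDifferentiableWithinAt.differentiableWithinAt_mpullbackWithin_vectorField
      hW.mdifferentiableWithinAt (s := Set.univ)
    rw [Set.preimage_univ, Set.univ_inter] at this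
    exact this.differentiableAt (by rw [hu]; exact Filter.univ_mem)
  have c1 : ∀ y ∈ φ.target, ContMDiffAt 𝓘(ℝ, EuclideanSpace ℝ (Fin n)) (𝓡 n) ∞ φ.symm y := by
    intro y hy
    have := contMDiffWithinAt_extChartAt_symm_range (I := 𝓡 n) (n := ∞) g hy
    rwa [ModelWithCorners.Boundaryless.range_eq_univ, contMDiffWithinAt_univ] at this
  have hf : ContDiffAt ℝ 2 f (φ g) :=
    (contMDiffAt_iff_contDiffAt.1 (ContMDiffAt.comp (g := a) (φ g) ha.contMDiffAt
      (c1 _ (mem_extChartAt_target g)))).of_le (WithTop.coe_le_coe.2 (le_top (a := (2 : ℕ∞))))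
  have key := fderiv_apply_lieBracket hf (by simp) hW' hV'
  have tgt : ∀ᶠ y in nhds (φ g), y ∈ φ.target := by
    exact (isOpen_extChartAt_target g).mem_nhds (mem_extChartAt_target g)
  have push : ∀ (Z : ∀ g : G, TangentSpace (𝓡 n) g), ∀ y ∈ φ.target,
      fderiv ℝ f y (mpullbackWithin 𝓘(ℝ, EuclideanSpace ℝ (Fin n)) (𝓡 n) φ.symm Z
        (Set.range (𝓡 n)) y) = realDiffAt n a (φ.symm y) (Z (φ.symm y)) := by
    intro Z y hy
    have e1 := mfderiv_comp y (ha.mdifferentiableAt (x := φ.symm y) (by simp))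
      ((c1 y hy).mdifferentiableAt (by simp))
    have e2 : fderiv ℝ f y = (mfderiv (𝓡 n) 𝓘(ℝ, 𝕜) a (φ.symm y)).comp
      (mfderiv 𝓘(ℝ, EuclideanSpace ℝ (Fin n)) (𝓡 n) φ.symm y) := by
      rw [← e1, mfderiv_eq_fderiv]; rfl
    have inv := isInvertible_mfderivWithin_extChartAt_symm (I := 𝓡 n) hy
    rw [hu, mfderivWithin_univ] at inv
    have e3 : mfderiv 𝓘(ℝ, EuclideanSpace ℝ (Fin n)) (𝓡 n) φ.symm y
      (mpullbackWithin 𝓘(ℝ, EuclideanSpace ℝ (Fin n)) (𝓡 n) φ.symm Z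
        (Set.range (𝓡 n)) y) = Z (φ.symm y) := by
      rw [mpullbackWithin_apply, hu, mfderivWithin_univ]
      exact inv.self_apply_inverse _
    rw [e2]
    exact congrArg (mfderiv (𝓡 n) 𝓘(ℝ, 𝕜) a (φ.symm y)) e3
  have hb : mlieBracket (𝓡 n) V W g = lieBracket ℝ V' W' (φ g) := by
    have h1 : mlieBracket (𝓡 n) V W g = _ := mlieBracketWithin_apply
    have h2 : ∀ A : EuclideanSpace ℝ (Fin n) →L[ℝ] EuclideanSpace ℝ (Fin n),
        A = ContinuousLinearMap.id ℝ _ → ∀ x, A.inverse x = x := by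
      rintro _ rfl x
      simp
    refine h1.trans ((h2 _ (mfderiv_extChartAt_self (I := 𝓡 n) (x := g)) _).trans ?_)
    rw [Set.preimage_univ, Set.univ_inter]
    change lieBracketWithin ℝ V' W' (Set.range (𝓡 n)) (φ g) = _
    rw [hu]
    exact congrFun (lieBracketWithin_univ (V := V') (W := W')) _
  have at_pt : ∀ Z : ∀ g : G, TangentSpace (𝓡 n) g,
      mpullbackWithin 𝓘(ℝ, EuclideanSpace ℝ (Fin n)) (𝓡 n) φ.symm Z (Set.range (𝓡 n)) (φ g)
        = Z g := by
    intro Z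
    have h0 : φ.symm (φ g) = g := extChartAt_to_inv g
    have h1 : ∀ x, x = g → ∀ v : EuclideanSpace ℝ (Fin n), v = Z x → v = Z g := by
      rintro x rfl v hv; exact hv
    refine h1 _ h0 _ ?_
    rw [mpullbackWithin_apply]
    exact mfderivWithin_extChartAt_symm_inverse_apply (I := 𝓡 n) (x := g) _
  have step : ∀ Z U : ∀ g : G, TangentSpace (𝓡 n) g, Smooth n (fun x => realDiffAt n a x (Z x)) →
      fderiv ℝ (fun y => fderiv ℝ f y (mpullbackWithin 𝓘(ℝ, EuclideanSpace ℝ (Fin n)) (𝓡 n)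
        φ.symm Z (Set.range (𝓡 n)) y)) (φ g) (mpullbackWithin 𝓘(ℝ, EuclideanSpace ℝ (Fin n)) (𝓡 n)
        φ.symm U (Set.range (𝓡 n)) (φ g)) =
      realDiffAt n (fun x => realDiffAt n a x (Z x)) g (U g) := by
    intro Z U hZ
    have e : (fun y => fderiv ℝ f y (mpullbackWithin 𝓘(ℝ, EuclideanSpace ℝ (Fin n)) (𝓡 n)
        φ.symm Z (Set.range (𝓡 n)) y)) =ᶠ[nhds (φ g)]
        fun y => realDiffAt n a (φ.symm y) (Z (φ.symm y)) := tgt.mono fun y hy => push Z y hy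
    rw [e.fderiv_eq, at_pt U, realDiffAt_eq_fderiv (hZ.mdifferentiableAt (by simp))]
  rw [realDiffAt_eq_fderiv (ha.mdifferentiableAt (by simp)), hb]
  exact key.trans (congrArg₂ (· - ·) (step W V hWa) (step V W hVa))

variable [Group G] [LieGroup (𝓡 n) ∞ G]

theorem realDiffAt_lie {a : G → 𝕜} (ha : Smooth n a) (v w : GroupLieAlgebra (𝓡 n) G) (g : G) :
    realDiffAt n a g (realLeftTriv n g ⁅v, w⁆) =
      realDiffAt n (fun x => realDiffAt n a x (realLeftTriv n x w)) g (realLeftTriv n g v) -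
        realDiffAt n (fun x => realDiffAt n a x (realLeftTriv n x v)) g (realLeftTriv n g w) := by
  have h := realDiffAt_mlieBracket ha (V := mulInvariantVectorField v)
    (W := mulInvariantVectorField w) g (mdifferentiableAt_mulInvariantVectorField v)
    (mdifferentiableAt_mulInvariantVectorField w) (smooth_realDiffAt n ha v)
    (smooth_realDiffAt n ha w)
  rw [← mulInvariantVector_mlieBracket] at h
  exact h

theorem diffAt_lie {a : G → 𝕜} (ha : Smooth n a) (v w : LieC 𝕜 n G) (g : G) :
    diffAt n a g (leftTriv 𝕜 n g ⁅v, w⁆) =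
      diffAt n (fun x => diffAt n a x (leftTriv 𝕜 n x w)) g (leftTriv 𝕜 n g v) -
        diffAt n (fun x => diffAt n a x (leftTriv 𝕜 n x v)) g (leftTriv 𝕜 n g w) := by
  induction v using TensorProduct.induction_on with
  | zero => simp [diffAt_const]
  | add v₁ v₂ h1 h2 =>
    simp only [add_lie, map_add, h1, h2]
    rw [diffAt_add n (smooth_diffAt n ha v₁) (smooth_diffAt n ha v₂), LinearMap.add_apply]
    ring
  | tmul c v =>
    induction w using TensorProduct.induction_on with
    | zero =>
      have h0 : ⁅c ⊗ₜ[ℝ] v, (0 : LieC 𝕜 n G)⁆ = 0 := lie_zero (c ⊗ₜ[ℝ] v : LieC 𝕜 n G)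
      simp [diffAt_const, h0]
    | add w₁ w₂ h1 h2 =>
      have h0 : ⁅c ⊗ₜ[ℝ] v, w₁ + w₂⁆ = ⁅c ⊗ₜ[ℝ] v, w₁⁆ + ⁅c ⊗ₜ[ℝ] v, w₂⁆ :=
        lie_add (c ⊗ₜ[ℝ] v : LieC 𝕜 n G) w₁ w₂
      simp only [h0, map_add, h1, h2]
      rw [diffAt_add n (smooth_diffAt n ha w₁) (smooth_diffAt n ha w₂), LinearMap.add_apply]
      ring
    | tmul d w =>
      have e0 : ∀ (e : 𝕜) (x : GroupLieAlgebra (𝓡 n) G) (g : G),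
          leftTriv 𝕜 n g (e ⊗ₜ[ℝ] x) = e ⊗ₜ[ℝ] realLeftTriv n g x := fun _ _ _ => rfl
      have h0 : ⁅c ⊗ₜ[ℝ] v, d ⊗ₜ[ℝ] w⁆ = (c * d) ⊗ₜ[ℝ] ⁅v, w⁆ :=
        LieAlgebra.ExtendScalars.bracket_tmul ..
      simp only [h0, e0, diffAt_tmul, realDiffAt_lie ha]
      have e3 := congrArg (fun L => L ((1 : 𝕜) ⊗ₜ[ℝ] realLeftTriv n g v))
        (diffAt_const_mul n (smooth_realDiffAt n ha w) d g)
      have e4 := congrArg (fun L => L ((1 : 𝕜) ⊗ₜ[ℝ] realLeftTriv n g w))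
        (diffAt_const_mul n (smooth_realDiffAt n ha v) c g)
      simp only [LinearMap.smul_apply, diffAt_one_tmul, smul_eq_mul] at e3 e4
      rw [e3, e4]
      ring

end Commutator

/-! ### Bump functions, and functions with vanishing derivative -/

section Global

variable {𝕜 : Type*} [RCLike 𝕜] {n : ℕ}
variable {G : Type*} [TopologicalSpace G] [ChartedSpace (EuclideanSpace ℝ (Fin n)) G]
  [IsManifold (𝓡 n) ∞ G]

/-- Every real-linear form on the tangent space is the differential of a smooth function: a linear
function in a chart, cut off by a bump function. -/
theorem exists_realDiffAt_eq [T2Space G] (g : G) (φ : TangentSpace (𝓡 n) g →ₗ[ℝ] 𝕜) :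
    ∃ a : G → 𝕜, Smooth n a ∧ realDiffAt n a g = φ := by
  let φ' : EuclideanSpace ℝ (Fin n) →L[ℝ] 𝕜 :=
    LinearMap.toContinuousLinearMap (φ : EuclideanSpace ℝ (Fin n) →ₗ[ℝ] 𝕜)
  let f : SmoothBumpFunction (𝓡 n) g := Classical.arbitrary _
  have hs : ContMDiffOn (𝓡 n) 𝓘(ℝ, 𝕜) ∞ (fun x => φ' (extChartAt (𝓡 n) g x))
      (chartAt (EuclideanSpace ℝ (Fin n)) g).source :=
    φ'.contDiff.contMDiff.comp_contMDiffOn contMDiffOn_extChartAt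
  refine ⟨fun x => f x • φ' (extChartAt (𝓡 n) g x), f.contMDiff_smul hs, ?_⟩
  have he : (fun x => f x • φ' (extChartAt (𝓡 n) g x)) =ᶠ[nhds g]
      fun x => φ' (extChartAt (𝓡 n) g x) := by
    filter_upwards [f.eventuallyEq_one] with x hx
    simp [hx]
  ext v
  have h1 := congrArg (fun L => L v) (he.mfderiv_eq (I := 𝓡 n) (I' := 𝓘(ℝ, 𝕜)))
  have h2 : MDifferentiableAt (𝓡 n) 𝓘(ℝ, 𝕜) (fun x => φ' (extChartAt (𝓡 n) g x)) g :=
    ((hs.contMDiffAt ((chartAt _ g).open_source.mem_nhds (mem_chart_source _ g)))).mdifferentiableAt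
      (by simp)
  refine (h1.trans (realDiffAt_eq_fderiv h2 v)).trans ?_
  have h3 : (fun y => φ' (extChartAt (𝓡 n) g ((extChartAt (𝓡 n) g).symm y)))
      =ᶠ[nhds (extChartAt (𝓡 n) g g)] φ' := by
    filter_upwards [(isOpen_extChartAt_target g).mem_nhds (mem_extChartAt_target (I := 𝓡 n) g)]
      with y hy
    rw [(extChartAt (𝓡 n) g).right_inv hy]
  rw [h3.fderiv_eq, φ'.fderiv]
  rfl

/-- Every cotangent vector is the differential of a smooth function. -/
theorem exists_diffAt_eq [T2Space G] (g : G) (φ : TC 𝕜 n g →ₗ[𝕜] 𝕜) :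
    ∃ a : G → 𝕜, Smooth n a ∧ diffAt n a g = φ := by
  obtain ⟨a, ha, h⟩ := exists_realDiffAt_eq (𝕜 := 𝕜) g
    (φ.restrictScalars ℝ ∘ₗ TensorProduct.mk ℝ 𝕜 (TangentSpace (𝓡 n) g) 1)
  refine ⟨a, ha, ?_⟩
  ext v
  simp [diffAt, h]

/-- A smooth function with vanishing derivative on a connected manifold is constant. -/
theorem eq_of_diffAt_eq_zero [ConnectedSpace G] {a : G → 𝕜} (ha : Smooth n a)
    (h : ∀ g, diffAt n a g = 0) (x y : G) : a x = a y := by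
  have hd : ∀ g, mfderiv (𝓡 n) 𝓘(ℝ, 𝕜) a g = 0 := by
    intro g
    ext v
    have := congrArg (fun L => L ((1 : 𝕜) ⊗ₜ[ℝ] v)) (h g)
    simp only [diffAt_one_tmul, LinearMap.zero_apply] at this
    exact this
  have hl : IsLocallyConstant a := by
    rw [IsLocallyConstant.iff_eventually_eq]
    intro g
    set φ := extChartAt (𝓡 n) g
    obtain ⟨ε, hε, hb⟩ := Metric.isOpen_iff.1 (isOpen_extChartAt_target g) _
      (mem_extChartAt_target (I := 𝓡 n) g)
    have hdf : ∀ y ∈ φ.target, HasFDerivAt (fun y => a (φ.symm y))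
        (0 : EuclideanSpace ℝ (Fin n) →L[ℝ] 𝕜) y := by
      intro y hy
      have c1 : MDifferentiableAt 𝓘(ℝ, EuclideanSpace ℝ (Fin n)) (𝓡 n) φ.symm y := by
        have := contMDiffWithinAt_extChartAt_symm_range (I := 𝓡 n) (n := ∞) g hy
        rw [ModelWithCorners.Boundaryless.range_eq_univ, contMDiffWithinAt_univ] at this
        exact this.mdifferentiableAt (by simp)
      have h1 := (ha.mdifferentiableAt (x := φ.symm y) (by simp)).hasMFDerivAt.comp y
        c1.hasMFDerivAt
      rw [hd] at h1
      have h2 := h1.hasFDerivAt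
      refine h2.congr_fderiv ?_
      ext v
      rfl
    have hu : Metric.ball (φ g) ε ∈ nhds (φ g) := Metric.ball_mem_nhds _ hε
    filter_upwards [(continuousAt_extChartAt (I := 𝓡 n) g).preimage_mem_nhds hu,
      extChartAt_source_mem_nhds (I := 𝓡 n) g] with x hx hxs
    have := (convex_ball (φ g) ε).is_const_of_fderivWithin_eq_zero (𝕜 := ℝ)
      (f := fun y => a (φ.symm y))
      (fun y hy => (hdf y (hb hy)).differentiableAt.differentiableWithinAt)
      (fun y hy => by
        rw [fderivWithin_of_isOpen Metric.isOpen_ball hy, (hdf y (hb hy)).fderiv])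
      hx (Metric.mem_ball_self hε)
    have e1 : φ.symm (φ x) = x := φ.left_inv hxs
    have e2 : φ.symm (φ g) = g := extChartAt_to_inv g
    rwa [e1, e2] at this
  exact hl.apply_eq_of_preconnectedSpace x y

end Global

/-! ### Invariant vector fields and the adjoint representation -/

section InvariantFields

variable {𝕜 : Type*} [RCLike 𝕜] {n : ℕ}
variable {G : Type*} [TopologicalSpace G] [ChartedSpace (EuclideanSpace ℝ (Fin n)) G] [Group G]
  [LieGroup (𝓡 n) ∞ G]

instance finiteDimensional_lieC : FiniteDimensional 𝕜 (LieC 𝕜 n G) :=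
  inferInstanceAs (FiniteDimensional 𝕜 (𝕜 ⊗[ℝ] EuclideanSpace ℝ (Fin n)))

omit [Group G] [LieGroup (𝓡 n) ∞ G] in
@[ext]
theorem Cinf.ext {a b : Cinf 𝕜 n G} (h : ∀ g, a.1 g = b.1 g) : a = b :=
  Subtype.ext (funext h)

/-- Evaluation of smooth functions at a point. -/
def evalAt (g : G) : Cinf 𝕜 n G →ₐ[𝕜] 𝕜 :=
  (Pi.evalAlgHom 𝕜 (fun _ : G => 𝕜) g).comp (Cinf 𝕜 n G).val

omit [Group G] [LieGroup (𝓡 n) ∞ G] in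
theorem evalAt_apply (g : G) (a : Cinf 𝕜 n G) : evalAt g a = a.1 g := rfl

theorem diffAt_comp_leftMul {a : G → 𝕜} (ha : Smooth n a) (g h : G) :
    diffAt n (fun x => a (g * x)) h = diffAt n a (g * h) ∘ₗ leftPush 𝕜 n g h :=
  diffAt_comp ha contMDiff_mul_left h

theorem diffAt_comp_rightMul {a : G → 𝕜} (ha : Smooth n a) (g h : G) :
    diffAt n (fun x => a (x * h)) g = diffAt n a (g * h) ∘ₗ rightPush 𝕜 n g h :=
  diffAt_comp ha contMDiff_mul_right g

theorem leftTriv_one (v : LieC 𝕜 n G) : leftTriv 𝕜 n (1 : G) v = v := by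
  have key : ∀ x : GroupLieAlgebra (𝓡 n) G, realLeftTriv n (1 : G) x = x := by
    intro x
    have h : (fun y : G => 1 * y) = id := by funext y; simp
    change mfderiv (𝓡 n) (𝓡 n) (fun y : G => 1 * y) 1 x = x
    rw [h]
    exact congrArg (fun L => L x) (mfderiv_id (I := 𝓡 n) (x := (1 : G)))
  induction v using TensorProduct.induction_on with
  | zero => exact map_zero _
  | tmul c x => exact congrArg (fun z => c ⊗ₜ[ℝ] z) (key x)
  | add x y hx hy => exact (map_add _ _ _).trans (congrArg₂ (· + ·) hx hy)

/-- The left-invariant vector field generated by `v ∈ 𝔤`, as a derivation of `C^∞(G)`. -/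
def leftDer (v : LieC 𝕜 n G) : Derivation 𝕜 (Cinf 𝕜 n G) (Cinf 𝕜 n G) :=
  Derivation.mk'
    { toFun := fun a => ⟨fun g => diffAt n a.1 g (leftTriv 𝕜 n g v), smooth_diffAt n a.2 v⟩
      map_add' := fun a b => Cinf.ext fun g =>
        congrArg (fun L => L (leftTriv 𝕜 n g v)) (diffAt_add n a.2 b.2 g)
      map_smul' := fun c a => Cinf.ext fun g =>
        congrArg (fun L => L (leftTriv 𝕜 n g v)) (diffAt_const_mul n a.2 c g) }
    fun a b => Cinf.ext fun g =>
      congrArg (fun L => L (leftTriv 𝕜 n g v)) (diffAt_mul a.2 b.2 g)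

theorem leftDer_apply (v : LieC 𝕜 n G) (a : Cinf 𝕜 n G) (g : G) :
    (leftDer v a).1 g = diffAt n a.1 g (leftTriv 𝕜 n g v) := rfl

theorem leftDer_one (v : LieC 𝕜 n G) (a : Cinf 𝕜 n G) :
    (leftDer v a).1 1 = diffAt n a.1 1 v := by
  rw [leftDer_apply, leftTriv_one]

theorem leftDer_leftPull (v : LieC 𝕜 n G) (a : Cinf 𝕜 n G) (g h : G) :
    (leftDer v (leftPull0 g a)).1 h = (leftDer v a).1 (g * h) := by
  rw [leftDer_apply, leftDer_apply, ← leftPush_leftTriv]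
  exact congrArg (fun L => L (leftTriv 𝕜 n h v)) (diffAt_comp_leftMul a.2 g h)

theorem leftDer_rightPull (v : LieC 𝕜 n G) (a : Cinf 𝕜 n G) (g h : G) :
    (leftDer v (rightPull0 h a)).1 g = (leftDer (AdInv n h v) a).1 (g * h) := by
  rw [leftDer_apply, leftDer_apply, ← rightPush_leftTriv]
  exact congrArg (fun L => L (leftTriv 𝕜 n g v)) (diffAt_comp_rightMul a.2 g h)

theorem leftDer_eq_diffAt_one (v : LieC 𝕜 n G) (a : Cinf 𝕜 n G) (g : G) :
    (leftDer v a).1 g = diffAt n (fun x => a.1 (g * x)) 1 v := by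
  have h := leftDer_leftPull v a g 1
  rw [mul_one, leftDer_one] at h
  exact h.symm

theorem leftDer_add (v w : LieC 𝕜 n G) : leftDer (v + w) = leftDer v + leftDer w := by
  ext a g
  change diffAt n a.1 g (leftTriv 𝕜 n g (v + w)) = _
  rw [map_add, map_add]; rfl

theorem leftDer_smul (c : 𝕜) (v : LieC 𝕜 n G) : leftDer (c • v) = c • leftDer v := by
  ext a g
  change diffAt n a.1 g (leftTriv 𝕜 n g (c • v)) = _
  rw [map_smul, map_smul]; rfl

theorem leftDer_lie (v w : LieC 𝕜 n G) (a : Cinf 𝕜 n G) :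
    leftDer ⁅v, w⁆ a = leftDer v (leftDer w a) - leftDer w (leftDer v a) := by
  ext g
  exact diffAt_lie a.2 v w g

variable (𝕜 n G) in
/-- The action of `𝔤` on `C^∞(G)` by left-invariant vector fields. -/
def leftField : LieC 𝕜 n G →ₗ⁅𝕜⁆ Derivation 𝕜 (Cinf 𝕜 n G) (Cinf 𝕜 n G) where
  toFun := leftDer
  map_add' := leftDer_add
  map_smul' := leftDer_smul
  map_lie' := fun {v w} => Derivation.ext fun a => leftDer_lie v w a

theorem contMDiff_mul_right_translate (a : Cinf 𝕜 n G) (g : G) :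
    ContMDiff ((𝓡 n).prod (𝓡 n)) 𝓘(ℝ, 𝕜) ∞ (fun p : G × G => a.1 (p.1 * (p.2 * g))) :=
  ContMDiff.comp (g := a.1) a.2 (contMDiff_fst.mul (contMDiff_snd.mul contMDiff_const))

theorem smooth_rightDer (v : LieC 𝕜 n G) (a : Cinf 𝕜 n G) :
    Smooth n (fun g : G => diffAt n (fun x => a.1 (x * g)) 1 v) := by
  have h : ContMDiff ((𝓡 n).prod (𝓡 n)) 𝓘(ℝ, 𝕜) ∞ (fun p : G × G => a.1 (p.2 * p.1)) :=
    ContMDiff.comp (g := a.1) a.2 (contMDiff_snd.mul contMDiff_fst)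
  exact smooth_diffAt_snd h 1 v

/-- Minus the right-invariant vector field generated by `v ∈ 𝔤`, as a derivation of `C^∞(G)`. With
this sign, `v ↦ rightDer v` is a homomorphism of Lie algebras. -/
def rightDer (v : LieC 𝕜 n G) : Derivation 𝕜 (Cinf 𝕜 n G) (Cinf 𝕜 n G) :=
  Derivation.mk'
    { toFun := fun a => ⟨fun g => -diffAt n (fun x => a.1 (x * g)) 1 v, by
        have h := (Smooth.const n (-1 : 𝕜)).mul n (smooth_rightDer v a)
        simpa only [neg_one_mul] using! h⟩
      map_add' := fun a b => Cinf.ext fun g => by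
        have h := congrArg (fun L => L v)
          (diffAt_add n (rightPull0 g a).2 (rightPull0 g b).2 (1 : G))
        exact (congrArg (- ·) h).trans (neg_add _ _)
      map_smul' := fun c a => Cinf.ext fun g => by
        have h := congrArg (fun L => L v) (diffAt_const_mul n (rightPull0 g a).2 c (1 : G))
        exact (congrArg (- ·) h).trans (mul_neg _ _).symm }
    fun a b => Cinf.ext fun g => by
      have h := congrArg (fun L => L v) (diffAt_mul (rightPull0 g a).2 (rightPull0 g b).2 (1 : G))
      refine (congrArg (- ·) h).trans ?_
      change -(a.1 (1 * g) * diffAt n (fun x => b.1 (x * g)) 1 v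
        + b.1 (1 * g) * diffAt n (fun x => a.1 (x * g)) 1 v)
        = a.1 g * -diffAt n (fun x => b.1 (x * g)) 1 v +
          b.1 g * -diffAt n (fun x => a.1 (x * g)) 1 v
      rw [one_mul]
      ring

theorem rightDer_apply (v : LieC 𝕜 n G) (a : Cinf 𝕜 n G) (g : G) :
    (rightDer v a).1 g = -diffAt n (fun x => a.1 (x * g)) 1 v := rfl

theorem rightDer_eq_leftDer (v : LieC 𝕜 n G) (a : Cinf 𝕜 n G) (g : G) :
    (rightDer v a).1 g = -(leftDer v (rightPull0 g a)).1 1 := by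
  rw [leftDer_one]; rfl

theorem rightDer_add (v w : LieC 𝕜 n G) : rightDer (v + w) = rightDer v + rightDer w := by
  ext a g
  exact (congrArg (- ·) (map_add (diffAt n (fun x => a.1 (x * g)) 1) v w)).trans (neg_add _ _)

theorem rightDer_smul (c : 𝕜) (v : LieC 𝕜 n G) : rightDer (c • v) = c • rightDer v := by
  ext a g
  exact (congrArg (- ·) (map_smul (diffAt n (fun x => a.1 (x * g)) 1) c v)).trans
    (mul_neg _ _).symm

theorem rightDer_lie (v w : LieC 𝕜 n G) (a : Cinf 𝕜 n G) :
    rightDer ⁅v, w⁆ a = rightDer v (rightDer w a) - rightDer w (rightDer v a) := by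
  ext g
  have key : ∀ v w : LieC 𝕜 n G, (rightDer v (rightDer w a)).1 g =
      (leftDer w (leftDer v (rightPull0 g a))).1 1 := by
    intro v w
    have h := diffAt_comm (contMDiff_mul_right_translate a g) 1 1 w v
    rw [leftDer_one]
    have e1 : (fun x => diffAt n (fun y => a.1 (x * (y * g))) 1 v) =
        (leftDer v (rightPull0 g a)).1 := by
      funext x
      rw [leftDer_eq_diffAt_one]
      simp only [rightPull0, mul_assoc]
    rw [← e1, h]
    have h2 : (fun y => diffAt n (fun x => a.1 (x * (y * g))) 1 w)
      = fun y => (-1 : 𝕜) * (rightDer w a).1 (y * g) := by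
      funext y
      rw [rightDer_apply, neg_one_mul, neg_neg]
    rw [h2, rightDer_apply]
    have h3 := congrArg (fun L => L v) 
      (diffAt_const_mul n (rightPull0 g (rightDer w a)).2 (-1) (1 : G))
    refine Eq.trans ?_ h3.symm
    exact (neg_one_mul _).symm
  have h' : (leftDer ⁅v, w⁆ (rightPull0 g a)).1 1 =
    (leftDer v (leftDer w (rightPull0 g a))).1 1 - (leftDer w (leftDer v (rightPull0 g a))).1 1 :=
    congrArg (fun b => b.1 1) (leftDer_lie v w (rightPull0 g a))
  have h5 : (rightDer ⁅v, w⁆ a).1 g = -(leftDer ⁅v, w⁆ (rightPull0 g a)).1 1 :=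
    rightDer_eq_leftDer ⁅v, w⁆ a g
  refine h5.trans ?_
  rw [h', ← key v w, ← key w v]
  exact neg_sub _ _

variable (𝕜 n G) in
/-- The action of `𝔤` on `C^∞(G)` by (minus) right-invariant vector fields. -/
def rightField : LieC 𝕜 n G →ₗ⁅𝕜⁆ Derivation 𝕜 (Cinf 𝕜 n G) (Cinf 𝕜 n G) where
  toFun := rightDer
  map_add' := rightDer_add
  map_smul' := rightDer_smul
  map_lie' := fun {v w} => Derivation.ext fun a => rightDer_lie v w a

/-- In the left-invariant frame, the right-invariant field of `v` has the value `Ad_{g⁻¹} v` at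
`g`. -/
theorem rightDer_eq_neg (v : LieC 𝕜 n G) (a : Cinf 𝕜 n G) (g : G) :
    (rightDer v a).1 g = -(leftDer (AdInv n g v) a).1 g := by
  have h := leftDer_rightPull v a 1 g
  rw [one_mul] at h
  rw [← h]
  exact rightDer_eq_leftDer v a g

/-- Left- and right-invariant vector fields commute. -/
theorem leftDer_rightDer_comm (v w : LieC 𝕜 n G) (a : Cinf 𝕜 n G) :
    leftDer v (rightDer w a) = rightDer w (leftDer v a) := by
  ext g
  have hs : ContMDiff ((𝓡 n).prod (𝓡 n)) 𝓘(ℝ, 𝕜) ∞ (fun p : G × G => a.1 (p.1 * (g * p.2))) :=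
    ContMDiff.comp (g := a.1) a.2 (contMDiff_fst.mul (contMDiff_const.mul contMDiff_snd))
  have h := diffAt_comm hs 1 1 w v
  rw [rightDer_apply, leftDer_eq_diffAt_one]
  have e1 : (fun x => (leftDer v a).1 (x * g)) =
      fun x => diffAt n (fun y => a.1 (x * (g * y))) 1 v := by
    funext x
    rw [leftDer_eq_diffAt_one]
    simp only [mul_assoc]
  have e2 : (fun y => (rightDer w a).1 (g * y)) =
      fun y => (-1 : 𝕜) * diffAt n (fun x => a.1 (x * (g * y))) 1 w := by
    funext y
    rw [rightDer_apply, neg_one_mul]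
  rw [e1, e2, h, diffAt_const_mul n (smooth_diffAt_fst hs 1 w), LinearMap.smul_apply, smul_eq_mul,
    neg_one_mul]

theorem leftDer_lie_rightDer (v w : LieC 𝕜 n G) :
    ⁅(leftDer v : Derivation 𝕜 (Cinf 𝕜 n G) (Cinf 𝕜 n G)), rightDer w⁆ = 0 := by
  ext a : 1
  rw [Derivation.commutator_apply, leftDer_rightDer_comm, sub_self]
  rfl

/-- The differential of `a` at `g` in the left trivialization, `L̂_a(g)(v) = a'(g; g v)`. -/
theorem tilde_d0 (a : Cinf 𝕜 n G) (g : G) (v : LieC 𝕜 n G) :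
    tilde (d0 a) g v = (leftDer v a).1 g := rfl

theorem leftDer_sum_apply {ι : Type*} (s : Finset ι) (c : ι → 𝕜) (v : ι → LieC 𝕜 n G)
    (b : Cinf 𝕜 n G) (g : G) :
    (leftDer (∑ i ∈ s, c i • v i) b).1 g = ∑ i ∈ s, c i * (leftDer (v i) b).1 g := by
  simp only [← tilde_d0, map_sum, map_smul, smul_eq_mul]

theorem leftDer_coord {ι : Type*} [Fintype ι] (e : Module.Basis ι 𝕜 (LieC 𝕜 n G))
    (v : LieC 𝕜 n G) (b : Cinf 𝕜 n G) (g : G) :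
    (leftDer v b).1 g = ∑ i, e.coord i v * (leftDer (e i) b).1 g := by
  refine Eq.trans ?_ (leftDer_sum_apply Finset.univ (fun i => e.coord i v) e b g)
  exact congrArg (fun v => (leftDer v b).1 g) (e.sum_repr v).symm

variable [T2Space G]

/-- Every linear form on `𝔤` is the differential of a smooth
function at a given point, in the left trivialization. -/
theorem exists_leftDer_eq (g : G) (φ : LieC 𝕜 n G →ₗ[𝕜] 𝕜) :
    ∃ a : Cinf 𝕜 n G, ∀ v, (leftDer v a).1 g = φ v := by
  obtain ⟨a, ha, h⟩ := exists_diffAt_eq (𝕜 := 𝕜) g (φ ∘ₗ (leftTriv 𝕜 n g).symm.toLinearMap)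
  refine ⟨⟨a, ha⟩, fun v => ?_⟩
  exact (congrArg (fun L => L (leftTriv 𝕜 n g v)) h).trans
    (congrArg φ ((leftTriv 𝕜 n g).symm_apply_apply v))

theorem eq_of_leftDer_eq (g : G) {v w : LieC 𝕜 n G}
    (h : ∀ a : Cinf 𝕜 n G, (leftDer v a).1 g = (leftDer w a).1 g) : v = w := by
  rw [← sub_eq_zero, ← Module.forall_dual_apply_eq_zero_iff 𝕜]
  intro φ
  obtain ⟨a, ha⟩ := exists_leftDer_eq g φ
  rw [map_sub, ← ha, ← ha, h, sub_self]

theorem AdInv_lie (h : G) (v w : LieC 𝕜 n G) :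
    AdInv n h ⁅v, w⁆ = ⁅AdInv n h v, AdInv n h w⁆ := by
  refine eq_of_leftDer_eq h fun a => ?_
  have e : ∀ (v : LieC 𝕜 n G) (b : Cinf 𝕜 n G), leftDer v (rightPull0 h b) =
      rightPull0 h (leftDer (AdInv n h v) b) := fun v b => Cinf.ext fun g =>
    leftDer_rightPull v b g h
  have h1 := leftDer_rightPull ⁅v, w⁆ a 1 h
  rw [one_mul] at h1
  rw [← h1, leftDer_lie, leftDer_lie, e, e, e, e]
  change (leftDer (AdInv n h v) (leftDer (AdInv n h w) a)).1 (1 * h) -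
    (leftDer (AdInv n h w) (leftDer (AdInv n h v) a)).1 (1 * h) = _
  rw [one_mul]
  rfl

theorem AdInv_AdInv_inv (h : G) (v : LieC 𝕜 n G) : AdInv n h (AdInv n h⁻¹ v) = v := by
  refine eq_of_leftDer_eq h fun a => ?_
  have h1 := leftDer_rightPull (AdInv n h⁻¹ v) a 1 h
  have h2 := leftDer_rightPull v (rightPull0 h a) h h⁻¹
  have h3 : rightPull0 h⁻¹ (rightPull0 h a) = a := by
    ext g
    simp [rightPull0]
  rw [mul_inv_cancel, h3] at h2
  rw [one_mul] at h1
  rw [← h1, ← h2]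

theorem smooth_AdInv (ψ : LieC 𝕜 n G →ₗ[𝕜] 𝕜) (w : LieC 𝕜 n G) :
    Smooth n (fun g : G => ψ (AdInv n g w)) := by
  obtain ⟨a, ha⟩ := exists_leftDer_eq (1 : G) ψ
  have hs : ContMDiff ((𝓡 n).prod (𝓡 n)) 𝓘(ℝ, 𝕜) ∞
      (fun p : G × G => a.1 (p.1⁻¹ * (p.2 * p.1))) :=
    ContMDiff.comp (g := a.1) a.2 ((contMDiff_fst.inv).mul (contMDiff_snd.mul contMDiff_fst))
  have h := smooth_diffAt_snd hs 1 w
  convert h using 2 with g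
  have h1 := rightDer_eq_neg w (leftPull0 g⁻¹ a) g
  rw [rightDer_apply, neg_inj, leftDer_leftPull, inv_mul_cancel, ha] at h1
  exact h1.symm

/-- The matrix coefficient `g ↦ ψ(Ad_{g⁻¹} w)` of the adjoint representation. -/
def adCoeff (ψ : LieC 𝕜 n G →ₗ[𝕜] 𝕜) (w : LieC 𝕜 n G) : Cinf 𝕜 n G :=
  ⟨fun g => ψ (AdInv n g w), smooth_AdInv ψ w⟩

/-- The derivative of `g ↦ ψ(Ad_{g⁻¹} w)` along a left-invariant field, in one coordinate. -/
theorem leftDer_adCoeff_coord {ι : Type*} [Fintype ι] (e : Module.Basis ι 𝕜 (LieC 𝕜 n G))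
    (u w : LieC 𝕜 n G) (g : G) (i : ι) :
    (leftDer u (adCoeff (e.coord i) w)).1 g = e.coord i ⁅AdInv n g w, u⁆ := by
  -- expand the right-invariant field in the left-invariant frame and use that it commutes with `u`
  have hY : ∀ b : Cinf 𝕜 n G, -rightDer w b = ∑ i, adCoeff (e.coord i) w * leftDer (e i) b := by
    intro b
    ext g
    change -(rightDer w b).1 g = evalAt g (∑ i, adCoeff (e.coord i) w * leftDer (e i) b)
    rw [rightDer_eq_neg, neg_neg, map_sum, leftDer_coord e]
    rfl
  suffices h : ∑ i, (leftDer u (adCoeff (e.coord i) w)).1 g • e i = ⁅AdInv n g w, u⁆ by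
    classical
    rw [← h, map_sum]
    simp [Finsupp.single_apply]
  refine eq_of_leftDer_eq g fun a => ?_
  rw [leftDer_sum_apply]
  have h1 := congrArg (evalAt g) (congrArg (leftDer u) (hY a))
  have h2 := congrArg (evalAt g) (hY (leftDer u a))
  rw [← leftDer_rightDer_comm, ← map_neg] at h2
  have h3 := h1.symm.trans h2
  simp only [map_sum, Derivation.leibniz, smul_eq_mul, map_add, map_mul,
    Finset.sum_add_distrib] at h3
  have hA : leftDer (AdInv n g w) a = ∑ i, e.coord i (AdInv n g w) • leftDer (e i) a := by
    ext h
    rw [leftDer_coord e, ← evalAt_apply, map_sum]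
    rfl
  have h5 : (leftDer u (∑ i, e.coord i (AdInv n g w) • leftDer (e i) a)).1 g =
      ∑ i, e.coord i (AdInv n g w) * (leftDer u (leftDer (e i) a)).1 g := by
    rw [← evalAt_apply, map_sum, map_sum]
    refine Finset.sum_congr rfl fun i _ => ?_
    rw [Derivation.map_smul]
    rfl
  have h4 : (leftDer ⁅AdInv n g w, u⁆ a).1 g =
      ∑ i, e.coord i (AdInv n g w) * (leftDer (e i) (leftDer u a)).1 g
      - ∑ i, e.coord i (AdInv n g w) * (leftDer u (leftDer (e i) a)).1 g := by
    rw [leftDer_lie, hA, ← h5, ← leftDer_coord]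
    rfl
  rw [h4, eq_sub_iff_add_eq, add_comm]
  refine Eq.trans ?_ h3
  refine congrArg₂ (· + ·) rfl (Finset.sum_congr rfl fun i _ => ?_)
  exact mul_comm _ _

/-- The derivative of a matrix coefficient of `g ↦ Ad_{g⁻¹}` along a left-invariant field. -/
theorem leftDer_adCoeff (ψ : LieC 𝕜 n G →ₗ[𝕜] 𝕜) (u w : LieC 𝕜 n G) (g : G) :
    (leftDer u (adCoeff ψ w)).1 g = ψ ⁅AdInv n g w, u⁆ := by
  let e := Module.finBasis 𝕜 (LieC 𝕜 n G)
  have h1 : ∀ v, ψ v = ∑ i, ψ (e i) * e.coord i v := by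
    intro v
    refine (congrArg ψ (e.sum_repr v).symm).trans ?_
    rw [map_sum]
    refine Finset.sum_congr rfl fun i _ => ?_
    rw [map_smul, smul_eq_mul, mul_comm]
    rfl
  have h2 : adCoeff ψ w = ∑ i, ψ (e i) • adCoeff (e.coord i) w := by
    ext h
    change ψ (AdInv n h w) = evalAt h _
    rw [h1, map_sum]
    rfl
  rw [h2, h1]
  rw [← evalAt_apply]
  rw [map_sum, map_sum]
  refine Finset.sum_congr rfl fun i _ => ?_
  rw [Derivation.map_smul, ← leftDer_adCoeff_coord]
  rfl

end InvariantFields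

/-! ### Tensors and pairs of linear forms -/

section Pairing

variable {𝕜 : Type*} [RCLike 𝕜] {V W : Type*} [AddCommGroup V] [Module 𝕜 V]
  [AddCommGroup W] [Module 𝕜 W]

theorem pair_tmul (u v : V) (α β : V →ₗ[𝕜] 𝕜) : pair (u ⊗ₜ v) α β = α u * β v := by
  simp [pair]

theorem pair_add (s t : V ⊗[𝕜] V) (α β : V →ₗ[𝕜] 𝕜) :
    pair (s + t) α β = pair s α β + pair t α β := by
  simp [pair]

theorem pair_neg (t : V ⊗[𝕜] V) (α β : V →ₗ[𝕜] 𝕜) : pair (-t) α β = -pair t α β := by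
  simp [pair]

theorem pair_sub (s t : V ⊗[𝕜] V) (α β : V →ₗ[𝕜] 𝕜) :
    pair (s - t) α β = pair s α β - pair t α β := by
  simp [pair]

theorem pair_sum {ι : Type*} (s : Finset ι) (p q : ι → V) (α β : V →ₗ[𝕜] 𝕜) :
    pair (∑ i ∈ s, p i ⊗ₜ[𝕜] q i) α β = ∑ i ∈ s, α (p i) * β (q i) := by
  simp [pair]

theorem pair_map (f g : V →ₗ[𝕜] W) (t : V ⊗[𝕜] V) (α β : W →ₗ[𝕜] 𝕜) :
    pair (TensorProduct.map f g t) α β = pair t (α ∘ₗ f) (β ∘ₗ g) := by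
  simp only [pair, TensorProduct.map_comp, LinearMap.comp_apply]

theorem pair_comm (t : V ⊗[𝕜] V) (α β : V →ₗ[𝕜] 𝕜) :
    pair (TensorProduct.comm 𝕜 V V t) α β = pair t β α := by
  induction t using TensorProduct.induction_on with
  | zero => simp [pair]
  | tmul u v => simp [pair_tmul, mul_comm]
  | add s t hs ht => rw [map_add, pair_add, pair_add, hs, ht]

theorem eq_zero_of_pair_eq_zero [FiniteDimensional 𝕜 V] {t : V ⊗[𝕜] V}
    (h : ∀ α β : V →ₗ[𝕜] 𝕜, pair t α β = 0) : t = 0 := by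
  let e := Module.finBasis 𝕜 V
  refine (e.tensorProduct e).ext_elem fun ⟨i, j⟩ => ?_
  have key : ∀ t, (e.tensorProduct e).repr t (i, j) = pair t (e.coord i) (e.coord j) := by
    intro t
    induction t using TensorProduct.induction_on with
    | zero => simp [pair]
    | tmul u v => simp [pair_tmul, mul_comm]
    | add s t hs ht => rw [map_add, pair_add, Finsupp.add_apply, hs, ht]
  rw [key, h, map_zero]
  rfl

end Pairing

/-! ### Symmetric and antisymmetric part of a tensor -/

section SymmetricPart

variable {𝕜 : Type*} [RCLike 𝕜] {L : Type*} [LieRing L] [LieAlgebra 𝕜 L]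

theorem symPart_add_skewPart (r : L ⊗[𝕜] L) : symPart r + skewPart r = r := by
  rw [symPart, skewPart, ← smul_add]
  rw [show r + TensorProduct.comm 𝕜 L L r + (r - TensorProduct.comm 𝕜 L L r) = (2 : 𝕜) • r by
    rw [two_smul]; abel]
  rw [smul_smul, inv_mul_cancel₀ two_ne_zero, one_smul]

theorem comm_skewPart (r : L ⊗[𝕜] L) : TensorProduct.comm 𝕜 L L (skewPart r) = -skewPart r := by
  rw [skewPart, map_smul, map_sub, ← smul_neg]
  congr 1
  rw [show TensorProduct.comm 𝕜 L L (TensorProduct.comm 𝕜 L L r) = r from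
    (TensorProduct.comm 𝕜 L L).symm_apply_apply r, neg_sub]

theorem comm_lie_tensor (v : L) (r : L ⊗[𝕜] L) :
    TensorProduct.comm 𝕜 L L ⁅v, r⁆ = ⁅v, TensorProduct.comm 𝕜 L L r⁆ := by
  induction r using TensorProduct.induction_on with
  | zero => simp
  | tmul x y => simp [TensorProduct.LieModule.lie_tmul_right, add_comm]
  | add s t hs ht => simp [hs, ht]

end SymmetricPart

/-! ### The Poisson bracket and its infinitesimal multiplicativity -/

section Bracket

variable {𝕜 : Type*} [RCLike 𝕜] {n : ℕ}
variable {G : Type*} [TopologicalSpace G] [ChartedSpace (EuclideanSpace ℝ (Fin n)) G] [Group G]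
  [LieGroup (𝓡 n) ∞ G]

namespace PoissonLieStructure

variable (P : PoissonLieStructure 𝕜 n G)

omit [LieGroup (𝓡 n) ∞ G] in
theorem bracket_apply (a b : Cinf 𝕜 n G) (g : G) :
    (P.bracket a b).1 g = pair (P.biv g) (diffAt n a.1 g) (diffAt n b.1 g) := rfl

/-- The bivector field in the left trivialization. -/
def leftBiv (g : G) : LieC 𝕜 n G ⊗[𝕜] LieC 𝕜 n G :=
  TensorProduct.map (leftTriv 𝕜 n g).symm.toLinearMap (leftTriv 𝕜 n g).symm.toLinearMap (P.biv g)

theorem bracket_eq_pair (a b : Cinf 𝕜 n G) (g : G) :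
    (P.bracket a b).1 g = pair (P.leftBiv g) (tilde (d0 a) g) (tilde (d0 b) g) := by
  rw [leftBiv, pair_map, bracket_apply]
  have e : ∀ c : Cinf 𝕜 n G, tilde (d0 c) g ∘ₗ (leftTriv 𝕜 n g).symm.toLinearMap =
      diffAt n c.1 g := by
    intro c
    ext v
    simp [tilde, d0]
  rw [e, e]

theorem exists_bracket_eq_sum (g : G) : ∃ S : Finset (LieC 𝕜 n G × LieC 𝕜 n G),
    ∀ a b : Cinf 𝕜 n G, (P.bracket a b).1 g =
      ∑ i ∈ S, (leftDer i.1 a).1 g * (leftDer i.2 b).1 g := by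
  obtain ⟨S, hS⟩ := TensorProduct.exists_finset (P.leftBiv g)
  refine ⟨S, fun a b => ?_⟩
  rw [bracket_eq_pair, hS, pair_sum]
  rfl

omit [LieGroup (𝓡 n) ∞ G] in
theorem bracket_skew (a b : Cinf 𝕜 n G) : P.bracket a b = -P.bracket b a := by
  ext g
  change pair _ _ _ = -pair _ _ _
  rw [← pair_comm, P.skew, pair_neg]

omit [LieGroup (𝓡 n) ∞ G] in
theorem bracket_add_right (a b c : Cinf 𝕜 n G) :
    P.bracket a (b + c) = P.bracket a b + P.bracket a c := by
  ext g
  change pair _ _ (diffAt n (fun h => b.1 h + c.1 h) g) = (P.bracket a b).1 g + (P.bracket a c).1 g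
  rw [diffAt_add n b.2 c.2, bracket_apply, bracket_apply]
  simp [pair, TensorProduct.map_add_right]

omit [LieGroup (𝓡 n) ∞ G] in
theorem bracket_smul_right (a : Cinf 𝕜 n G) (k : 𝕜) (b : Cinf 𝕜 n G) :
    P.bracket a (k • b) = k • P.bracket a b := by
  ext g
  change pair _ _ (diffAt n (fun h => k * b.1 h) g) = k * (P.bracket a b).1 g
  rw [diffAt_const_mul n b.2, bracket_apply]
  simp [pair, TensorProduct.map_smul_right]

omit [LieGroup (𝓡 n) ∞ G] in
theorem bracket_mul_right (a b c : Cinf 𝕜 n G) :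
    P.bracket a (b * c) = b * P.bracket a c + c * P.bracket a b := by
  ext g
  change pair _ _ (diffAt n (fun h => b.1 h * c.1 h) g) =
    b.1 g * (P.bracket a c).1 g + c.1 g * (P.bracket a b).1 g
  rw [diffAt_mul b.2 c.2, bracket_apply, bracket_apply]
  simp [pair, TensorProduct.map_add_right, TensorProduct.map_smul_right]

omit [LieGroup (𝓡 n) ∞ G] in
theorem bracket_add_left (a b c : Cinf 𝕜 n G) :
    P.bracket (a + b) c = P.bracket a c + P.bracket b c := by
  rw [P.bracket_skew, bracket_add_right, neg_add, ← P.bracket_skew, ← P.bracket_skew]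

omit [LieGroup (𝓡 n) ∞ G] in
theorem bracket_smul_left (k : 𝕜) (a b : Cinf 𝕜 n G) :
    P.bracket (k • a) b = k • P.bracket a b := by
  rw [P.bracket_skew, bracket_smul_right, ← smul_neg, ← P.bracket_skew]

/-- The Hamiltonian derivation `{a, -}`. -/
def ham : Cinf 𝕜 n G →ₗ[𝕜] Derivation 𝕜 (Cinf 𝕜 n G) (Cinf 𝕜 n G) where
  toFun a := Derivation.mk'
    { toFun := P.bracket a
      map_add' := P.bracket_add_right a
      map_smul' := P.bracket_smul_right a } (P.bracket_mul_right a)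
  map_add' a b := Derivation.ext fun c => P.bracket_add_left a b c
  map_smul' k a := Derivation.ext fun c => P.bracket_smul_left k a c

omit [LieGroup (𝓡 n) ∞ G] in
theorem ham_apply (a b : Cinf 𝕜 n G) : P.ham a b = P.bracket a b := rfl

omit [LieGroup (𝓡 n) ∞ G] in
theorem ham_skew (a b : Cinf 𝕜 n G) : P.ham a b = -P.ham b a := P.bracket_skew a b

omit [LieGroup (𝓡 n) ∞ G] in
theorem ham_mul_left (a b c : Cinf 𝕜 n G) : P.ham (a * b) c = a * P.ham b c + b * P.ham a c := by
  rw [ham_skew, Derivation.leibniz, P.ham_skew b c, P.ham_skew a c]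
  simp only [smul_eq_mul]
  ring

omit [LieGroup (𝓡 n) ∞ G] in
theorem ham_jacobi (a b c : Cinf 𝕜 n G) :
    P.ham a (P.ham b c) - P.ham b (P.ham a c) - P.ham (P.ham a b) c = 0 := by
  have h : P.ham a (P.ham b c) + P.ham b (P.ham c a) + P.ham c (P.ham a b) = 0 :=
    Cinf.ext fun g => P.jacobi a.1 b.1 c.1 a.2 b.2 c.2 g
  rw [P.ham_skew c a, map_neg, P.ham_skew c (P.ham a b)] at h
  rw [← h]
  ring

/-- Multiplicativity of the bivector field, in terms of brackets. -/
theorem bracket_mul (a b : Cinf 𝕜 n G) (g h : G) :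
    (P.bracket a b).1 (g * h) = (P.bracket (leftPull0 g a) (leftPull0 g b)).1 h +
      (P.bracket (rightPull0 h a) (rightPull0 h b)).1 g := by
  simp only [bracket_apply]
  rw [P.multiplicative, pair_add, pair_map, pair_map, ← diffAt_comp_leftMul a.2,
    ← diffAt_comp_leftMul b.2, ← diffAt_comp_rightMul a.2, ← diffAt_comp_rightMul b.2]
  rfl

/-- A multiplicative bivector field vanishes at the identity. -/
theorem bracket_one (a b : Cinf 𝕜 n G) : (P.bracket a b).1 1 = 0 := by
  have h := P.bracket_mul a b 1 1
  have e1 : ∀ c : Cinf 𝕜 n G, leftPull0 1 c = c := fun c => by ext g; simp [leftPull0]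
  have e2 : ∀ c : Cinf 𝕜 n G, rightPull0 1 c = c := fun c => by ext g; simp [rightPull0]
  rw [e1, e1, e2, e2, mul_one] at h
  simpa using h

/-- The cobracket condition at `e`, transported to `g` by left translation. -/
theorem leftDer_bracket_leftPull {r : LieC 𝕜 n G ⊗[𝕜] LieC 𝕜 n G} (hr : IsQuasitriangular P r)
    (v : LieC 𝕜 n G) (a b : Cinf 𝕜 n G) (g : G) :
    (leftDer v (P.bracket (leftPull0 g a) (leftPull0 g b))).1 1 =
      pair ⁅v, r⁆ (tilde (d0 a) g) (tilde (d0 b) g) := by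
  rw [leftDer_one, hr.cobracket, adTensor]
  have e : ∀ c : Cinf 𝕜 n G, diffAt n (leftPull0 g c).1 1 = tilde (d0 c) g := by
    intro c
    refine LinearMap.ext fun v => ?_
    rw [tilde_d0, leftDer_eq_diffAt_one]
    rfl
  rw [e, e]

/-- Infinitesimal form of multiplicativity: a left-invariant field fails to be a derivation of the
Poisson bracket by the coboundary `ad_v(r)`. -/
theorem leftDer_bracket {r : LieC 𝕜 n G ⊗[𝕜] LieC 𝕜 n G} (hr : IsQuasitriangular P r)
    (v : LieC 𝕜 n G) (a b : Cinf 𝕜 n G) (g : G) :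
    (leftDer v (P.bracket a b)).1 g = (P.bracket (leftDer v a) b).1 g +
      (P.bracket a (leftDer v b)).1 g + pair ⁅v, r⁆ (tilde (d0 a) g) (tilde (d0 b) g) := by
  obtain ⟨S, hS⟩ := P.exists_bracket_eq_sum g
  have hsm : ∀ c : Cinf 𝕜 n G, ContMDiff ((𝓡 n).prod (𝓡 n)) 𝓘(ℝ, 𝕜) ∞
      (fun p : G × G => c.1 (p.2 * p.1)) := fun c =>
    ContMDiff.comp (g := c.1) c.2 (contMDiff_snd.mul contMDiff_fst)
  -- by multiplicativity, `{a, b}(g k)` is `{L_g^* a, L_g^* b}(k)` plus the bracket at `g` of the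
  -- right translates by `k`; the second summand is a sum of products `A a p * A b q`,
  -- functions of `k`
  let A : Cinf 𝕜 n G → LieC 𝕜 n G → Cinf 𝕜 n G := fun c p =>
    ⟨fun k => (leftDer p (rightPull0 k c)).1 g, smooth_diffAt_snd (hsm c) g (leftTriv 𝕜 n g p)⟩
  have hA1 : ∀ c p, (A c p).1 1 = (leftDer p c).1 g := by
    intro c p
    have e2 : rightPull0 1 c = c := by ext g; simp [rightPull0]
    change (leftDer p (rightPull0 1 c)).1 g = _
    rw [e2]
  have hA2 : ∀ c p, (leftDer v (A c p)).1 1 = (leftDer p (leftDer v c)).1 g := by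
    intro c p
    rw [leftDer_one]
    refine (diffAt_comm (hsm c) 1 g v (leftTriv 𝕜 n g p)).trans ?_
    have e : (fun x => diffAt n (fun k => c.1 (x * k)) 1 v) = (leftDer v c).1 := by
      funext x
      exact (leftDer_eq_diffAt_one v c x).symm
    exact congrArg (fun f => diffAt n f g (leftTriv 𝕜 n g p)) e
  have key : leftPull0 g (P.bracket a b) = P.bracket (leftPull0 g a) (leftPull0 g b) +
      ∑ i ∈ S, A a i.1 * A b i.2 := by
    ext k
    refine (P.bracket_mul a b g k).trans (congrArg₂ (· + ·) rfl ?_)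
    rw [hS, ← evalAt_apply, map_sum]
    rfl
  have h1 := leftDer_leftPull v (P.bracket a b) g 1
  rw [mul_one] at h1
  rw [← h1, key, map_add, map_sum]
  change _ + evalAt 1 (∑ i ∈ S, leftDer v (A a i.1 * A b i.2)) = _
  rw [P.leftDer_bracket_leftPull hr, map_sum, hS, hS, ← Finset.sum_add_distrib, add_comm]
  congr 1
  refine Finset.sum_congr rfl fun i _ => ?_
  rw [Derivation.leibniz]
  change (A a i.1).1 1 * (leftDer v (A b i.2)).1 1 + (A b i.2).1 1 * (leftDer v (A a i.1)).1 1 = _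
  rw [hA1, hA1, hA2, hA2]
  ring

variable [T2Space G]

/-- The symmetric part of a quasitriangular structure is invariant, because the cobracket is
antisymmetric. -/
theorem lie_symPart {r : LieC 𝕜 n G ⊗[𝕜] LieC 𝕜 n G} (hr : IsQuasitriangular P r)
    (v : LieC 𝕜 n G) : ⁅v, symPart r⁆ = 0 := by
  have h : ⁅v, r + TensorProduct.comm 𝕜 _ _ r⁆ = 0 := by
    refine eq_zero_of_pair_eq_zero fun α β => ?_
    obtain ⟨a, ha⟩ := exists_leftDer_eq (1 : G) α
    obtain ⟨b, hb⟩ := exists_leftDer_eq (1 : G) β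
    have ea : tilde (d0 a) 1 = α := LinearMap.ext ha
    have eb : tilde (d0 b) 1 = β := LinearMap.ext hb
    rw [lie_add, ← comm_lie_tensor, pair_add, pair_comm, ← ea, ← eb]
    have h1 := P.leftDer_bracket hr v a b 1
    have h2 := P.leftDer_bracket hr v b a 1
    rw [P.bracket_one, P.bracket_one, zero_add, zero_add] at h1 h2
    rw [← h1, ← h2, P.bracket_skew a b, map_neg]
    exact neg_add_cancel _
  rw [symPart, lie_smul, h, smul_zero]

theorem lie_skewPart {r : LieC 𝕜 n G ⊗[𝕜] LieC 𝕜 n G} (hr : IsQuasitriangular P r)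
    (v : LieC 𝕜 n G) : ⁅v, skewPart r⁆ = ⁅v, r⁆ := by
  conv_rhs => rw [← symPart_add_skewPart r, lie_add, P.lie_symPart hr, zero_add]

/-- The failure of a left-invariant field to be a derivation of the Poisson bracket, for a
presentation `r₋ = ∑ pᵢ ⊗ qᵢ`. -/
theorem leftDer_ham {r : LieC 𝕜 n G ⊗[𝕜] LieC 𝕜 n G} (hr : IsQuasitriangular P r)
    {S : Finset (LieC 𝕜 n G × LieC 𝕜 n G)} (hS : skewPart r = ∑ i ∈ S, i.1 ⊗ₜ[𝕜] i.2)
    (v : LieC 𝕜 n G) (a b : Cinf 𝕜 n G) :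
    leftDer v (P.ham a b) = P.ham (leftDer v a) b + P.ham a (leftDer v b) +
      ∑ i ∈ S, (leftDer ⁅v, i.1⁆ a * leftDer i.2 b + leftDer i.1 a * leftDer ⁅v, i.2⁆ b) := by
  ext g
  refine (P.leftDer_bracket hr v a b g).trans (congrArg₂ (· + ·) rfl ?_)
  rw [← P.lie_skewPart hr, hS, ← evalAt_apply, map_sum]
  have h : ⁅v, ∑ i ∈ S, i.1 ⊗ₜ[𝕜] i.2⁆ =
      ∑ i ∈ S, (⁅v, i.1⁆ ⊗ₜ[𝕜] i.2 + i.1 ⊗ₜ[𝕜] ⁅v, i.2⁆) := by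
    rw [lie_sum]
    exact Finset.sum_congr rfl fun i _ => TensorProduct.LieModule.lie_tmul_right _ _ _
  rw [h, Finset.sum_add_distrib, pair_add, pair_sum, pair_sum, ← Finset.sum_add_distrib]
  rfl

end PoissonLieStructure

end Bracket

/-! ### Left-invariant bidifferential operators vanishing at the identity -/

section InvariantBidifferential

variable {𝕜 : Type*} [RCLike 𝕜] {n : ℕ}
variable {G : Type*} [TopologicalSpace G] [ChartedSpace (EuclideanSpace ℝ (Fin n)) G] [Group G]
  [LieGroup (𝓡 n) ∞ G] [T2Space G]

/-- Every linear form on `𝔤` is the derivative, at a given point, of a smooth function along the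
right-invariant fields. -/
theorem exists_rightDer_eq (g : G) (φ : LieC 𝕜 n G →ₗ[𝕜] 𝕜) :
    ∃ a : Cinf 𝕜 n G, ∀ v, (rightDer v a).1 g = φ v := by
  obtain ⟨a, ha⟩ := exists_leftDer_eq (1 : G) (-φ)
  refine ⟨rightPull0 g⁻¹ a, fun v => ?_⟩
  have e : rightPull0 g (rightPull0 g⁻¹ a) = a := by
    ext h
    simp [rightPull0]
  rw [rightDer_eq_leftDer, e, ha]
  simp

/-- Expansion of the differential of `a` at `g` in the differentials of functions `αᵢ` which are, at
`g`, dual to the right-invariant frame. -/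
theorem tilde_d0_eq_sum_rightDer {ι : Type*} [Fintype ι] (e : Module.Basis ι 𝕜 (LieC 𝕜 n G))
    (g : G) (a : Cinf 𝕜 n G) {α : ι → Cinf 𝕜 n G}
    (hα : ∀ i v, (rightDer v (α i)).1 g = e.coord i v) :
    tilde (d0 a) g = ∑ i, (rightDer (e i) a).1 g • tilde (d0 (α i)) g := by
  refine LinearMap.ext fun v => ?_
  rw [← AdInv_AdInv_inv g v, LinearMap.sum_apply]
  set w := AdInv n g⁻¹ v
  have h : ∀ b : Cinf 𝕜 n G, tilde (d0 b) g (AdInv n g w) = -(rightDer w b).1 g := by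
    intro b
    rw [rightDer_eq_neg, neg_neg]
    rfl
  have h2 : (rightDer w a).1 g = ∑ i, e.coord i w * (rightDer (e i) a).1 g := by
    rw [rightDer_eq_leftDer, leftDer_coord e, ← Finset.sum_neg_distrib]
    refine Finset.sum_congr rfl fun i _ => ?_
    rw [rightDer_eq_leftDer, mul_neg]
  rw [h, h2, ← Finset.sum_neg_distrib]
  refine Finset.sum_congr rfl fun i _ => ?_
  rw [LinearMap.smul_apply, h, hα, smul_eq_mul]
  ring

omit [T2Space G] [Group G] [LieGroup (𝓡 n) ∞ G] in
/-- Coefficients of a bilinear expression in a smooth frame are smooth: if `Q = M f Mᵀ` with `M`,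
`Q` smooth and `M(g) = 1`, then `f` is smooth at `g`, since `det(M)² f = adj(M) Q adj(M)ᵀ`. -/
theorem contMDiffAt_of_matrix_eq {ι : Type*} [Fintype ι] [DecidableEq ι]
    (M Q : Matrix ι ι (Cinf 𝕜 n G)) (f : ι → ι → G → 𝕜) (g : G)
    (hQ : ∀ h, (evalAt h).mapMatrix Q = (evalAt h).mapMatrix M *
      Matrix.of (fun i j => f i j h) * ((evalAt h).mapMatrix M).transpose)
    (hM : (evalAt g).mapMatrix M = 1) (i j : ι) :
    ContMDiffAt (𝓡 n) 𝓘(ℝ, 𝕜) ∞ (f i j) g := by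
  set N := M.adjugate with hN
  set d := M.det with hd
  have hNM : ∀ h, (evalAt h).mapMatrix N * (evalAt h).mapMatrix M =
      evalAt h d • (1 : Matrix ι ι 𝕜) := by
    intro h
    rw [← map_mul, hN, Matrix.adjugate_mul]
    ext k l
    simp only [AlgHom.mapMatrix_apply, Matrix.map_apply, Matrix.smul_apply, Matrix.one_apply,
      smul_eq_mul, map_mul, apply_ite (evalAt h), map_one, map_zero]
    rfl
  have hfN : ∀ h, (evalAt h).mapMatrix (N * Q * N.transpose) =
      (evalAt h d * evalAt h d) • Matrix.of (fun i j => f i j h) := by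
    intro h
    have e0 : (evalAt h).mapMatrix N.transpose = ((evalAt h).mapMatrix N).transpose := rfl
    have e2 : (evalAt h).mapMatrix N * ((evalAt h).mapMatrix M * Matrix.of (fun i j => f i j h) *
        ((evalAt h).mapMatrix M).transpose) * ((evalAt h).mapMatrix N).transpose =
        ((evalAt h).mapMatrix N * (evalAt h).mapMatrix M) * Matrix.of (fun i j => f i j h) *
        ((evalAt h).mapMatrix N * (evalAt h).mapMatrix M).transpose := by
      simp only [Matrix.transpose_mul, Matrix.mul_assoc]
    rw [map_mul, map_mul, e0, hQ, e2, hNM, Matrix.transpose_smul, Matrix.transpose_one,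
      Matrix.smul_mul, Matrix.one_mul, Matrix.mul_smul, Matrix.mul_one, smul_smul]
  have hdet : d.1 g = 1 := by
    have e2 : evalAt g d = ((evalAt g).mapMatrix M).det := AlgHom.map_det (evalAt g) M
    rw [← evalAt_apply, e2, hM, Matrix.det_one]
  have hds : Smooth n d.1 := d.2
  have hne : ∀ᶠ h in nhds g, d.1 h ≠ 0 :=
    hds.continuous.continuousAt.eventually_ne (by rw [hdet]; exact one_ne_zero)
  set S := (N * Q * N.transpose) i j
  have hev : f i j =ᶠ[nhds g] fun h => S.1 h * (d.1 h * d.1 h)⁻¹ := by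
    filter_upwards [hne] with h hh
    have h3 : S.1 h = (d.1 h * d.1 h) * f i j h := congrFun (congrFun (hfN h) i) j
    rw [h3]
    field_simp
  have hD : Smooth n (fun h => d.1 h * d.1 h) := Smooth.mul n hds hds
  have hinv : ContMDiffAt (𝓡 n) 𝓘(ℝ, 𝕜) ∞ (fun h => (d.1 h * d.1 h)⁻¹) g :=
    (contDiffAt_inv ℝ (by rw [hdet]; simp)).comp_contMDiffAt (g := fun x : 𝕜 => x⁻¹)
      hD.contMDiffAt
  have hS : Smooth n S.1 := S.2
  exact ((contDiff_mul (𝕜 := ℝ) (𝔸 := 𝕜) (n := ∞)).comp_contMDiffAt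
    (hS.contMDiffAt.prodMk_space hinv)).congr_of_eventuallyEq hev

/-- A left-invariant first-order bidifferential operator which vanishes at `e` is zero: in a
right-invariant frame its coefficients have vanishing derivatives, because left- and right-invariant
fields commute. -/
theorem bidifferential_eq_zero [ConnectedSpace G] (F : Cinf 𝕜 n G → Cinf 𝕜 n G → Cinf 𝕜 n G)
    (T : G → LieC 𝕜 n G ⊗[𝕜] LieC 𝕜 n G)
    (hT : ∀ a b g, (F a b).1 g = pair (T g) (tilde (d0 a) g) (tilde (d0 b) g))
    (hF : ∀ (v : LieC 𝕜 n G) a b, leftDer v (F a b) = F (leftDer v a) b + F a (leftDer v b))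
    (h1 : ∀ a b, (F a b).1 1 = 0) (a b : Cinf 𝕜 n G) : F a b = 0 := by
  let e := Module.finBasis 𝕜 (LieC 𝕜 n G)
  choose α hα using fun (g : G) i => exists_rightDer_eq g (e.coord i)
  let ι := Fin (Module.finrank 𝕜 (LieC 𝕜 n G))
  let f : ι → ι → G → 𝕜 := fun i j g => (F (α g i) (α g j)).1 g
  -- the numbers `f i j g` are the coefficients of `F` at `g` in the right-invariant frame
  have hf : ∀ a b g, (F a b).1 g =
      ∑ i, ∑ j, (rightDer (e i) a).1 g * (rightDer (e j) b).1 g * f i j g := by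
    intro a b g
    rw [hT, tilde_d0_eq_sum_rightDer e g a (hα g), tilde_d0_eq_sum_rightDer e g b (hα g)]
    simp only [f, hT]
    induction T g using TensorProduct.induction_on with
    | zero => simp [pair]
    | tmul u v =>
      simp only [pair_tmul, LinearMap.sum_apply, LinearMap.smul_apply, smul_eq_mul,
        Finset.sum_mul_sum]
      exact Finset.sum_congr rfl fun i _ => Finset.sum_congr rfl fun j _ => by ring
    | add s t hs ht => simp only [pair_add, hs, ht, mul_add, Finset.sum_add_distrib]
  have hsm : ∀ i j, Smooth n (f i j) := by
    intro i j g
    -- `M i k = (e k)ᴿ (α g i)` is the identity matrix at `g`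
    refine contMDiffAt_of_matrix_eq (Matrix.of fun i k => rightDer (e k) (α g i))
      (Matrix.of fun i j => F (α g i) (α g j)) f g (fun h => ?_) ?_ i j
    · ext i j
      refine (hf (α g i) (α g j) h).trans ?_
      rw [Matrix.mul_apply]
      simp only [Matrix.mul_apply, Finset.sum_mul]
      rw [Finset.sum_comm]
      refine Finset.sum_congr rfl fun k _ => Finset.sum_congr rfl fun l _ => ?_
      change _ = (rightDer (e l) (α g i)).1 h * f l k h * (rightDer (e k) (α g j)).1 h
      ring
    · ext i k
      refine (hα g i (e k)).trans ?_
      simp [Matrix.one_apply, Finsupp.single_apply, eq_comm]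
  have hconst : ∀ i j (v : LieC 𝕜 n G), leftDer v (⟨f i j, hsm i j⟩ : Cinf 𝕜 n G) = 0 := by
    intro k l v
    have hF' : ∀ a b, F a b = ∑ i, ∑ j, rightDer (e i) a * rightDer (e j) b *
        (⟨f i j, hsm i j⟩ : Cinf 𝕜 n G) := by
      intro a b
      ext g
      rw [hf, ← evalAt_apply]
      simp only [map_sum, map_mul]
      rfl
    have key : ∀ a b, ∑ i, ∑ j, rightDer (e i) a * rightDer (e j) b *
        leftDer v (⟨f i j, hsm i j⟩ : Cinf 𝕜 n G) = 0 := by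
      intro a b
      have h := hF v a b
      rw [hF' a b, hF' (leftDer v a) b, hF' a (leftDer v b)] at h
      simp only [map_sum, Derivation.leibniz, ← Finset.sum_add_distrib, smul_eq_mul] at h
      rw [← sub_eq_zero, ← Finset.sum_sub_distrib] at h
      rw [← h]
      refine Finset.sum_congr rfl fun i _ => ?_
      rw [← Finset.sum_sub_distrib]
      refine Finset.sum_congr rfl fun j _ => ?_
      rw [leftDer_rightDer_comm, leftDer_rightDer_comm]
      ring
    ext g
    have h := congrArg (evalAt g) (key (α g k) (α g l))
    simp only [map_sum, map_mul] at h
    have h2 : ∀ i k, evalAt g (rightDer (e i) (α g k)) = if k = i then 1 else 0 := by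
      intro i k
      refine (hα g k (e i)).trans ?_
      simp [Finsupp.single_apply, eq_comm]
    simp only [h2, map_zero] at h
    simp only [ite_mul, one_mul, zero_mul, mul_ite, mul_one, mul_zero, Finset.sum_ite_eq,
      Finset.mem_univ, if_true] at h
    exact h
  have hzero : ∀ i j g, f i j g = 0 := by
    intro i j g
    rw [eq_of_diffAt_eq_zero (hsm i j) (fun g => ?_) g 1]
    · exact h1 _ _
    · refine LinearMap.ext fun u => ?_
      have h := congrArg (fun b => b.1 g) (hconst i j ((leftTriv 𝕜 n g).symm u))
      simpa [leftDer_apply] using h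
  ext g
  rw [hf]
  simp [hzero]

end InvariantBidifferential

/-! ### The Poisson bracket is a coboundary -/

section BracketFormula

variable {𝕜 : Type*} [RCLike 𝕜] {n : ℕ}
variable {G : Type*} [TopologicalSpace G] [ChartedSpace (EuclideanSpace ℝ (Fin n)) G] [Group G]
  [LieGroup (𝓡 n) ∞ G] [T2Space G]

/-- On a connected group the Poisson bracket is the coboundary `r₋ᴸ - r₋ᴿ`: it is the difference of
the left- and the right-invariant bivector field generated by `r₋ = ∑ pᵢ ⊗ qᵢ`. -/
theorem PoissonLieStructure.ham_eq_sum [ConnectedSpace G] (P : PoissonLieStructure 𝕜 n G)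
    {r : LieC 𝕜 n G ⊗[𝕜] LieC 𝕜 n G} (hr : IsQuasitriangular P r)
    {S : Finset (LieC 𝕜 n G × LieC 𝕜 n G)} (hS : skewPart r = ∑ i ∈ S, i.1 ⊗ₜ[𝕜] i.2)
    (a b : Cinf 𝕜 n G) :
    P.ham a b = ∑ i ∈ S, (leftDer i.1 a * leftDer i.2 b - rightDer i.1 a * rightDer i.2 b) := by
  rw [← sub_eq_zero]
  refine bidifferential_eq_zero (fun a b => P.ham a b - ∑ i ∈ S,
    (leftDer i.1 a * leftDer i.2 b - rightDer i.1 a * rightDer i.2 b))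
    (fun g => P.leftBiv g - (skewPart r - TensorProduct.map (AdInv n g) (AdInv n g) (skewPart r)))
    (fun a b g => ?_) (fun v a b => ?_) (fun a b => ?_) a b
  · change (P.bracket a b).1 g - evalAt g (∑ i ∈ S,
      (leftDer i.1 a * leftDer i.2 b - rightDer i.1 a * rightDer i.2 b)) = _
    rw [P.bracket_eq_pair, pair_sub, pair_sub, pair_map, hS, pair_sum, pair_sum, map_sum,
      ← Finset.sum_sub_distrib]
    congr 1
    refine Finset.sum_congr rfl fun i _ => ?_
    change (leftDer i.1 a).1 g * (leftDer i.2 b).1 g - (rightDer i.1 a).1 g * (rightDer i.2 b).1 g =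
      (leftDer i.1 a).1 g * (leftDer i.2 b).1 g -
      (leftDer (AdInv n g i.1) a).1 g * (leftDer (AdInv n g i.2) b).1 g
    rw [rightDer_eq_neg, rightDer_eq_neg, neg_mul_neg]
  · rw [map_sub, P.leftDer_ham hr hS, map_sum]
    have h : ∑ i ∈ S, (leftDer ⁅v, i.1⁆ a * leftDer i.2 b + leftDer i.1 a * leftDer ⁅v, i.2⁆ b) =
      ∑ i ∈ S, leftDer v (leftDer i.1 a * leftDer i.2 b - rightDer i.1 a * rightDer i.2 b) -
      (∑ i ∈ S, (leftDer i.1 (leftDer v a) * leftDer i.2 b -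
        rightDer i.1 (leftDer v a) * rightDer i.2 b) +
      ∑ i ∈ S, (leftDer i.1 a * leftDer i.2 (leftDer v b) -
        rightDer i.1 a * rightDer i.2 (leftDer v b))) := by
      rw [← Finset.sum_add_distrib, ← Finset.sum_sub_distrib]
      refine Finset.sum_congr rfl fun i _ => ?_
      rw [map_sub, Derivation.leibniz, Derivation.leibniz, leftDer_lie, leftDer_lie,
        leftDer_rightDer_comm, leftDer_rightDer_comm]
      simp only [smul_eq_mul]
      ring
    rw [h]
    ring
  · change (P.bracket a b).1 1 - evalAt 1 (∑ i ∈ S,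
      (leftDer i.1 a * leftDer i.2 b - rightDer i.1 a * rightDer i.2 b)) = 0
    rw [P.bracket_one, map_sum, Finset.sum_eq_zero, sub_zero]
    intro i _
    have h : ∀ (v : LieC 𝕜 n G) (c : Cinf 𝕜 n G), (rightDer v c).1 1 = -(leftDer v c).1 1 := by
      intro v c
      have e : rightPull0 1 c = c := by ext g; simp [rightPull0]
      rw [rightDer_eq_leftDer, e]
    change (leftDer i.1 a).1 1 * (leftDer i.2 b).1 1 -
      (rightDer i.1 a).1 1 * (rightDer i.2 b).1 1 = 0
    rw [h, h]
    ring

end BracketFormula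

/-! ### Components of forms in the left-invariant frame -/

section Components

variable {𝕜 : Type*} [RCLike 𝕜] {n : ℕ}
variable {G : Type*} [TopologicalSpace G] [ChartedSpace (EuclideanSpace ℝ (Fin n)) G] [Group G]
  [LieGroup (𝓡 n) ∞ G]

/-- The components of a 1-form in the left-invariant frame. -/
def comp1 : Form1 𝕜 n G →ₗ[𝕜] LieC 𝕜 n G →ₗ[𝕜] Cinf 𝕜 n G :=
  LinearMap.mk₂ 𝕜 (fun τ v => ⟨fun g => tilde τ g v, smooth_tilde τ v⟩)
    (fun _ _ _ => rfl) (fun _ _ _ => rfl)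
    (fun τ v w => Cinf.ext fun g => map_add (tilde τ g) v w)
    (fun c τ v => Cinf.ext fun g => map_smul (tilde τ g) c v)

theorem comp1_apply (τ : Form1 𝕜 n G) (v : LieC 𝕜 n G) (g : G) :
    (comp1 τ v).1 g = tilde τ g v := rfl

theorem Form1.ext {τ η : Form1 𝕜 n G} (h : ∀ v, comp1 τ v = comp1 η v) : τ = η := by
  refine Subtype.ext (funext fun g => LinearMap.ext fun u => ?_)
  have := congrArg (fun a => a.1 g) (h ((leftTriv 𝕜 n g).symm u))
  simpa [comp1_apply, tilde] using this

/-- The 1-form with given components in the left-invariant frame. -/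
def form1 (c : LieC 𝕜 n G →ₗ[𝕜] Cinf 𝕜 n G) : Form1 𝕜 n G :=
  ⟨fun g => ((evalAt g).toLinearMap ∘ₗ c) ∘ₗ (leftTriv 𝕜 n g).symm.toLinearMap, fun v => by
    have h : Smooth n (c v).1 := (c v).2
    convert h using 2 with g
    simp [evalAt_apply]⟩

theorem comp1_form1 (c : LieC 𝕜 n G →ₗ[𝕜] Cinf 𝕜 n G) (v : LieC 𝕜 n G) :
    comp1 (form1 c) v = c v := by
  ext g
  rw [comp1_apply]
  simp [tilde, form1, evalAt_apply]

theorem comp1_d0 (a : Cinf 𝕜 n G) (v : LieC 𝕜 n G) : comp1 (d0 a) v = leftDer v a := rfl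

theorem comp1_fmul (a : Cinf 𝕜 n G) (τ : Form1 𝕜 n G) (v : LieC 𝕜 n G) :
    comp1 (fmul a τ) v = a * comp1 τ v := rfl

/-- The components of a 2-form in the left-invariant frame. -/
def comp2 (η : Form2 𝕜 n G) : LieC 𝕜 n G →ₗ[𝕜] LieC 𝕜 n G →ₗ[𝕜] Cinf 𝕜 n G :=
  LinearMap.mk₂ 𝕜 (fun v w => ⟨fun g => η.1 g ![leftTriv 𝕜 n g v, leftTriv 𝕜 n g w], η.2 v w⟩)
    (fun v v' w => Cinf.ext fun g =>
      (congrArg (fun u => η.1 g ![u, leftTriv 𝕜 n g w]) (map_add (leftTriv 𝕜 n g) v v')).trans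
        ((η.1 g).map_vecCons_add _ _ _))
    (fun c v w => Cinf.ext fun g =>
      (congrArg (fun u => η.1 g ![u, leftTriv 𝕜 n g w]) (map_smul (leftTriv 𝕜 n g) c v)).trans
        ((η.1 g).map_vecCons_smul _ _ _))
    (fun v w w' => Cinf.ext fun g => by
      have h : ∀ u₁ u₂ : TC 𝕜 n g, η.1 g ![u₁, u₂] = -η.1 g ![u₂, u₁] := fun u₁ u₂ => by
        rw [← (η.1 g).map_swap ![u₂, u₁] (i := 0) (j := 1) (by simp)]
        congr 1
        ext i
        fin_cases i <;> rfl
      change η.1 g ![leftTriv 𝕜 n g v, leftTriv 𝕜 n g (w + w')] =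
        η.1 g ![leftTriv 𝕜 n g v, leftTriv 𝕜 n g w] + η.1 g ![leftTriv 𝕜 n g v, leftTriv 𝕜 n g w']
      rw [h, h _ (leftTriv 𝕜 n g w), h _ (leftTriv 𝕜 n g w'), map_add,
        (η.1 g).map_vecCons_add, neg_add])
    (fun c v w => Cinf.ext fun g => by
      have h : ∀ u₁ u₂ : TC 𝕜 n g, η.1 g ![u₁, u₂] = -η.1 g ![u₂, u₁] := fun u₁ u₂ => by
        rw [← (η.1 g).map_swap ![u₂, u₁] (i := 0) (j := 1) (by simp)]
        congr 1
        ext i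
        fin_cases i <;> rfl
      change η.1 g ![leftTriv 𝕜 n g v, leftTriv 𝕜 n g (c • w)] =
        c • η.1 g ![leftTriv 𝕜 n g v, leftTriv 𝕜 n g w]
      rw [h, h _ (leftTriv 𝕜 n g w), map_smul, (η.1 g).map_vecCons_smul, smul_neg])

theorem comp2_apply (η : Form2 𝕜 n G) (v w : LieC 𝕜 n G) (g : G) :
    (comp2 η v w).1 g = η.1 g ![leftTriv 𝕜 n g v, leftTriv 𝕜 n g w] := rfl

theorem comp2_self (η : Form2 𝕜 n G) (v : LieC 𝕜 n G) : comp2 η v v = 0 := by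
  ext g
  exact (η.1 g).map_eq_zero_of_eq _ (i := 0) (j := 1) rfl (by simp)

theorem comp2_swap (η : Form2 𝕜 n G) (v w : LieC 𝕜 n G) : comp2 η v w = -comp2 η w v := by
  have h := comp2_self η (v + w)
  simp only [map_add, LinearMap.add_apply, comp2_self, zero_add, add_zero] at h
  rw [add_comm] at h
  exact eq_neg_of_add_eq_zero_left h

theorem Form2.ext {η θ : Form2 𝕜 n G} (h : ∀ v w, comp2 η v w = comp2 θ v w) : η = θ := by
  refine Subtype.ext (funext fun g => AlternatingMap.ext fun m => ?_)
  have := congrArg (fun a => a.1 g) (h ((leftTriv 𝕜 n g).symm (m 0)) ((leftTriv 𝕜 n g).symm (m 1)))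
  have e : ![m 0, m 1] = m := by ext i; fin_cases i <;> rfl
  simpa [comp2_apply, e] using this

/-- The 2-form with given components in the left-invariant frame. -/
def form2 (c : LieC 𝕜 n G →ₗ[𝕜] LieC 𝕜 n G →ₗ[𝕜] Cinf 𝕜 n G) (hc : ∀ v, c v v = 0) :
    Form2 𝕜 n G :=
  ⟨fun g => altOfBilin 𝕜 ((c.compr₂ (evalAt g).toLinearMap).compl₁₂
      (leftTriv 𝕜 n g).symm.toLinearMap (leftTriv 𝕜 n g).symm.toLinearMap)
      (fun u => by simp [hc]), fun v w => by
    have h : Smooth n (c v w).1 := (c v w).2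
    convert h using 2 with g
    simp [altOfBilin, evalAt_apply]⟩

theorem comp2_form2 (c : LieC 𝕜 n G →ₗ[𝕜] LieC 𝕜 n G →ₗ[𝕜] Cinf 𝕜 n G) (hc : ∀ v, c v v = 0)
    (v w : LieC 𝕜 n G) : comp2 (form2 c hc) v w = c v w := by
  ext g
  rw [comp2_apply]
  simp [form2, altOfBilin, evalAt_apply]

theorem comp2_add (η θ : Form2 𝕜 n G) (v w : LieC 𝕜 n G) :
    comp2 (η + θ) v w = comp2 η v w + comp2 θ v w := rfl

theorem comp2_smul (c : 𝕜) (η : Form2 𝕜 n G) (v w : LieC 𝕜 n G) :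
    comp2 (c • η) v w = c • comp2 η v w := rfl

theorem comp2_zero (v w : LieC 𝕜 n G) : comp2 (0 : Form2 𝕜 n G) v w = 0 := rfl

theorem comp2_sum {ι : Type*} (s : Finset ι) (η : ι → Form2 𝕜 n G) (v w : LieC 𝕜 n G) :
    comp2 (∑ i ∈ s, η i) v w = ∑ i ∈ s, comp2 (η i) v w := by
  classical
  induction s using Finset.induction_on with
  | empty => rfl
  | insert i s hi ih => rw [Finset.sum_insert hi, Finset.sum_insert hi, comp2_add, ih]

theorem comp2_wedge (τ η : Form1 𝕜 n G) (v w : LieC 𝕜 n G) :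
    comp2 (wedge τ η) v w = comp1 τ v * comp1 η w - comp1 η v * comp1 τ w := rfl

theorem comp2_d1 (τ : Form1 𝕜 n G) (v w : LieC 𝕜 n G) :
    comp2 (d1 τ) v w = leftDer v (comp1 τ w) - leftDer w (comp1 τ v) - comp1 τ ⁅v, w⁆ := by
  ext g
  change d1Inv τ g ((leftTriv 𝕜 n g).symm (leftTriv 𝕜 n g v))
    ((leftTriv 𝕜 n g).symm (leftTriv 𝕜 n g w)) = _
  rw [LinearEquiv.symm_apply_apply, LinearEquiv.symm_apply_apply]
  rfl

/-- The components of the exterior derivative of a 2-form in the left-invariant frame. -/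
def comp3d (η : Form2 𝕜 n G) (v w z : LieC 𝕜 n G) : Cinf 𝕜 n G :=
  leftDer v (comp2 η w z) - leftDer w (comp2 η v z) + leftDer z (comp2 η v w)
    - comp2 η ⁅v, w⁆ z + comp2 η ⁅v, z⁆ w - comp2 η ⁅w, z⁆ v

theorem d2_eq_comp3d (η : Form2 𝕜 n G) (g : G) (u v w : TC 𝕜 n g) :
    d2 η g u v w = (comp3d η ((leftTriv 𝕜 n g).symm u) ((leftTriv 𝕜 n g).symm v)
      ((leftTriv 𝕜 n g).symm w)).1 g := by
  conv_lhs => rw [← (leftTriv 𝕜 n g).apply_symm_apply u, ← (leftTriv 𝕜 n g).apply_symm_apply v,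
    ← (leftTriv 𝕜 n g).apply_symm_apply w]
  simp only [d2, LinearEquiv.symm_apply_apply]
  rfl

/-- The components of `d² = 0` on 1-forms; this is the Jacobi identity of `𝔤`. -/
theorem comp3d_d1 (τ : Form1 𝕜 n G) (v w z : LieC 𝕜 n G) : comp3d (d1 τ) v w z = 0 := by
  have h1 : comp1 τ ⁅⁅v, w⁆, z⁆ - comp1 τ ⁅⁅v, z⁆, w⁆ + comp1 τ ⁅⁅w, z⁆, v⁆ = 0 := by
    rw [← map_sub, ← map_add]
    have h : ∀ {L : Type _} [LieRing L] (v w z : L),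
        ⁅⁅v, w⁆, z⁆ - ⁅⁅v, z⁆, w⁆ + ⁅⁅w, z⁆, v⁆ = 0 := by
      intro L _ v w z
      have h := lie_jacobi v w z
      rw [← lie_skew v ⁅w, z⁆, ← lie_skew w ⁅z, v⁆, ← lie_skew z ⁅v, w⁆, ← lie_skew z v,
        neg_lie, neg_neg] at h
      rw [← neg_eq_zero, ← h]
      abel
    exact (congrArg (comp1 τ) (h v w z)).trans (map_zero _)
  simp only [comp3d, comp2_d1, map_sub, leftDer_lie]
  linear_combination h1

end Components

/-! ### The preconnection of a quasitriangular structure -/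

/-- The linear map `v ↦ [v, u]` of a Lie algebra. -/
def lieRight (𝕜 : Type*) {L : Type*} [CommRing 𝕜] [LieRing L] [LieAlgebra 𝕜 L] (u : L) :
    L →ₗ[𝕜] L where
  toFun v := ⁅v, u⁆
  map_add' v w := add_lie v w u
  map_smul' c v := smul_lie c v u

/-- A bilinear map is antisymmetric when evaluated on `r₋ = ∑ pᵢ ⊗ qᵢ`. -/
theorem sum_eq_neg_of_skewPart {𝕜 : Type*} [RCLike 𝕜] {L M : Type*} [LieRing L] [LieAlgebra 𝕜 L]
    [AddCommGroup M] [Module 𝕜 M] {r : L ⊗[𝕜] L} {S : Finset (L × L)}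
    (hS : skewPart r = ∑ i ∈ S, i.1 ⊗ₜ[𝕜] i.2) (f : L →ₗ[𝕜] L →ₗ[𝕜] M) :
    ∑ i ∈ S, f i.1 i.2 = -∑ i ∈ S, f i.2 i.1 := by
  have h := congrArg (TensorProduct.lift f) (comm_skewPart r)
  rw [hS] at h
  simp only [map_sum, map_neg, TensorProduct.comm_tmul, TensorProduct.lift.tmul] at h
  rw [h, neg_neg]

theorem sum_mul_sum_sub_eq {R ι κ : Type*} [CommRing R] [Fintype ι] (S : Finset κ) (x y : κ → R)
    (c d : ι → κ → R) (t : ι → R) :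
    ∑ i, (∑ j ∈ S, (x j * c i j - y j * d i j)) * t i =
      ∑ j ∈ S, (x j * ∑ i, c i j * t i - y j * ∑ i, d i j * t i) := by
  simp only [Finset.sum_mul, Finset.mul_sum]
  rw [Finset.sum_comm]
  refine Finset.sum_congr rfl fun j _ => ?_
  rw [← Finset.sum_sub_distrib]
  exact Finset.sum_congr rfl fun i _ => by ring

section Preconnection

variable {𝕜 : Type*} [RCLike 𝕜] {n : ℕ}
variable {G : Type*} [TopologicalSpace G] [ChartedSpace (EuclideanSpace ℝ (Fin n)) G] [Group G]
  [LieGroup (𝓡 n) ∞ G]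

theorem comp1_add (τ η : Form1 𝕜 n G) (v : LieC 𝕜 n G) :
    comp1 (τ + η) v = comp1 τ v + comp1 η v := rfl

theorem comp1_sub (τ η : Form1 𝕜 n G) (v : LieC 𝕜 n G) :
    comp1 (τ - η) v = comp1 τ v - comp1 η v := rfl

theorem comp1_leftPull1 (g : G) (τ : Form1 𝕜 n G) (v : LieC 𝕜 n G) :
    comp1 (leftPull1 g τ) v = leftPull0 g (comp1 τ v) := by
  ext h
  change τ.1 (g * h) (leftPush 𝕜 n g h (leftTriv 𝕜 n h v)) = τ.1 (g * h) (leftTriv 𝕜 n (g * h) v)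
  rw [leftPush_leftTriv]

theorem comp1_rightPull1 (h : G) (τ : Form1 𝕜 n G) (v : LieC 𝕜 n G) :
    comp1 (rightPull1 h τ) v = rightPull0 h (comp1 τ (AdInv n h v)) := by
  ext g
  change τ.1 (g * h) (rightPush 𝕜 n g h (leftTriv 𝕜 n g v)) =
    τ.1 (g * h) (leftTriv 𝕜 n (g * h) (AdInv n h v))
  rw [rightPush_leftTriv]

theorem comp1_coord {ι : Type*} [Fintype ι] (e : Module.Basis ι 𝕜 (LieC 𝕜 n G))
    (τ : Form1 𝕜 n G) (v : LieC 𝕜 n G) : comp1 τ v = ∑ i, e.coord i v • comp1 τ (e i) := by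
  conv_lhs => rw [← e.sum_repr v, map_sum]
  simp only [map_smul, Module.Basis.coord_apply]

theorem comp1_apply_coord {ι : Type*} [Fintype ι] (e : Module.Basis ι 𝕜 (LieC 𝕜 n G))
    (τ : Form1 𝕜 n G) (v : LieC 𝕜 n G) (g : G) :
    ∑ i, e.coord i v * (comp1 τ (e i)).1 g = (comp1 τ v).1 g := by
  rw [comp1_coord e τ v, ← evalAt_apply, map_sum]
  rfl

omit [Group G] [LieGroup (𝓡 n) ∞ G] in
theorem derivation_sum_smul_apply {ι : Type*} [Fintype ι]
    (D : Derivation 𝕜 (Cinf 𝕜 n G) (Cinf 𝕜 n G)) (c : ι → 𝕜) (β : ι → Cinf 𝕜 n G) (h : G) :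
    (D (∑ i, c i • β i)).1 h = ∑ i, c i * (D (β i)).1 h := by
  rw [map_sum, ← evalAt_apply, map_sum]
  refine Finset.sum_congr rfl fun i _ => ?_
  rw [Derivation.map_smul]
  rfl

omit [Group G] [LieGroup (𝓡 n) ∞ G] in
theorem derivation_sum_mul_apply {ι : Type*} [Fintype ι]
    (D : Derivation 𝕜 (Cinf 𝕜 n G) (Cinf 𝕜 n G)) (α β : ι → Cinf 𝕜 n G) (h : G) :
    (D (∑ i, α i * β i)).1 h =
      ∑ i, ((α i).1 h * (D (β i)).1 h + (D (α i)).1 h * (β i).1 h) := by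
  rw [map_sum, ← evalAt_apply, map_sum]
  refine Finset.sum_congr rfl fun i _ => ?_
  rw [Derivation.leibniz, mul_comm _ ((β i).1 h)]
  rfl

variable (P : PoissonLieStructure 𝕜 n G) (S : Finset (LieC 𝕜 n G × LieC 𝕜 n G))

/-- The map `γ̃(a, s) = {a, s} + ∑ (pᵢ a) ad*_{qᵢ} s`, on forms; here `∑ pᵢ ⊗ qᵢ` is the sum over
`S`. -/
def conn : Op1 𝕜 n G :=
  LinearMap.mk₂ 𝕜 (fun a τ => form1 ((P.ham a : Cinf 𝕜 n G →ₗ[𝕜] Cinf 𝕜 n G) ∘ₗ comp1 τ +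
      ∑ i ∈ S, LinearMap.mulLeft 𝕜 (leftDer i.1 a) ∘ₗ comp1 τ ∘ₗ lieRight 𝕜 i.2))
    (fun a b τ => Form1.ext fun v => by
      simp [comp1_form1, add_mul, Finset.sum_add_distrib]
      abel)
    (fun c a τ => Form1.ext fun v => by
      simp [comp1_form1, Finset.smul_sum])
    (fun a τ η => Form1.ext fun v => by
      simp [comp1_form1, mul_add, Finset.sum_add_distrib]
      abel)
    (fun c a τ => Form1.ext fun v => by
      simp [comp1_form1, Finset.smul_sum])

theorem comp1_conn (a : Cinf 𝕜 n G) (τ : Form1 𝕜 n G) (v : LieC 𝕜 n G) :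
    comp1 (conn P S a τ) v =
      P.ham a (comp1 τ v) + ∑ i ∈ S, leftDer i.1 a * comp1 τ ⁅v, i.2⁆ := by
  refine (comp1_form1 _ v).trans ?_
  rw [LinearMap.add_apply, LinearMap.sum_apply]
  rfl

theorem comp1_conn_apply (a : Cinf 𝕜 n G) (τ : Form1 𝕜 n G) (v : LieC 𝕜 n G) (g : G) :
    (comp1 (conn P S a τ) v).1 g = (P.bracket a (comp1 τ v)).1 g +
      ∑ i ∈ S, (leftDer i.1 a).1 g * (comp1 τ ⁅v, i.2⁆).1 g := by
  rw [comp1_conn, ← evalAt_apply, map_add, map_sum]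
  rfl

/-- The components of the extension of `conn P S` to 2-forms. -/
def connComp (a : Cinf 𝕜 n G) (η : Form2 𝕜 n G) : LieC 𝕜 n G →ₗ[𝕜] LieC 𝕜 n G →ₗ[𝕜] Cinf 𝕜 n G :=
  (comp2 η).compr₂ (P.ham a : Cinf 𝕜 n G →ₗ[𝕜] Cinf 𝕜 n G) +
    ∑ i ∈ S, ((comp2 η).compr₂ (LinearMap.mulLeft 𝕜 (leftDer i.1 a)) ∘ₗ lieRight 𝕜 i.2 +
      ((comp2 η).compr₂ (LinearMap.mulLeft 𝕜 (leftDer i.1 a))).compl₂ (lieRight 𝕜 i.2))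

theorem connComp_apply (a : Cinf 𝕜 n G) (η : Form2 𝕜 n G) (v w : LieC 𝕜 n G) :
    connComp P S a η v w = P.ham a (comp2 η v w) +
      ∑ i ∈ S, leftDer i.1 a * (comp2 η ⁅v, i.2⁆ w + comp2 η v ⁅w, i.2⁆) := by
  simp only [connComp, LinearMap.add_apply, LinearMap.sum_apply, mul_add]
  rfl

theorem connComp_self (a : Cinf 𝕜 n G) (η : Form2 𝕜 n G) (v : LieC 𝕜 n G) :
    connComp P S a η v v = 0 := by
  rw [connComp_apply, comp2_self, map_zero, zero_add]
  refine Finset.sum_eq_zero fun i _ => ?_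
  rw [comp2_swap, neg_add_cancel, mul_zero]

/-- The extension of `conn P S` to 2-forms. -/
def conn2 : Op2 𝕜 n G :=
  LinearMap.mk₂ 𝕜 (fun a η => form2 (connComp P S a η) (connComp_self P S a η))
    (fun a b τ => Form2.ext fun v w => by
      simp [comp2_form2, connComp_apply, comp2_add, add_mul, Finset.sum_add_distrib]
      abel)
    (fun c a τ => Form2.ext fun v w => by
      simp [comp2_form2, connComp_apply, comp2_smul, ← smul_add, ← Finset.smul_sum])
    (fun a τ η => Form2.ext fun v w => by
      simp [comp2_form2, connComp_apply, comp2_add, mul_add, Finset.sum_add_distrib]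
      abel)
    (fun c a τ => Form2.ext fun v w => by
      simp [comp2_form2, connComp_apply, comp2_smul, ← smul_add, ← Finset.smul_sum])

theorem comp2_conn2 (a : Cinf 𝕜 n G) (η : Form2 𝕜 n G) (v w : LieC 𝕜 n G) :
    comp2 (conn2 P S a η) v w = P.ham a (comp2 η v w) +
      ∑ i ∈ S, leftDer i.1 a * (comp2 η ⁅v, i.2⁆ w + comp2 η v ⁅w, i.2⁆) :=
  (comp2_form2 _ (connComp_self P S a η) v w).trans (connComp_apply P S a η v w)

theorem isPreconnection_conn : IsPreconnection P (conn P S) where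
  derivation x y τ := Form1.ext fun v => by
    simp only [comp1_conn, comp1_add, comp1_fmul, P.ham_mul_left, Derivation.leibniz, smul_eq_mul,
      mul_add, Finset.mul_sum, add_mul, Finset.sum_add_distrib, mul_assoc]
    abel
  connection x y τ := Form1.ext fun v => by
    simp only [comp1_conn, comp1_add, comp1_fmul, Derivation.leibniz, smul_eq_mul,
      mul_add, Finset.mul_sum, mul_left_comm _ y, P.ham_apply x y]
    ring

theorem isExtension_conn2 : IsExtension (conn P S) (conn2 P S) := by
  refine fun x τ η => Form2.ext fun v w => ?_
  simp only [comp2_conn2, comp2_add, comp2_wedge, comp1_conn, map_sub, Derivation.leibniz,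
    smul_eq_mul, add_mul, mul_add, Finset.mul_sum, Finset.sum_mul]
  have h : ∀ i ∈ S, leftDer i.1 x * (comp1 τ ⁅v, i.2⁆ * comp1 η w - comp1 η ⁅v, i.2⁆ * comp1 τ w) +
      leftDer i.1 x * (comp1 τ v * comp1 η ⁅w, i.2⁆ - comp1 η v * comp1 τ ⁅w, i.2⁆) =
      leftDer i.1 x * comp1 τ ⁅v, i.2⁆ * comp1 η w
      - comp1 η v * (leftDer i.1 x * comp1 τ ⁅w, i.2⁆)
      + comp1 τ v * (leftDer i.1 x * comp1 η ⁅w, i.2⁆)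
      - leftDer i.1 x * comp1 η ⁅v, i.2⁆ * comp1 τ w := fun i _ => by ring
  rw [Finset.sum_congr rfl h]
  simp only [Finset.sum_add_distrib, Finset.sum_sub_distrib]
  ring

/-- Every 2-form is a sum of wedge products of 1-forms, so an operator on 2-forms that extends an
operator on 1-forms is determined by it. -/
theorem IsExtension.unique {γ : Op1 𝕜 n G} {Γ₁ Γ₂ : Op2 𝕜 n G} (h₁ : IsExtension γ Γ₁)
    (h₂ : IsExtension γ Γ₂) : Γ₁ = Γ₂ := by
  let e := Module.finBasis 𝕜 (LieC 𝕜 n G)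
  -- the left-invariant coframe dual to `e`
  let ε : Fin (Module.finrank 𝕜 (LieC 𝕜 n G)) → Form1 𝕜 n G := fun i =>
    form1 ((Algebra.linearMap 𝕜 (Cinf 𝕜 n G)) ∘ₗ e.coord i)
  have hε : ∀ i v, comp1 (ε i) v = algebraMap 𝕜 (Cinf 𝕜 n G) (e.coord i v) := fun i v =>
    comp1_form1 _ v
  -- the sum over all pairs counts every pair of frame vectors twice, hence the factor 1/2
  have key : ∀ η : Form2 𝕜 n G, η = (2 : 𝕜)⁻¹ • ∑ i, ∑ j,
      wedge (fmul (comp2 η (e i) (e j)) (ε i)) (ε j) := by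
    refine fun η => Form2.ext fun v w => ?_
    rw [comp2_smul, comp2_sum]
    simp only [comp2_sum, comp2_wedge, comp1_fmul, hε]
    have h : ∀ v w, comp2 η v w = ∑ i, ∑ j, comp2 η (e i) (e j) *
        algebraMap 𝕜 (Cinf 𝕜 n G) (e.coord i v) * algebraMap 𝕜 (Cinf 𝕜 n G) (e.coord j w) := by
      intro v w
      conv_lhs => rw [← e.sum_repr v, ← e.sum_repr w]
      simp only [map_sum, LinearMap.sum_apply, map_smul, LinearMap.smul_apply,
        Module.Basis.coord_apply, Finset.smul_sum]
      rw [Finset.sum_comm]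
      refine Finset.sum_congr rfl fun i _ => Finset.sum_congr rfl fun j _ => ?_
      rw [Algebra.smul_def, Algebra.smul_def]
      ring
    have h' : ∑ i, ∑ j, algebraMap 𝕜 (Cinf 𝕜 n G) (e.coord j v) *
        (comp2 η (e i) (e j) * algebraMap 𝕜 (Cinf 𝕜 n G) (e.coord i w)) = comp2 η w v := by
      rw [h w v]
      refine Finset.sum_congr rfl fun i _ => Finset.sum_congr rfl fun j _ => ?_
      ring
    simp only [Finset.sum_sub_distrib]
    rw [← h, h', comp2_swap η w v, sub_neg_eq_add, ← two_smul 𝕜, smul_smul,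
      inv_mul_cancel₀ two_ne_zero, one_smul]
  refine LinearMap.ext fun x => LinearMap.ext fun η => ?_
  rw [key η]
  simp only [map_smul, map_sum, h₁ x, h₂ x]

/-- The bilinear map `(φ, ψ) ↦ ∑ φ(pᵢ) ad*_{qᵢ} ψ`. -/
def coadMap : (LieC 𝕜 n G →ₗ[𝕜] 𝕜) →ₗ[𝕜] (LieC 𝕜 n G →ₗ[𝕜] 𝕜) →ₗ[𝕜] (LieC 𝕜 n G →ₗ[𝕜] 𝕜) :=
  ∑ i ∈ S, (LinearMap.lsmul 𝕜 (LieC 𝕜 n G →ₗ[𝕜] 𝕜)).compl₁₂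
    (LinearMap.applyₗ i.1) (LinearMap.lcomp 𝕜 𝕜 (lieRight 𝕜 i.2))

theorem coadMap_apply (φ ψ : LieC 𝕜 n G →ₗ[𝕜] 𝕜) (w : LieC 𝕜 n G) :
    coadMap S φ ψ w = ∑ i ∈ S, φ i.1 * ψ ⁅w, i.2⁆ := by
  simp only [coadMap, LinearMap.sum_apply]
  rfl

variable {P S} {r : LieC 𝕜 n G ⊗[𝕜] LieC 𝕜 n G}

theorem tilde_conn (hS : skewPart r = ∑ i ∈ S, i.1 ⊗ₜ[𝕜] i.2) (a : Cinf 𝕜 n G)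
    (τ : Form1 𝕜 n G) (g : G) (v : LieC 𝕜 n G) :
    tilde (conn P S a τ) g v = pbracket n P.biv a.1 (fun h => tilde τ h v) g +
      coadTerm (skewPart r) (tilde (d0 a) g) (tilde τ g) v := by
  rw [← comp1_apply, comp1_conn, coadTerm, hS, pair_sum, ← evalAt_apply, map_add, map_sum]
  rfl

theorem coadTerm_eq_sum (hS : skewPart r = ∑ i ∈ S, i.1 ⊗ₜ[𝕜] i.2)
    (φ ψ : LieC 𝕜 n G →ₗ[𝕜] 𝕜) (w : LieC 𝕜 n G) :
    coadTerm (skewPart r) φ ψ w = ∑ i ∈ S, φ i.1 * ψ ⁅w, i.2⁆ := by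
  rw [coadTerm, hS, pair_sum]
  rfl

theorem hasXiHatZero_conn (hS : skewPart r = ∑ i ∈ S, i.1 ⊗ₜ[𝕜] i.2) :
    HasXiHatZero P r (conn P S) := by
  refine ⟨coadMap S, fun a τ g v => ?_, fun φ ψ w => ?_⟩
  · exact (tilde_conn hS a τ g v).trans
      (congrArg _ ((coadTerm_eq_sum hS _ _ v).trans (coadMap_apply S _ _ v).symm))
  · exact sub_eq_zero.2 ((coadMap_apply S φ ψ w).trans (coadTerm_eq_sum hS φ ψ w).symm)

theorem HasXiHatZero.eq_conn (hS : skewPart r = ∑ i ∈ S, i.1 ⊗ₜ[𝕜] i.2) {γ : Op1 𝕜 n G}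
    (hγ : HasXiHatZero P r γ) : γ = conn P S := by
  obtain ⟨Ξ, h₁, h₂⟩ := hγ
  refine LinearMap.ext fun a => LinearMap.ext fun τ => Form1.ext fun v => Cinf.ext fun g => ?_
  rw [comp1_apply, comp1_apply, tilde_conn hS, h₁]
  exact congrArg _ (sub_eq_zero.1 (h₂ _ _ _))

/-- Left covariance follows from multiplicativity of the bracket: the coadjoint term has constant
coefficients in the left-invariant frame. -/
theorem isLeftCovariant_conn : IsLeftCovariant P (conn P S) := by
  intro a τ g h u
  obtain ⟨w, rfl⟩ := (leftTriv 𝕜 n h).surjective u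
  have e : (fun k => τ.1 (k * h) (leftPush 𝕜 n k h (leftTriv 𝕜 n h w))) =
      (rightPull0 h (comp1 τ w)).1 := by
    funext k
    rw [leftPush_leftTriv]
    rfl
  rw [e, leftPush_leftTriv]
  change (comp1 (conn P S a τ) w).1 (g * h) =
    (comp1 (conn P S (leftPull0 g a) (leftPull1 g τ)) w).1 h +
      (P.bracket (rightPull0 h a) (rightPull0 h (comp1 τ w))).1 g
  rw [comp1_conn_apply, comp1_conn_apply, P.bracket_mul, comp1_leftPull1]
  have e2 : ∑ i ∈ S, (leftDer i.1 a).1 (g * h) * (comp1 τ ⁅w, i.2⁆).1 (g * h) =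
      ∑ i ∈ S, (leftDer i.1 (leftPull0 g a)).1 h * (comp1 (leftPull1 g τ) ⁅w, i.2⁆).1 h := by
    refine Finset.sum_congr rfl fun i _ => ?_
    rw [comp1_leftPull1, leftDer_leftPull]
    rfl
  rw [e2]
  ring

variable [T2Space G]

/-- Compatibility: the coadjoint terms account for the failure of left-invariant fields to be
derivations of the Poisson bracket. -/
theorem isCompatible_conn (hr : IsQuasitriangular P r)
    (hS : skewPart r = ∑ i ∈ S, i.1 ⊗ₜ[𝕜] i.2) : IsCompatible P (conn P S) := by
  refine fun x y => Form1.ext fun v => ?_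
  rw [comp1_d0, comp1_sub, comp1_conn, comp1_conn, ← P.ham_apply, P.leftDer_ham hr hS,
    P.ham_skew (leftDer v x) y]
  simp only [comp1_d0]
  -- `skewPart r` is antisymmetric, which moves the bracket with `v` to the second factor
  have h : ∑ i ∈ S, leftDer ⁅v, i.1⁆ x * leftDer i.2 y =
      -∑ i ∈ S, leftDer i.1 y * leftDer ⁅v, i.2⁆ x := by
    have h := sum_eq_neg_of_skewPart hS ((LinearMap.mul 𝕜 (Cinf 𝕜 n G)).compl₁₂
      (comp1 (d0 x) ∘ₗ LieModule.toEnd 𝕜 (LieC 𝕜 n G) (LieC 𝕜 n G) v) (comp1 (d0 y)))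
    refine h.trans (congrArg _ (Finset.sum_congr rfl fun i _ => ?_))
    exact mul_comm _ _
  rw [Finset.sum_add_distrib, h]
  ring

/-- The bracket of a function with a coefficient of the adjoint representation. -/
theorem ham_adCoeff [ConnectedSpace G] (hr : IsQuasitriangular P r)
    (hS : skewPart r = ∑ i ∈ S, i.1 ⊗ₜ[𝕜] i.2) (a : Cinf 𝕜 n G) (ψ : LieC 𝕜 n G →ₗ[𝕜] 𝕜)
    (w : LieC 𝕜 n G) (h : G) : (P.ham a (adCoeff ψ w)).1 h =
      ∑ j ∈ S, ((leftDer j.1 a).1 h * ψ ⁅AdInv n h w, j.2⁆ -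
        (leftDer (AdInv n h j.1) a).1 h * ψ ⁅AdInv n h w, AdInv n h j.2⁆) := by
  rw [P.ham_eq_sum hr hS, ← evalAt_apply, map_sum]
  refine Finset.sum_congr rfl fun j _ => ?_
  rw [map_sub, map_mul, map_mul, evalAt_apply, evalAt_apply, evalAt_apply, evalAt_apply,
    leftDer_adCoeff, rightDer_eq_neg, rightDer_eq_neg, neg_mul_neg, leftDer_adCoeff]

/-- Right covariance of `conn P S`, in components. Each of the two sums that `ham_adCoeff` produces
cancels a coadjoint term. -/
theorem comp1_conn_AdInv [ConnectedSpace G] (hr : IsQuasitriangular P r)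
    (hS : skewPart r = ∑ i ∈ S, i.1 ⊗ₜ[𝕜] i.2) {ι : Type*} [Fintype ι]
    (e : Module.Basis ι 𝕜 (LieC 𝕜 n G)) (a : Cinf 𝕜 n G) (τ : Form1 𝕜 n G) (g h : G)
    (w : LieC 𝕜 n G) : (comp1 (conn P S a τ) (AdInv n h w)).1 (g * h) =
      (comp1 (conn P S (rightPull0 h a) (rightPull1 h τ)) w).1 g +
        (P.ham (leftPull0 g a) (∑ i, adCoeff (e.coord i) w * leftPull0 g (comp1 τ (e i)))).1 h := by
  have e3 : (P.ham (leftPull0 g a) (leftPull0 g (comp1 τ (AdInv n h w)))).1 h =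
      ∑ i, e.coord i (AdInv n h w) *
        (P.ham (leftPull0 g a) (leftPull0 g (comp1 τ (e i)))).1 h := by
    rw [← derivation_sum_smul_apply]
    refine congrArg (fun b => (P.ham (leftPull0 g a) b).1 h) (Cinf.ext fun k => ?_)
    rw [← evalAt_apply k (∑ i, _), map_sum]
    exact (comp1_apply_coord e τ (AdInv n h w) (g * k)).symm
  have e4 : ∑ i, (P.ham (leftPull0 g a) (adCoeff (e.coord i) w)).1 h *
      (leftPull0 g (comp1 τ (e i))).1 h =
      ∑ j ∈ S, ((leftDer j.1 a).1 (g * h) * (comp1 τ ⁅AdInv n h w, j.2⁆).1 (g * h) -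
        (leftDer (AdInv n h j.1) a).1 (g * h) *
          (comp1 τ ⁅AdInv n h w, AdInv n h j.2⁆).1 (g * h)) := by
    simp only [ham_adCoeff hr hS, leftDer_leftPull]
    refine (sum_mul_sum_sub_eq S _ _ _ _ _).trans (Finset.sum_congr rfl fun j _ => ?_)
    exact congrArg₂ (fun s t => _ * s - _ * t) (comp1_apply_coord e τ _ (g * h))
      (comp1_apply_coord e τ _ (g * h))
  have e5 : (P.ham (leftPull0 g a)
      (∑ i, adCoeff (e.coord i) w * leftPull0 g (comp1 τ (e i)))).1 h = _ :=
    (derivation_sum_mul_apply (P.ham (leftPull0 g a)) (fun i => adCoeff (e.coord i) w)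
      (fun i => leftPull0 g (comp1 τ (e i))) h).trans
    (Finset.sum_add_distrib.trans (congrArg₂ (· + ·) e3.symm e4))
  have e6 : ∑ i ∈ S, (leftDer i.1 (rightPull0 h a)).1 g *
      (comp1 (rightPull1 h τ) ⁅w, i.2⁆).1 g = ∑ j ∈ S, (leftDer (AdInv n h j.1) a).1 (g * h) *
        (comp1 τ ⁅AdInv n h w, AdInv n h j.2⁆).1 (g * h) := by
    refine Finset.sum_congr rfl fun i _ => ?_
    rw [comp1_rightPull1, AdInv_lie, leftDer_rightPull]
    rfl
  rw [e5, comp1_conn_apply, comp1_conn_apply, P.bracket_mul, Finset.sum_sub_distrib, e6,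
    comp1_rightPull1, P.ham_apply]
  ring

/-- Right covariance uses the coboundary formula for the bracket: right translation by `h` twists
the frame by `Ad_{h⁻¹}`, and the bracket with its matrix coefficients compensates the change of the
coadjoint term. -/
theorem isRightCovariant_conn [ConnectedSpace G] (hr : IsQuasitriangular P r)
    (hS : skewPart r = ∑ i ∈ S, i.1 ⊗ₜ[𝕜] i.2) : IsRightCovariant P (conn P S) := by
  intro a τ g h u
  obtain ⟨w, rfl⟩ := (leftTriv 𝕜 n g).surjective u
  have e := Module.finBasis 𝕜 (LieC 𝕜 n G)
  -- the second argument of the bracket, in terms of the coefficients of the adjoint representation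
  have e1 : (fun k => τ.1 (g * k) (rightPush 𝕜 n g k (leftTriv 𝕜 n g w))) =
      (∑ i, adCoeff (e.coord i) w * leftPull0 g (comp1 τ (e i))).1 := by
    funext k
    rw [rightPush_leftTriv, ← evalAt_apply, map_sum]
    exact (comp1_apply_coord e τ (AdInv n k w) (g * k)).symm
  rw [e1, rightPush_leftTriv]
  exact comp1_conn_AdInv hr hS e a τ g h w

end Preconnection

/-! ### Killing form and extension of scalars -/

/-- Extension of scalars preserves the nondegeneracy of the Killing form. -/
theorem isKilling_baseChange (K A L : Type*) [Field K] [Field A] [Algebra K A] [LieRing L]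
    [LieAlgebra K L] [FiniteDimensional K L] [LieAlgebra.IsKilling K L] :
    LieAlgebra.IsKilling A (A ⊗[K] L) where
  killingCompl_top_eq_bot := by
    rw [LieSubmodule.eq_bot_iff]
    intro z hz
    rw [LieIdeal.mem_killingCompl] at hz
    let b := Module.finBasis K L
    have hκ := LieAlgebra.IsKilling.killingForm_nondegenerate K L
    let d := (killingForm K L).dualBasis hκ b
    have hd : ∀ i j, LieModule.traceForm K L L (b i) (d j) = if i = j then 1 else 0 :=
      LinearMap.BilinForm.apply_dualBasis_right hκ ⟨LieModule.traceForm_comm K L L⟩ b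
    have hc : ∀ j, (b.baseChange A).repr z j = 0 := by
      intro j
      have h := hz (1 ⊗ₜ d j) trivial
      rw [LieModule.traceForm_comm, LieModule.traceForm_baseChange,
        ← (b.baseChange A).sum_repr z, map_sum, LinearMap.sum_apply] at h
      rw [← h, Finset.sum_eq_single j]
      · simp [LinearMap.BilinForm.baseChange_tmul, hd]
      · intro i _ hij
        simp [hd, hij]
      · simp
    exact (b.baseChange A).repr.map_eq_zero_iff.1 (Finsupp.ext hc)

/-! ### Trilinear maps and the Schouten square -/

section Trilinear

variable {𝕜 : Type*} [RCLike 𝕜] {V M : Type*} [AddCommGroup V] [Module 𝕜 V]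
  [AddCommGroup M] [Module 𝕜 M]

/-- The linear map `V ⊗ (V ⊗ V) → M` defined by a trilinear map. -/
def tri (f : V →ₗ[𝕜] V →ₗ[𝕜] V →ₗ[𝕜] M) : V ⊗[𝕜] (V ⊗[𝕜] V) →ₗ[𝕜] M :=
  TensorProduct.lift ((TensorProduct.lift.equiv (.id 𝕜) V V M).toLinearMap ∘ₗ f)

theorem tri_tmul (f : V →ₗ[𝕜] V →ₗ[𝕜] V →ₗ[𝕜] M) (a b c : V) :
    tri f (a ⊗ₜ (b ⊗ₜ c)) = f a b c := rfl

/-- The trilinear map `(u, v, w) ↦ A u * B v * D w`. -/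
def mulTri {C : Type*} [CommRing C] [Algebra 𝕜 C] (A B D : V →ₗ[𝕜] C) :
    V →ₗ[𝕜] V →ₗ[𝕜] V →ₗ[𝕜] C :=
  ((LinearMap.mul 𝕜 C).compl₁₂ A B).compr₂ ((LinearMap.mul 𝕜 C).compl₂ D)

variable {L : Type*} [LieRing L] [LieAlgebra 𝕜 L]

variable {ι κ : Type*} (S : Finset ι) (T : Finset κ) (a b : ι → L) (c d : κ → L)

theorem lie1213_sum : lie1213 (𝕜 := 𝕜) (∑ i ∈ S, a i ⊗ₜ[𝕜] b i) (∑ j ∈ T, c j ⊗ₜ[𝕜] d j) =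
    ∑ i ∈ S, ∑ j ∈ T, ⁅a i, c j⁆ ⊗ₜ[𝕜] (b i ⊗ₜ[𝕜] d j) := by
  simp only [lie1213, TensorProduct.sum_tmul, TensorProduct.tmul_sum, map_sum]
  rw [Finset.sum_comm]
  rfl

theorem lie1223_sum : lie1223 (𝕜 := 𝕜) (∑ i ∈ S, a i ⊗ₜ[𝕜] b i) (∑ j ∈ T, c j ⊗ₜ[𝕜] d j) =
    ∑ i ∈ S, ∑ j ∈ T, a i ⊗ₜ[𝕜] (⁅b i, c j⁆ ⊗ₜ[𝕜] d j) := by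
  simp only [lie1223, TensorProduct.sum_tmul, TensorProduct.tmul_sum, map_sum]
  rw [Finset.sum_comm]
  rfl

theorem lie1323_sum : lie1323 (𝕜 := 𝕜) (∑ i ∈ S, a i ⊗ₜ[𝕜] b i) (∑ j ∈ T, c j ⊗ₜ[𝕜] d j) =
    ∑ i ∈ S, ∑ j ∈ T, a i ⊗ₜ[𝕜] (c j ⊗ₜ[𝕜] ⁅b i, d j⁆) := by
  simp only [lie1323, TensorProduct.sum_tmul, TensorProduct.tmul_sum, map_sum]
  rw [Finset.sum_comm]
  rfl

theorem lie_sum_tmul (v : L) : ⁅v, ∑ i ∈ S, a i ⊗ₜ[𝕜] b i⁆ =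
    ∑ i ∈ S, (⁅v, a i⁆ ⊗ₜ[𝕜] b i + a i ⊗ₜ[𝕜] ⁅v, b i⁆) :=
  (map_sum (LieModule.toEnd 𝕜 L (L ⊗[𝕜] L) v) _ S).trans
    (Finset.sum_congr rfl fun _ _ => TensorProduct.LieModule.lie_tmul_right _ _ _)

theorem tri_schouten_sum (f : L →ₗ[𝕜] L →ₗ[𝕜] L →ₗ[𝕜] M) :
    tri f (schouten (∑ i ∈ S, a i ⊗ₜ[𝕜] b i)) = ∑ i ∈ S, ∑ j ∈ S,
      (f ⁅a i, a j⁆ (b i) (b j) + f (a i) ⁅b i, a j⁆ (b j) + f (a i) (a j) ⁅b i, b j⁆) := by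
  rw [schouten, lie1213_sum, lie1223_sum, lie1323_sum]
  simp only [← Finset.sum_add_distrib, map_sum, map_add, tri_tmul]

end Trilinear

/-! ### The Schouten square of the antisymmetric part -/

section SchoutenSkewPart

variable {𝕜 : Type*} [RCLike 𝕜] {L : Type*} [LieRing L] [LieAlgebra 𝕜 L]

theorem pair_lie (v : L) (t : L ⊗[𝕜] L) (φ ψ : L →ₗ[𝕜] 𝕜) :
    pair ⁅v, t⁆ φ ψ = pair t (φ ∘ₗ (LieModule.toEnd 𝕜 L L v : L →ₗ[𝕜] L)) ψ +
      pair t φ (ψ ∘ₗ (LieModule.toEnd 𝕜 L L v : L →ₗ[𝕜] L)) := by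
  induction t using TensorProduct.induction_on with
  | zero => simp [pair]
  | tmul x y => simp [TensorProduct.LieModule.lie_tmul_right, pair_add, pair_tmul]
  | add s t hs ht => rw [lie_add, pair_add, pair_add, pair_add, hs, ht]; ring

/-- For an invariant tensor `p`, `[p₁₂, t₁₃] = -[p₁₂, t₂₃]`. -/
theorem lie1213_of_invariant {p : L ⊗[𝕜] L} (hp : ∀ v : L, ⁅v, p⁆ = 0) (t : L ⊗[𝕜] L) :
    lie1213 p t = -lie1223 p t := by
  obtain ⟨S, rfl⟩ := TensorProduct.exists_finset p
  obtain ⟨T, rfl⟩ := TensorProduct.exists_finset t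
  rw [← add_eq_zero_iff_eq_neg, lie1213_sum, lie1223_sum, Finset.sum_comm, Finset.sum_comm (s := S),
    ← Finset.sum_add_distrib]
  refine Finset.sum_eq_zero fun j _ => ?_
  -- insert `j.2` in the third place of `-[j.1, p] = 0`
  have h := congrArg (fun s => -TensorProduct.assoc 𝕜 L L L (s ⊗ₜ[𝕜] j.2)) (hp j.1)
  simp only [TensorProduct.zero_tmul, map_zero, neg_zero, lie_sum_tmul] at h
  rw [← h]
  simp only [TensorProduct.sum_tmul,
    TensorProduct.add_tmul, map_sum, map_add, TensorProduct.assoc_tmul,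
    ← Finset.sum_neg_distrib, ← Finset.sum_add_distrib]
  refine Finset.sum_congr rfl fun i _ => ?_
  rw [← lie_skew j.1 i.1, ← lie_skew j.1 i.2]
  simp only [TensorProduct.neg_tmul, TensorProduct.tmul_neg]
  abel

/-- For an invariant tensor `p`, `[t₁₂, p₂₃] = -[t₁₃, p₂₃]`. -/
theorem lie1223_of_invariant {p : L ⊗[𝕜] L} (hp : ∀ v : L, ⁅v, p⁆ = 0) (t : L ⊗[𝕜] L) :
    lie1223 t p = -lie1323 t p := by
  obtain ⟨S, rfl⟩ := TensorProduct.exists_finset p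
  obtain ⟨T, rfl⟩ := TensorProduct.exists_finset t
  rw [← add_eq_zero_iff_eq_neg, lie1323_sum, lie1223_sum, ← Finset.sum_add_distrib]
  refine Finset.sum_eq_zero fun j _ => ?_
  have h := congrArg (fun s => j.1 ⊗ₜ[𝕜] s) (hp j.2)
  simp only [TensorProduct.tmul_zero, lie_sum_tmul] at h
  rw [← h]
  simp only [TensorProduct.tmul_sum, TensorProduct.tmul_add, Finset.sum_add_distrib]

/-- For an invariant tensor `p` and an antisymmetric tensor `t`,
`[p₁₃, t₂₃] = -[t₁₂, p₁₃]`. -/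
theorem lie1323_of_invariant {p t : L ⊗[𝕜] L} (hp : ∀ v : L, ⁅v, p⁆ = 0)
    (ht : TensorProduct.comm 𝕜 L L t = -t) : lie1323 p t = -lie1213 t p := by
  have e : lie1323 p t = -lie1323 p (TensorProduct.comm 𝕜 L L t) := by
    rw [ht]
    simp [lie1323, TensorProduct.tmul_neg]
  rw [e, neg_inj]
  clear e ht
  obtain ⟨S, rfl⟩ := TensorProduct.exists_finset p
  obtain ⟨T, rfl⟩ := TensorProduct.exists_finset t
  simp only [map_sum, TensorProduct.comm_tmul]
  rw [lie1323_sum, lie1213_sum, Finset.sum_comm, ← sub_eq_zero, ← Finset.sum_sub_distrib]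
  refine Finset.sum_eq_zero fun j _ => ?_
  -- insert `j.2` in the second place of `-[j.1, p] = 0`
  have h := congrArg (fun s => -TensorProduct.map LinearMap.id (TensorProduct.mk 𝕜 L L j.2) s)
    (hp j.1)
  simp only [map_zero, neg_zero, lie_sum_tmul] at h
  rw [← h]
  simp only [map_sum, map_add, TensorProduct.map_tmul, TensorProduct.mk_apply, LinearMap.id_apply,
    ← Finset.sum_neg_distrib, ← Finset.sum_sub_distrib]
  refine Finset.sum_congr rfl fun i _ => ?_
  rw [← lie_skew j.1 i.2]
  simp only [TensorProduct.tmul_neg]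
  abel

/-- If `r = r₊ + r₋` with `r₊` invariant satisfies the classical Yang-Baxter equation, then
`[[r₋, r₋]] = -[(r₊)₁₃, (r₊)₂₃]`. -/
theorem schouten_skewPart {r : L ⊗[𝕜] L} (hr : schouten r = 0)
    (hp : ∀ v : L, ⁅v, symPart r⁆ = 0) :
    schouten (skewPart r) = -lie1323 (symPart r) (symPart r) := by
  set p := symPart r with hpd
  set m := skewPart r with hm
  have h1 := lie1213_of_invariant hp p
  have h2 := lie1213_of_invariant hp m
  have h3 := lie1223_of_invariant hp m
  have h4 := lie1323_of_invariant hp (comm_skewPart r)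
  rw [← symPart_add_skewPart r, ← hpd, ← hm] at hr
  have h5 : schouten (p + m) = schouten p + schouten m + (lie1213 p m + lie1213 m p +
      (lie1223 p m + lie1223 m p) + (lie1323 p m + lie1323 m p)) := by
    simp only [schouten, lie1213, lie1223, lie1323, TensorProduct.add_tmul, TensorProduct.tmul_add,
      map_add]
    abel
  rw [h5, h2, h3, h4] at hr
  rw [schouten, h1] at hr
  rw [eq_neg_iff_add_eq_zero, ← hr]
  abel

theorem apply_lie_lie_sum {ι : Type*} (T : Finset ι) (a b : ι → 𝕜) (q : ι → L) (ψ : L →ₗ[𝕜] 𝕜)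
    (v : L) : ψ ⁅v, ⁅∑ i ∈ T, a i • q i, ∑ j ∈ T, b j • q j⁆⁆ =
      ∑ i ∈ T, ∑ j ∈ T, a i * b j * ψ ⁅v, ⁅q i, q j⁆⁆ := by
  rw [sum_lie_sum T T (fun i => a i • q i) (fun j => b j • q j)]
  simp only [lie_sum, smul_lie, lie_smul, map_sum, map_smul, smul_eq_mul, mul_assoc,
    mul_left_comm]

end SchoutenSkewPart

/-! ### Invariant tensors over a semisimple Lie algebra -/

section Converse

variable {𝕜 : Type*} [RCLike 𝕜] {L : Type*} [LieRing L] [LieAlgebra 𝕜 L] [FiniteDimensional 𝕜 L]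

/-- Over a Lie algebra without nonzero abelian ideals, an invariant tensor `p` with
`[v, [K φ, K χ]] = 0`, where `K φ = φ(p¹) p²`, vanishes: the image of `K` is an abelian ideal. -/
theorem eq_zero_of_lie_lie_eq_zero [LieAlgebra.IsKilling 𝕜 L] {p : L ⊗[𝕜] L}
    (hp : ∀ v : L, ⁅v, p⁆ = 0) (K : (L →ₗ[𝕜] 𝕜) →ₗ[𝕜] L)
    (hK : ∀ φ ψ : L →ₗ[𝕜] 𝕜, ψ (K φ) = pair p φ ψ)
    (h : ∀ (v : L) (φ χ : L →ₗ[𝕜] 𝕜), ⁅v, ⁅K φ, K χ⁆⁆ = 0) : p = 0 := by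
  have ext : ∀ v w : L, (∀ ψ : L →ₗ[𝕜] 𝕜, ψ v = ψ w) → v = w := fun v w hvw => by
    rw [← sub_eq_zero, ← Module.forall_dual_apply_eq_zero_iff 𝕜]
    intro ψ
    rw [map_sub, sub_eq_zero]
    exact hvw ψ
  have hKlie : ∀ (v : L) φ, ⁅v, K φ⁆ = K (-(φ ∘ₗ (LieModule.toEnd 𝕜 L L v : L →ₗ[𝕜] L))) := by
    intro v φ
    refine ext _ _ fun ψ => ?_
    rw [hK]
    have h1 := pair_lie v p φ ψ
    rw [hp, show pair (0 : L ⊗[𝕜] L) φ ψ = 0 by simp [pair]] at h1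
    have h2 : ψ ⁅v, K φ⁆ = pair p φ (ψ ∘ₗ (LieModule.toEnd 𝕜 L L v : L →ₗ[𝕜] L)) := by
      rw [← hK]; rfl
    rw [h2, ← hK (-_), map_neg, map_neg, hK]
    linear_combination -h1
  have hcenter : ∀ φ χ, ⁅K φ, K χ⁆ = 0 := by
    intro φ χ
    have h1 : ⁅K φ, K χ⁆ ∈ LieAlgebra.center 𝕜 L := fun v => h v φ χ
    rwa [LieAlgebra.center_eq_bot, LieSubmodule.mem_bot] at h1
  let I : LieIdeal 𝕜 L :=
    { LinearMap.range K with
      lie_mem := by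
        rintro v _ ⟨φ, rfl⟩
        exact ⟨_, (hKlie v φ).symm⟩ }
  have hI : I = ⊥ := by
    have : IsLieAbelian I := ⟨by
      rintro ⟨_, φ, rfl⟩ ⟨_, χ, rfl⟩
      exact Subtype.ext (hcenter φ χ)⟩
    exact LieAlgebra.IsKilling.ideal_eq_bot_of_isLieAbelian I
  refine eq_zero_of_pair_eq_zero fun φ ψ => ?_
  have h1 : K φ ∈ I := ⟨φ, rfl⟩
  rw [hI, LieSubmodule.mem_bot] at h1
  rw [← hK, h1, map_zero]

end Converse

/-! ### Curvature -/

section Curvature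

variable {𝕜 : Type*} [RCLike 𝕜] {n : ℕ}
variable {G : Type*} [TopologicalSpace G] [ChartedSpace (EuclideanSpace ℝ (Fin n)) G] [Group G]
  [LieGroup (𝓡 n) ∞ G]

/-- The trilinear map `(u₁, u₂, u₃) ↦ (u₁ x) (u₂ y) τ([v, u₃])` on the Lie algebra. -/
def curvTri (x y : Cinf 𝕜 n G) (τ : Form1 𝕜 n G) (v : LieC 𝕜 n G) :
    LieC 𝕜 n G →ₗ[𝕜] LieC 𝕜 n G →ₗ[𝕜] LieC 𝕜 n G →ₗ[𝕜] Cinf 𝕜 n G :=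
  mulTri (comp1 (d0 x)) (comp1 (d0 y))
    (comp1 τ ∘ₗ (LieModule.toEnd 𝕜 (LieC 𝕜 n G) (LieC 𝕜 n G) v : LieC 𝕜 n G →ₗ[𝕜] LieC 𝕜 n G))

theorem curvTri_apply (x y : Cinf 𝕜 n G) (τ : Form1 𝕜 n G) (v u₁ u₂ u₃ : LieC 𝕜 n G) :
    curvTri x y τ v u₁ u₂ u₃ = leftDer u₁ x * leftDer u₂ y * comp1 τ ⁅v, u₃⁆ := rfl

variable [T2Space G] {P : PoissonLieStructure 𝕜 n G} {r : LieC 𝕜 n G ⊗[𝕜] LieC 𝕜 n G}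
  {S : Finset (LieC 𝕜 n G × LieC 𝕜 n G)}

omit [T2Space G] in
theorem comp1_conn_conn (x y : Cinf 𝕜 n G) (τ : Form1 𝕜 n G) (v : LieC 𝕜 n G) :
    comp1 (conn P S x (conn P S y τ)) v =
      P.ham x (P.ham y (comp1 τ v)) +
      ∑ i ∈ S, P.ham x (leftDer i.1 y) * comp1 τ ⁅v, i.2⁆ +
      ∑ i ∈ S, leftDer i.1 y * P.ham x (comp1 τ ⁅v, i.2⁆) +
      ∑ i ∈ S, leftDer i.1 x * P.ham y (comp1 τ ⁅v, i.2⁆) +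
      ∑ i ∈ S, ∑ j ∈ S, leftDer i.1 x * leftDer j.1 y * comp1 τ ⁅⁅v, i.2⁆, j.2⁆ := by
  simp only [comp1_conn, map_add, map_sum, Derivation.leibniz, smul_eq_mul, mul_add,
    Finset.sum_add_distrib, Finset.mul_sum, mul_assoc]
  simp only [mul_comm (comp1 τ _)]
  abel

/-- The Leibniz defect `leftDer_ham` enters through the derivatives of `{x, y}`. -/
theorem comp1_conn_bracket (hr : IsQuasitriangular P r)
    (hS : skewPart r = ∑ i ∈ S, i.1 ⊗ₜ[𝕜] i.2) (x y : Cinf 𝕜 n G) (τ : Form1 𝕜 n G)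
    (v : LieC 𝕜 n G) :
    comp1 (conn P S (P.bracket x y) τ) v = P.ham (P.ham x y) (comp1 τ v) -
      ∑ i ∈ S, P.ham y (leftDer i.1 x) * comp1 τ ⁅v, i.2⁆ +
      ∑ i ∈ S, P.ham x (leftDer i.1 y) * comp1 τ ⁅v, i.2⁆ +
      ∑ i ∈ S, ∑ j ∈ S, (leftDer ⁅i.1, j.1⁆ x * leftDer j.2 y +
        leftDer j.1 x * leftDer ⁅i.1, j.2⁆ y) * comp1 τ ⁅v, i.2⁆ := by
  have h : ∑ i ∈ S, P.ham (leftDer i.1 x) y * comp1 τ ⁅v, i.2⁆ =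
      -∑ i ∈ S, P.ham y (leftDer i.1 x) * comp1 τ ⁅v, i.2⁆ := by
    rw [← Finset.sum_neg_distrib]
    exact Finset.sum_congr rfl fun i _ => by rw [P.ham_skew]; ring
  rw [comp1_conn, ← P.ham_apply]
  simp only [P.leftDer_ham hr hS, add_mul, Finset.sum_add_distrib, Finset.sum_mul]
  rw [h]
  abel

omit [T2Space G] in
/-- The quadratic terms of the curvature, assembled into `[[r₋, r₋]]` by the Jacobi identity. -/
theorem tri_curvTri_schouten (x y : Cinf 𝕜 n G) (τ : Form1 𝕜 n G) (v : LieC 𝕜 n G) :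
    tri (curvTri x y τ v) (schouten (∑ i ∈ S, i.1 ⊗ₜ[𝕜] i.2)) =
      ∑ i ∈ S, ∑ j ∈ S, leftDer i.1 x * leftDer j.1 y * comp1 τ ⁅⁅v, i.2⁆, j.2⁆ -
      ∑ i ∈ S, ∑ j ∈ S, leftDer i.1 y * leftDer j.1 x * comp1 τ ⁅⁅v, i.2⁆, j.2⁆ -
      ∑ i ∈ S, ∑ j ∈ S, (leftDer ⁅i.1, j.1⁆ x * leftDer j.2 y +
        leftDer j.1 x * leftDer ⁅i.1, j.2⁆ y) * comp1 τ ⁅v, i.2⁆ := by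
  have hlie : ∀ u w : LieC 𝕜 n G,
      comp1 τ ⁅v, ⁅u, w⁆⁆ = comp1 τ ⁅⁅v, u⁆, w⁆ - comp1 τ ⁅⁅v, w⁆, u⁆ := by
    intro u w
    rw [← map_sub]
    have h : ∀ {L : Type _} [LieRing L] (v u w : L), ⁅v, ⁅u, w⁆⁆ = ⁅⁅v, u⁆, w⁆ - ⁅⁅v, w⁆, u⁆ := by
      intro L _ v u w
      rw [leibniz_lie, ← lie_skew u ⁅v, w⁆, sub_eq_add_neg]
    exact congrArg (comp1 τ) (h v u w)
  have hskew : ∀ u w : LieC 𝕜 n G, ∀ z : Cinf 𝕜 n G, leftDer ⁅u, w⁆ z = -leftDer ⁅w, u⁆ z := by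
    intro u w z
    rw [leftDer_lie, leftDer_lie, neg_sub]
  rw [tri_schouten_sum]
  simp only [curvTri_apply]
  rw [Finset.sum_comm (s := S) (f := fun i j : LieC 𝕜 n G × LieC 𝕜 n G =>
      leftDer i.1 y * leftDer j.1 x * comp1 τ ⁅⁅v, i.2⁆, j.2⁆),
    Finset.sum_comm (s := S) (f := fun i j : LieC 𝕜 n G × LieC 𝕜 n G =>
      (leftDer ⁅i.1, j.1⁆ x * leftDer j.2 y +
        leftDer j.1 x * leftDer ⁅i.1, j.2⁆ y) * comp1 τ ⁅v, i.2⁆)]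
  simp only [← Finset.sum_sub_distrib]
  refine Finset.sum_congr rfl fun i _ => Finset.sum_congr rfl fun j _ => ?_
  rw [hlie i.2 j.2, hskew j.1 i.1, hskew j.1 i.2]
  ring

/-- The curvature of the preconnection is given by `[[r₋, r₋]]`. -/
theorem comp1_curvature (hr : IsQuasitriangular P r)
    (hS : skewPart r = ∑ i ∈ S, i.1 ⊗ₜ[𝕜] i.2) (x y : Cinf 𝕜 n G) (τ : Form1 𝕜 n G)
    (v : LieC 𝕜 n G) :
    comp1 (curvature P (conn P S) x y τ) v = tri (curvTri x y τ v) (schouten (skewPart r)) := by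
  have hJ := P.ham_jacobi x y (comp1 τ v)
  rw [curvature, comp1_sub, comp1_sub, comp1_conn_conn, comp1_conn_conn,
    comp1_conn_bracket hr hS, hS, tri_curvTri_schouten]
  linear_combination hJ

/-- In the triangular case the preconnection is flat. -/
theorem curvature_eq_zero (hr : IsQuasitriangular P r)
    (hS : skewPart r = ∑ i ∈ S, i.1 ⊗ₜ[𝕜] i.2) (ht : IsTriangular r) (x y : Cinf 𝕜 n G)
    (τ : Form1 𝕜 n G) : curvature P (conn P S) x y τ = 0 := by
  have e : skewPart r = r := by
    conv_rhs => rw [← symPart_add_skewPart r, show symPart r = 0 from ht, zero_add]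
  refine Form1.ext fun v => ?_
  rw [comp1_curvature hr hS, e, hr.yangBaxter, map_zero, map_zero]
  rfl

/-- On a semisimple Lie group, a flat preconnection comes from a triangular structure. The curvature
is `-[(r₊)₁₃, (r₊)₂₃]`, and evaluation at `e` on functions with prescribed differentials turns its
vanishing into `[v, [K φ, K χ]] = 0`, where `K φ = φ(r₊¹) r₊²`. -/
theorem isTriangular_of_curvature_eq_zero [LieAlgebra.HasTrivialRadical ℝ (GroupLieAlgebra (𝓡 n) G)]
    (hr : IsQuasitriangular P r) (hS : skewPart r = ∑ i ∈ S, i.1 ⊗ₜ[𝕜] i.2)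
    (hR : ∀ x y τ, curvature P (conn P S) x y τ = 0) : IsTriangular r := by
  have : FiniteDimensional ℝ (GroupLieAlgebra (𝓡 n) G) :=
    inferInstanceAs (FiniteDimensional ℝ (EuclideanSpace ℝ (Fin n)))
  -- over `ℝ`, the Killing form is nondegenerate by Cartan's criterion
  have : LieAlgebra.IsKilling 𝕜 (LieC 𝕜 n G) := isKilling_baseChange ℝ 𝕜 _
  obtain ⟨T, hT⟩ := TensorProduct.exists_finset (symPart r)
  let K : (LieC 𝕜 n G →ₗ[𝕜] 𝕜) →ₗ[𝕜] LieC 𝕜 n G :=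
    ∑ i ∈ T, (LinearMap.toSpanSingleton 𝕜 _ i.2) ∘ₗ LinearMap.applyₗ i.1
  have hK : ∀ φ, K φ = ∑ i ∈ T, φ i.1 • i.2 := fun φ => LinearMap.sum_apply _ _ _
  refine eq_zero_of_lie_lie_eq_zero (P.lie_symPart hr) K (fun φ ψ => ?_) (fun v φ χ => ?_)
  · rw [hT, pair_sum, hK, map_sum]
    simp only [map_smul, smul_eq_mul]
  · rw [← Module.forall_dual_apply_eq_zero_iff 𝕜]
    intro ψ
    obtain ⟨x, hx⟩ := exists_leftDer_eq (1 : G) φ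
    obtain ⟨y, hy⟩ := exists_leftDer_eq (1 : G) χ
    let τ : Form1 𝕜 n G := form1 ((Algebra.linearMap 𝕜 (Cinf 𝕜 n G)) ∘ₗ ψ)
    have h := comp1_curvature hr hS x y τ v
    rw [hR, schouten_skewPart hr.yangBaxter (P.lie_symPart hr), map_zero, LinearMap.zero_apply,
      map_neg, hT, lie1323_sum] at h
    have h' := congrArg (evalAt (1 : G)) h
    simp only [map_zero, map_neg, map_sum, tri_tmul, curvTri_apply, map_mul] at h'
    have hτ : ∀ u, evalAt (1 : G) (comp1 τ u) = ψ u := fun u => by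
      rw [comp1_form1]
      rfl
    simp only [evalAt_apply, hx, hy] at h'
    simp only [← evalAt_apply, hτ] at h'
    rw [zero_eq_neg] at h'
    rw [hK, hK]
    exact (apply_lie_lie_sum T (fun i => φ i.1) (fun i => χ i.1) Prod.snd ψ v).trans h'

end Curvature

/-! ### Antisymmetric solutions of the classical Yang-Baxter equation -/

section YangBaxter

variable {𝕜 : Type*} [RCLike 𝕜] {L M : Type*} [LieRing L] [LieAlgebra 𝕜 L] [LieRing M]
  [LieAlgebra 𝕜 M]

/-- If `r` is an antisymmetric solution of the classical Yang-Baxter equation and `f`, `g` are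
homomorphisms of Lie algebras with commuting images, then so is `(f ⊗ f) r - (g ⊗ g) r`. -/
theorem exists_sum_yangBaxter (f g : L →ₗ⁅𝕜⁆ M) (hfg : ∀ u v, ⁅f u, g v⁆ = 0) {r : L ⊗[𝕜] L}
    (hYB : schouten r = 0) (hcomm : TensorProduct.comm 𝕜 L L r = -r) {S : Finset (L × L)}
    (hS : r = ∑ i ∈ S, i.1 ⊗ₜ[𝕜] i.2) (C : Type*) [CommRing C] [Algebra 𝕜 C] :
    ∃ T : Finset (M × M),
      (∀ α β : M →ₗ[𝕜] C, ∑ k ∈ T, α k.1 * β k.2 =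
        ∑ i ∈ S, (α (f i.1) * β (f i.2) - α (g i.1) * β (g i.2))) ∧
      (∀ α β : M →ₗ[𝕜] C, ∑ l ∈ T, α l.1 * β l.2 = -∑ l ∈ T, α l.2 * β l.1) ∧
      ∀ α β δ : M →ₗ[𝕜] C, ∑ k ∈ T, ∑ l ∈ T, (α ⁅k.1, l.1⁆ * β k.2 * δ l.2 +
        α k.1 * β ⁅k.2, l.1⁆ * δ l.2 + α k.1 * β l.1 * δ ⁅k.2, l.2⁆) = 0 := by
  have map_eq : ∀ f : L →ₗ⁅𝕜⁆ M, TensorProduct.map (f : L →ₗ[𝕜] M) (f : L →ₗ[𝕜] M) r =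
      ∑ i ∈ S, f i.1 ⊗ₜ[𝕜] f i.2 := fun f => by
    rw [hS, map_sum]
    rfl
  have map_schouten : ∀ f : L →ₗ⁅𝕜⁆ M, schouten (∑ i ∈ S, f i.1 ⊗ₜ[𝕜] f i.2) = 0 := fun f => by
    have h := congrArg (TensorProduct.map (f : L →ₗ[𝕜] M)
      (TensorProduct.map (f : L →ₗ[𝕜] M) (f : L →ₗ[𝕜] M))) hYB
    rw [hS, schouten, lie1213_sum, lie1223_sum, lie1323_sum] at h
    simp only [map_add, map_sum, TensorProduct.map_tmul, LieHom.coe_toLinearMap, LieHom.map_lie,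
      map_zero] at h
    rw [schouten, lie1213_sum, lie1223_sum, lie1323_sum, h]
  have hgf : ∀ u v, ⁅g u, f v⁆ = 0 := fun u v => by rw [← lie_skew, hfg, neg_zero]
  obtain ⟨T, hT⟩ := TensorProduct.exists_finset
    (TensorProduct.map (f : L →ₗ[𝕜] M) (f : L →ₗ[𝕜] M) r -
      TensorProduct.map (g : L →ₗ[𝕜] M) (g : L →ₗ[𝕜] M) r)
  refine ⟨T, fun α β => ?_, fun α β => ?_, fun α β δ => ?_⟩
  · have h1 := congrArg (TensorProduct.lift ((LinearMap.mul 𝕜 C).compl₁₂ α β)) hT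
    rw [map_eq, map_eq] at h1
    simp only [map_sub, map_sum, TensorProduct.lift.tmul, ← Finset.sum_sub_distrib] at h1
    exact h1.symm
  · have h1 : TensorProduct.comm 𝕜 M M (∑ k ∈ T, k.1 ⊗ₜ[𝕜] k.2) = -∑ k ∈ T, k.1 ⊗ₜ[𝕜] k.2 := by
      have h1 : ∀ f : L →ₗ⁅𝕜⁆ M, TensorProduct.comm 𝕜 M M (∑ i ∈ S, f i.1 ⊗ₜ[𝕜] f i.2) =
          -∑ i ∈ S, f i.1 ⊗ₜ[𝕜] f i.2 := fun f => by
        have h2 := congrArg (TensorProduct.map (f : L →ₗ[𝕜] M) (f : L →ₗ[𝕜] M)) hcomm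
        rw [map_neg, map_eq] at h2
        rw [← h2, hS]
        simp only [map_sum, TensorProduct.comm_tmul, TensorProduct.map_tmul]
        rfl
      rw [← hT, map_eq, map_eq, map_sub, h1, h1, neg_sub, sub_neg_eq_add, add_comm, sub_eq_add_neg]
    have h2 := congrArg (TensorProduct.lift ((LinearMap.mul 𝕜 C).compl₁₂ α β)) h1
    simp only [map_sum, map_neg, TensorProduct.comm_tmul, TensorProduct.lift.tmul] at h2
    exact (neg_eq_iff_eq_neg.2 h2).symm
  · refine (tri_schouten_sum T Prod.fst Prod.snd (mulTri α β δ)).symm.trans ?_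
    rw [← hT, map_eq, map_eq]
    have h1 : ∀ s t : M ⊗[𝕜] M, lie1213 s t = 0 → lie1213 t s = 0 → lie1223 s t = 0 →
        lie1223 t s = 0 → lie1323 s t = 0 → lie1323 t s = 0 →
        schouten (s - t) = schouten s + schouten t := by
      intro s t h1 h2 h3 h4 h5 h6
      have e : schouten (s - t) = schouten s + schouten t - (lie1213 s t + lie1213 t s +
          (lie1223 s t + lie1223 t s) + (lie1323 s t + lie1323 t s)) := by
        simp only [schouten, lie1213, lie1223, lie1323, TensorProduct.sub_tmul,
          TensorProduct.tmul_sub, map_sub]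
        abel
      rw [e, h1, h2, h3, h4, h5, h6]
      simp
    rw [h1, map_schouten, map_schouten, add_zero, map_zero]
    all_goals
      simp only [lie1213_sum, lie1223_sum, lie1323_sum, hfg, hgf, TensorProduct.zero_tmul,
        TensorProduct.tmul_zero, Finset.sum_const_zero]

end YangBaxter

/-! ### The degree 2 identity for a Yang-Baxter tensor of derivations -/

section DerivationAlgebra

variable {𝕜 : Type*} [RCLike 𝕜] {C : Type*} [CommRing C] [Algebra 𝕜 C]

/-- Evaluation of derivations at an element of the algebra. -/
def evalDer (a : C) : Derivation 𝕜 C C →ₗ[𝕜] C where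
  toFun D := D a
  map_add' _ _ := rfl
  map_smul' _ _ := rfl

/-- The identity behind the vanishing of the obstruction in degree 2. Here `∑ U ⊗ W`, the sum over
`T`, is an antisymmetric solution of the classical Yang-Baxter equation in the Lie algebra of
derivations, and `B a b = D a * E b - E a * D b` plays the role of `da ∧ db`. -/
theorem sum_sum_eq_zero_of_yangBaxter (T : Finset (Derivation 𝕜 C C × Derivation 𝕜 C C))
    (hA : ∀ α β : Derivation 𝕜 C C →ₗ[𝕜] C,
      ∑ l ∈ T, α l.1 * β l.2 = -∑ l ∈ T, α l.2 * β l.1)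
    (hYB : ∀ α β δ : Derivation 𝕜 C C →ₗ[𝕜] C,
      ∑ k ∈ T, ∑ l ∈ T, (α ⁅k.1, l.1⁆ * β k.2 * δ l.2 + α k.1 * β ⁅k.2, l.1⁆ * δ l.2 +
        α k.1 * β l.1 * δ ⁅k.2, l.2⁆) = 0)
    (D E : C →ₗ[𝕜] C) (B : C → C → C) (hB : ∀ a b, B a b = D a * E b - E a * D b) (x y z : C) :
    ∑ k ∈ T, ∑ l ∈ T, l.1 x * (B (l.2 (k.1 y)) (k.2 z) + B (k.1 y) (l.2 (k.2 z)))
      - ∑ k ∈ T, ∑ l ∈ T, (l.2 (k.1 x) * B (l.1 z) (k.2 y) + k.1 x * B (l.1 z) (l.2 (k.2 y)))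
      - ∑ k ∈ T, ∑ l ∈ T, (l.2 (k.1 x) * B (l.1 y) (k.2 z) + k.1 x * B (l.1 y) (l.2 (k.2 z)))
      = 0 := by
  -- the Yang-Baxter equation, applied to `x`, `y`, `z` and antisymmetrized in `D` and `E`
  have hYB' := sub_eq_zero.2 ((hYB (evalDer x) (D ∘ₗ evalDer y) (E ∘ₗ evalDer z)).trans
    (hYB (evalDer x) (E ∘ₗ evalDer y) (D ∘ₗ evalDer z)).symm)
  have e1 : ∑ k ∈ T, ∑ l ∈ T, l.1 x * (B (l.2 (k.1 y)) (k.2 z) + B (k.1 y) (l.2 (k.2 z))) =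
      ∑ k ∈ T, ∑ l ∈ T, k.1 x * (B (k.2 (l.1 y)) (l.2 z) + B (l.1 y) (k.2 (l.2 z))) :=
    Finset.sum_comm
  -- exchange the two factors of the inner tensor
  have e2 : ∑ k ∈ T, ∑ l ∈ T,
      (l.2 (k.1 x) * B (l.1 z) (k.2 y) + k.1 x * B (l.1 z) (l.2 (k.2 y))) =
      ∑ k ∈ T, ∑ l ∈ T, (l.1 (k.1 x) * B (k.2 y) (l.2 z) + k.1 x * B (l.1 (k.2 y)) (l.2 z)) := by
    refine Finset.sum_congr rfl fun k _ => ?_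
    have h1 := hA (evalDer (k.1 x)) (E ∘ₗ evalDer z)
    have h2 := hA (evalDer (k.1 x)) (D ∘ₗ evalDer z)
    have h3 := hA (D ∘ₗ evalDer (k.2 y)) (E ∘ₗ evalDer z)
    have h4 := hA (E ∘ₗ evalDer (k.2 y)) (D ∘ₗ evalDer z)
    simp only [evalDer, LinearMap.comp_apply, LinearMap.coe_mk, AddHom.coe_mk] at h1 h2 h3 h4
    have c1 : ∑ l ∈ T, (l.2 (k.1 x) * B (l.1 z) (k.2 y) + k.1 x * B (l.1 z) (l.2 (k.2 y))) =
        E (k.2 y) * ∑ l ∈ T, l.2 (k.1 x) * D (l.1 z) - D (k.2 y) * ∑ l ∈ T, l.2 (k.1 x) * E (l.1 z)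
        + k.1 x * (∑ l ∈ T, E (l.2 (k.2 y)) * D (l.1 z) -
          ∑ l ∈ T, D (l.2 (k.2 y)) * E (l.1 z)) := by
      simp only [Finset.mul_sum, ← Finset.sum_sub_distrib, ← Finset.sum_add_distrib]
      refine Finset.sum_congr rfl fun l _ => ?_
      rw [hB, hB]
      ring
    have c2 : ∑ l ∈ T, (l.1 (k.1 x) * B (k.2 y) (l.2 z) + k.1 x * B (l.1 (k.2 y)) (l.2 z)) =
        D (k.2 y) * ∑ l ∈ T, l.1 (k.1 x) * E (l.2 z) - E (k.2 y) * ∑ l ∈ T, l.1 (k.1 x) * D (l.2 z)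
        + k.1 x * (∑ l ∈ T, D (l.1 (k.2 y)) * E (l.2 z) -
          ∑ l ∈ T, E (l.1 (k.2 y)) * D (l.2 z)) := by
      simp only [Finset.mul_sum, ← Finset.sum_sub_distrib, ← Finset.sum_add_distrib]
      refine Finset.sum_congr rfl fun l _ => ?_
      rw [hB, hB]
      ring
    rw [c1, c2, h1, h2, h3, h4]
    ring
  have e3 : ∑ k ∈ T, ∑ l ∈ T, l.2 (k.1 x) * B (l.1 y) (k.2 z) =
      -∑ k ∈ T, ∑ l ∈ T, k.1 (l.1 x) * B (k.2 y) (l.2 z) := by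
    rw [Finset.sum_comm (s := T) (t := T)
      (f := fun k l : Derivation 𝕜 C C × Derivation 𝕜 C C => k.1 (l.1 x) * B (k.2 y) (l.2 z)),
      ← Finset.sum_neg_distrib]
    refine Finset.sum_congr rfl fun k _ => ?_
    have h1 := hA (evalDer (k.1 x)) (E ∘ₗ evalDer y)
    have h2 := hA (evalDer (k.1 x)) (D ∘ₗ evalDer y)
    simp only [evalDer, LinearMap.comp_apply, LinearMap.coe_mk, AddHom.coe_mk] at h1 h2
    have c1 : ∑ l ∈ T, l.2 (k.1 x) * B (l.1 y) (k.2 z) =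
        E (k.2 z) * ∑ l ∈ T, l.2 (k.1 x) * D (l.1 y) -
          D (k.2 z) * ∑ l ∈ T, l.2 (k.1 x) * E (l.1 y) := by
      simp only [Finset.mul_sum, ← Finset.sum_sub_distrib]
      refine Finset.sum_congr rfl fun l _ => ?_
      rw [hB]
      ring
    have c2 : ∑ l ∈ T, l.1 (k.1 x) * B (l.2 y) (k.2 z) =
        E (k.2 z) * ∑ l ∈ T, l.1 (k.1 x) * D (l.2 y) -
          D (k.2 z) * ∑ l ∈ T, l.1 (k.1 x) * E (l.2 y) := by
      simp only [Finset.mul_sum, ← Finset.sum_sub_distrib]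
      refine Finset.sum_congr rfl fun l _ => ?_
      rw [hB]
      ring
    rw [c1, c2, h1, h2]
    ring
  rw [e1, e2]
  simp only [Finset.sum_add_distrib (f := fun l : Derivation 𝕜 C C × Derivation 𝕜 C C =>
    l.2 (_ : C) * B (l.1 y) _)]
  rw [Finset.sum_add_distrib (f := fun k : Derivation 𝕜 C C × Derivation 𝕜 C C => ∑ l ∈ T,
    l.2 (k.1 x) * B (l.1 y) (k.2 z)), e3, ← hYB']
  simp only [← Finset.sum_sub_distrib, ← Finset.sum_neg_distrib, ← Finset.sum_add_distrib]
  refine Finset.sum_congr rfl fun k _ => Finset.sum_congr rfl fun l _ => ?_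
  simp only [evalDer, LinearMap.comp_apply, LinearMap.coe_mk,
    AddHom.coe_mk, Derivation.commutator_apply, map_sub, hB]
  ring

end DerivationAlgebra

/-! ### The triangular bivector field as a tensor of derivations -/

section FlatCalculus

variable {𝕜 : Type*} [RCLike 𝕜] {n : ℕ}
variable {G : Type*} [TopologicalSpace G] [ChartedSpace (EuclideanSpace ℝ (Fin n)) G] [Group G]
  [LieGroup (𝓡 n) ∞ G]

/-- The bivector field `rᴸ - rᴿ`, as a tensor of derivations, for a triangular structure
`r = ∑ pᵢ ⊗ qᵢ`: it is an antisymmetric solution of the classical Yang-Baxter equation. -/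
theorem exists_derivation_tensor {r : LieC 𝕜 n G ⊗[𝕜] LieC 𝕜 n G}
    {S : Finset (LieC 𝕜 n G × LieC 𝕜 n G)}
    (hYB : schouten r = 0) (hcomm : TensorProduct.comm 𝕜 _ _ r = -r)
    (hS : r = ∑ i ∈ S, i.1 ⊗ₜ[𝕜] i.2) :
    ∃ T : Finset (Derivation 𝕜 (Cinf 𝕜 n G) (Cinf 𝕜 n G) × Derivation 𝕜 (Cinf 𝕜 n G) (Cinf 𝕜 n G)),
      (∀ α β : Derivation 𝕜 (Cinf 𝕜 n G) (Cinf 𝕜 n G) →ₗ[𝕜] Cinf 𝕜 n G,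
        ∑ k ∈ T, α k.1 * β k.2 = ∑ i ∈ S,
          (α (leftDer i.1) * β (leftDer i.2) - α (rightDer i.1) * β (rightDer i.2))) ∧
      (∀ α β : Derivation 𝕜 (Cinf 𝕜 n G) (Cinf 𝕜 n G) →ₗ[𝕜] Cinf 𝕜 n G,
        ∑ l ∈ T, α l.1 * β l.2 = -∑ l ∈ T, α l.2 * β l.1) ∧
      ∀ α β δ : Derivation 𝕜 (Cinf 𝕜 n G) (Cinf 𝕜 n G) →ₗ[𝕜] Cinf 𝕜 n G,
        ∑ k ∈ T, ∑ l ∈ T, (α ⁅k.1, l.1⁆ * β k.2 * δ l.2 + α k.1 * β ⁅k.2, l.1⁆ * δ l.2 +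
          α k.1 * β l.1 * δ ⁅k.2, l.2⁆) = 0 := by
  exact exists_sum_yangBaxter (leftField 𝕜 n G) (rightField 𝕜 n G) leftDer_lie_rightDer hYB hcomm hS
    (Cinf 𝕜 n G)

end FlatCalculus

/-! ### The exterior derivative -/

section ExteriorDerivative

variable {𝕜 : Type*} [RCLike 𝕜] {n : ℕ}
variable {G : Type*} [TopologicalSpace G] [ChartedSpace (EuclideanSpace ℝ (Fin n)) G] [Group G]
  [LieGroup (𝓡 n) ∞ G]

theorem d1_d0 (a : Cinf 𝕜 n G) : d1 (d0 a) = 0 := by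
  refine Form2.ext fun v w => ?_
  rw [comp2_d1, comp1_d0, comp1_d0, comp1_d0, leftDer_lie, comp2_zero, sub_self]

theorem d1_add (τ η : Form1 𝕜 n G) : d1 (τ + η) = d1 τ + d1 η := by
  refine Form2.ext fun v w => ?_
  rw [comp2_add, comp2_d1, comp2_d1, comp2_d1, comp1_add, comp1_add, comp1_add]
  simp only [map_add]
  ring

theorem comp1_neg (τ : Form1 𝕜 n G) (v : LieC 𝕜 n G) : comp1 (-τ) v = -comp1 τ v := rfl

theorem comp2_neg (η : Form2 𝕜 n G) (v w : LieC 𝕜 n G) : comp2 (-η) v w = -comp2 η v w := rfl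

theorem d1_neg (τ : Form1 𝕜 n G) : d1 (-τ) = -d1 τ := by
  refine Form2.ext fun v w => ?_
  rw [comp2_neg, comp2_d1, comp2_d1, comp1_neg, comp1_neg, comp1_neg, map_neg, map_neg]
  ring

theorem Form1.map_neg (f : Form1 𝕜 n G →ₗ[𝕜] Form1 𝕜 n G) (τ : Form1 𝕜 n G) : f (-τ) = -f τ :=
  _root_.map_neg f τ

theorem Form2.map_neg (f : Form2 𝕜 n G →ₗ[𝕜] Form2 𝕜 n G) (η : Form2 𝕜 n G) : f (-η) = -f η :=
  _root_.map_neg f η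

theorem d1_sum {ι : Type*} (s : Finset ι) (τ : ι → Form1 𝕜 n G) :
    d1 (∑ i ∈ s, τ i) = ∑ i ∈ s, d1 (τ i) :=
  map_sum (AddMonoidHom.mk' (d1 : Form1 𝕜 n G → Form2 𝕜 n G) d1_add) τ s

theorem d1_fmul_d0 (a b : Cinf 𝕜 n G) : d1 (fmul a (d0 b)) = wedge (d0 a) (d0 b) := by
  refine Form2.ext fun v w => ?_
  rw [comp2_d1, comp2_wedge]
  simp only [comp1_fmul, comp1_d0, Derivation.leibniz, smul_eq_mul, leftDer_lie]
  ring

theorem comp3d_add (η θ : Form2 𝕜 n G) (v w z : LieC 𝕜 n G) :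
    comp3d (η + θ) v w z = comp3d η v w z + comp3d θ v w z := by
  simp only [comp3d, comp2_add, map_add]
  ring

end ExteriorDerivative

/-! ### The super-Jacobi obstructions -/

section Obstructions

variable {𝕜 : Type*} [RCLike 𝕜] {n : ℕ}
variable {G : Type*} [TopologicalSpace G] [ChartedSpace (EuclideanSpace ℝ (Fin n)) G] [Group G]
  [LieGroup (𝓡 n) ∞ G]

/-- The degree 1 obstruction is the curvature on exact forms. -/
theorem J1_eq_curvature (P : PoissonLieStructure 𝕜 n G) (γ : Op1 𝕜 n G) (x y z : Cinf 𝕜 n G) :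
    J1 P γ x y z = curvature P γ x y (d0 z) := by
  refine Form1.ext fun v => ?_
  have h1 : comp1 (J1 P γ x y z) v =
    comp1 (γ x (γ y (d0 z))) v + -comp1 (γ (P.bracket x y) (d0 z)) v
    + comp1 (γ y (-γ x (d0 z))) v := rfl
  have h2 : comp1 (curvature P γ x y (d0 z)) v = comp1 (γ x (γ y (d0 z))) v -
    comp1 (γ y (γ x (d0 z))) v - comp1 (γ (P.bracket x y) (d0 z)) v := rfl
  have h3 : comp1 (γ y (-γ x (d0 z))) v = -comp1 (γ y (γ x (d0 z))) v :=
    congrArg (fun τ => comp1 τ v) (Form1.map_neg (γ y) (γ x (d0 z)))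
  rw [h1, h2, h3]
  ring

variable {γ : Op1 𝕜 n G} {Γ : Op2 𝕜 n G}

theorem comp2_comm11 (x : Cinf 𝕜 n G) (τ : Form1 𝕜 n G) (v w : LieC 𝕜 n G) :
    comp2 (comm11 γ Γ x τ) v w = comp2 (d1 (γ x τ)) v w - comp2 (Γ x (d1 τ)) v w := rfl

theorem comp2_comm11_neg (x : Cinf 𝕜 n G) (τ : Form1 𝕜 n G) (v w : LieC 𝕜 n G) :
    comp2 (comm11 γ Γ x (-τ)) v w = -(comp2 (d1 (γ x τ)) v w - comp2 (Γ x (d1 τ)) v w) := by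
  have h1 : comp2 (d1 (γ x (-τ))) v w = -comp2 (d1 (γ x τ)) v w :=
    congrArg (fun η => comp2 η v w) ((congrArg d1 (Form1.map_neg (γ x) τ)).trans (d1_neg _))
  have h2 : comp2 (Γ x (d1 (-τ))) v w = -comp2 (Γ x (d1 τ)) v w :=
    congrArg (fun η => comp2 η v w) ((congrArg (Γ x) (d1_neg τ)).trans (Form2.map_neg (Γ x) _))
  rw [comp2_comm11, h1, h2]
  ring

theorem comm11_d0 (x y : Cinf 𝕜 n G) : comm11 γ Γ x (d0 y) = d1 (γ x (d0 y)) := by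
  refine Form2.ext fun v w => ?_
  rw [comp2_comm11, d1_d0, map_zero, comp2_zero, sub_zero]

/-- The degree 2 obstruction, using that `d γ(x, dy) - γ(x, d dy) = d γ(x, dy)`. -/
theorem comp2_J2 (x y z : Cinf 𝕜 n G) (v w : LieC 𝕜 n G) :
    comp2 (J2 γ Γ x y z) v w = comp2 (Γ x (d1 (γ y (d0 z)))) v w -
      (comp2 (d1 (γ z (γ x (d0 y)))) v w - comp2 (Γ z (d1 (γ x (d0 y)))) v w) -
      (comp2 (d1 (γ y (γ x (d0 z)))) v w - comp2 (Γ y (d1 (γ x (d0 z)))) v w) := by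
  have h1 : comp2 (J2 γ Γ x y z) v w = comp2 (Γ x (comm11 γ Γ y (d0 z))) v w -
    comp2 (comm11 γ Γ z (γ x (d0 y))) v w + comp2 (comm11 γ Γ y (-γ x (d0 z))) v w := rfl
  have h2 : comp2 (Γ x (comm11 γ Γ y (d0 z))) v w = comp2 (Γ x (d1 (γ y (d0 z)))) v w :=
    congrArg (fun η => comp2 (Γ x η) v w) (comm11_d0 y z)
  have h3 := comp2_comm11 (γ := γ) (Γ := Γ) z (γ x (d0 y)) v w
  have h4 := comp2_comm11_neg (γ := γ) (Γ := Γ) y (γ x (d0 z)) v w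
  linear_combination h1 + h2 - h3 + h4

/-- By compatibility, `γ(x, dz)` and `γ(z, dx)` differ by an exact form. -/
theorem d1_apply_d0_comm {P : PoissonLieStructure 𝕜 n G} (hγ : IsCompatible P γ)
    (x z : Cinf 𝕜 n G) : d1 (γ x (d0 z)) = d1 (γ z (d0 x)) := by
  have h1 : γ x (d0 z) = γ z (d0 x) + d0 (P.bracket x z) :=
    Form1.ext fun v => by
      have h2 : leftDer v (P.bracket x z) = comp1 (γ x (d0 z)) v - comp1 (γ z (d0 x)) v :=
        congrArg (fun τ => comp1 τ v) (hγ x z)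
      rw [comp1_add, comp1_d0, h2]
      ring
  rw [h1, d1_add, d1_d0, add_zero]

/-- If the degree 2 obstruction vanishes, the 2-form whose differential is the degree 3 obstruction
is exact. -/
theorem ext_comm11_cyclic_sum {P : PoissonLieStructure 𝕜 n G} (hγ : IsCompatible P γ)
    {x y z : Cinf 𝕜 n G} (h : J2 γ Γ x y z = 0) :
    Γ x (comm11 γ Γ y (d0 z)) + Γ z (comm11 γ Γ x (d0 y)) + Γ y (comm11 γ Γ z (d0 x)) =
      d1 (γ z (γ x (d0 y))) + d1 (γ y (γ x (d0 z))) := by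
  refine Form2.ext fun v w => ?_
  have h0 : comp2 (J2 γ Γ x y z) v w = 0 := congrArg (fun η => comp2 η v w) h
  have h1 := comp2_J2 (γ := γ) (Γ := Γ) x y z v w
  have h2 : comp2 (Γ x (comm11 γ Γ y (d0 z))) v w = comp2 (Γ x (d1 (γ y (d0 z)))) v w :=
    congrArg (fun η => comp2 (Γ x η) v w) (comm11_d0 y z)
  have h3 : comp2 (Γ z (comm11 γ Γ x (d0 y))) v w = comp2 (Γ z (d1 (γ x (d0 y)))) v w :=
    congrArg (fun η => comp2 (Γ z η) v w) (comm11_d0 x y)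
  have h4 : comp2 (Γ y (comm11 γ Γ z (d0 x))) v w = comp2 (Γ y (d1 (γ x (d0 z)))) v w :=
    congrArg (fun η => comp2 (Γ y η) v w) ((comm11_d0 z x).trans (d1_apply_d0_comm hγ x z).symm)
  rw [comp2_add, comp2_add, comp2_add]
  linear_combination h2 + h3 + h4 - h1 + h0

/-- The degree 3 obstruction follows from the degree 2 one, since `d² = 0` and the preconnection is
compatible. -/
theorem J3_eq_zero {P : PoissonLieStructure 𝕜 n G} (hγ : IsCompatible P γ) {x y z : Cinf 𝕜 n G}
    (h : J2 γ Γ x y z = 0) (g : G) (u v w : TC 𝕜 n g) : J3 γ Γ x y z g u v w = 0 := by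
  have h2 : ∀ a b c : LieC 𝕜 n G, comp3d (Γ x (comm11 γ Γ y (d0 z))) a b c +
      comp3d (Γ z (comm11 γ Γ x (d0 y))) a b c + comp3d (Γ y (comm11 γ Γ z (d0 x))) a b c = 0 := by
    intro a b c
    rw [← comp3d_add, ← comp3d_add, ext_comm11_cyclic_sum hγ h, comp3d_add, comp3d_d1, comp3d_d1,
      add_zero]
  have h3 := congrArg (fun a : Cinf 𝕜 n G => a.1 g) (h2 ((leftTriv 𝕜 n g).symm u)
    ((leftTriv 𝕜 n g).symm v) ((leftTriv 𝕜 n g).symm w))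
  exact (congrArg₂ (· + ·) (congrArg₂ (· + ·) (d2_eq_comp3d _ g u v w) (d2_eq_comp3d _ g u v w))
    (d2_eq_comp3d _ g u v w)).trans h3

variable {T : Finset (Derivation 𝕜 (Cinf 𝕜 n G) (Cinf 𝕜 n G) ×
  Derivation 𝕜 (Cinf 𝕜 n G) (Cinf 𝕜 n G))}

/-- `Γ_x d γ_y dz` for a preconnection of the form `γ_x da = ∑ (U x) d(W a)`. -/
theorem comp2_ext_d1_conn (hΓ : IsExtension γ Γ)
    (hT : ∀ x a, γ x (d0 a) = ∑ k ∈ T, fmul (k.1 x) (d0 (k.2 a))) (x y z : Cinf 𝕜 n G)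
    (v w : LieC 𝕜 n G) :
    comp2 (Γ x (d1 (γ y (d0 z)))) v w = ∑ k ∈ T, ∑ l ∈ T, l.1 x *
      (comp2 (wedge (d0 (l.2 (k.1 y))) (d0 (k.2 z))) v w +
        comp2 (wedge (d0 (k.1 y)) (d0 (l.2 (k.2 z)))) v w) := by
  rw [hT, d1_sum, map_sum, comp2_sum]
  refine Finset.sum_congr rfl fun k _ => ?_
  rw [d1_fmul_d0, hΓ, comp2_add, comp2_wedge, comp2_wedge, hT, hT]
  simp only [map_sum, LinearMap.sum_apply, comp1_fmul, comp2_wedge, comp1_d0]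
  simp only [Finset.sum_mul, Finset.mul_sum, ← Finset.sum_sub_distrib, ← Finset.sum_add_distrib]
  refine Finset.sum_congr rfl fun l _ => ?_
  ring

/-- `d γ_z γ_x dy` for a preconnection of the form `γ_x da = ∑ (U x) d(W a)`. -/
theorem d1_conn_conn {P : PoissonLieStructure 𝕜 n G} (hγ : IsPreconnection P γ)
    (hT : ∀ x a, γ x (d0 a) = ∑ k ∈ T, fmul (k.1 x) (d0 (k.2 a)))
    (hP : ∀ a b, P.bracket a b = ∑ k ∈ T, k.1 a * k.2 b) (x y z : Cinf 𝕜 n G) :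
    d1 (γ z (γ x (d0 y))) = ∑ k ∈ T, ∑ l ∈ T,
      (wedge (d0 (k.1 x * l.1 z)) (d0 (l.2 (k.2 y))) +
        wedge (d0 (l.1 z * l.2 (k.1 x))) (d0 (k.2 y))) := by
  have h : γ z (γ x (d0 y)) = ∑ k ∈ T, ∑ l ∈ T,
      (fmul (k.1 x * l.1 z) (d0 (l.2 (k.2 y))) + fmul (l.1 z * l.2 (k.1 x)) (d0 (k.2 y))) := by
    rw [hT, map_sum]
    refine Finset.sum_congr rfl fun k _ => Form1.ext fun v => ?_
    rw [hγ.connection, comp1_add, comp1_fmul, comp1_fmul, hT, hP]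
    simp only [map_sum, LinearMap.sum_apply, comp1_add, comp1_fmul, Finset.sum_mul, Finset.mul_sum,
      mul_assoc, ← Finset.sum_add_distrib]
  rw [h, d1_sum]
  refine Finset.sum_congr rfl fun k _ => ?_
  rw [d1_sum]
  refine Finset.sum_congr rfl fun l _ => ?_
  rw [d1_add, d1_fmul_d0, d1_fmul_d0]

/-- `d γ_z γ_x dy - Γ_z d γ_x dy` for a preconnection of the form `γ_x da = ∑ (U x) d(W a)`. -/
theorem comp2_d1_conn_conn (hΓ : IsExtension γ Γ) {P : PoissonLieStructure 𝕜 n G}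
    (hγ : IsPreconnection P γ) (hT : ∀ x a, γ x (d0 a) = ∑ k ∈ T, fmul (k.1 x) (d0 (k.2 a)))
    (hP : ∀ a b, P.bracket a b = ∑ k ∈ T, k.1 a * k.2 b) (x y z : Cinf 𝕜 n G)
    (v w : LieC 𝕜 n G) :
    comp2 (d1 (γ z (γ x (d0 y)))) v w - comp2 (Γ z (d1 (γ x (d0 y)))) v w = ∑ k ∈ T, ∑ l ∈ T,
      (l.2 (k.1 x) * comp2 (wedge (d0 (l.1 z)) (d0 (k.2 y))) v w +
        k.1 x * comp2 (wedge (d0 (l.1 z)) (d0 (l.2 (k.2 y)))) v w) := by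
  rw [d1_conn_conn hγ hT hP, comp2_ext_d1_conn hΓ hT]
  simp only [comp2_sum, ← Finset.sum_sub_distrib]
  refine Finset.sum_congr rfl fun k _ => Finset.sum_congr rfl fun l _ => ?_
  rw [comp2_add]
  simp only [comp2_wedge, comp1_d0, Derivation.leibniz, smul_eq_mul]
  ring

/-- The degree 2 obstruction vanishes for a preconnection of the form `γ_x da = ∑ (U x) d(W a)`,
where `∑ U ⊗ W` is a triangular structure on derivations. -/
theorem J2_eq_zero {P : PoissonLieStructure 𝕜 n G} (hγ : IsPreconnection P γ)
    (hΓ : IsExtension γ Γ) (hT : ∀ x a, γ x (d0 a) = ∑ k ∈ T, fmul (k.1 x) (d0 (k.2 a)))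
    (hP : ∀ a b, P.bracket a b = ∑ k ∈ T, k.1 a * k.2 b)
    (hA : ∀ α β : Derivation 𝕜 (Cinf 𝕜 n G) (Cinf 𝕜 n G) →ₗ[𝕜] Cinf 𝕜 n G,
      ∑ l ∈ T, α l.1 * β l.2 = -∑ l ∈ T, α l.2 * β l.1)
    (hYB : ∀ α β δ : Derivation 𝕜 (Cinf 𝕜 n G) (Cinf 𝕜 n G) →ₗ[𝕜] Cinf 𝕜 n G,
      ∑ k ∈ T, ∑ l ∈ T, (α ⁅k.1, l.1⁆ * β k.2 * δ l.2 + α k.1 * β ⁅k.2, l.1⁆ * δ l.2 +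
        α k.1 * β l.1 * δ ⁅k.2, l.2⁆) = 0) (x y z : Cinf 𝕜 n G) : J2 γ Γ x y z = 0 := by
  refine Form2.ext fun v w => ?_
  rw [comp2_J2, comp2_ext_d1_conn hΓ hT, comp2_d1_conn_conn hΓ hγ hT hP,
    comp2_d1_conn_conn hΓ hγ hT hP, comp2_zero]
  exact sum_sum_eq_zero_of_yangBaxter T hA hYB (leftDer v : _ →ₗ[𝕜] _) (leftDer w : _ →ₗ[𝕜] _)
    (fun a b => comp2 (wedge (d0 a) (d0 b)) v w) (fun a b => by
      rw [comp2_wedge]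
      simp only [comp1_d0]
      rw [mul_comm (leftDer v b)]
      rfl) x y z

end Obstructions

/-! ### Vanishing of the degree 2 obstruction in the triangular case -/

section Triangular

variable {𝕜 : Type*} [RCLike 𝕜] {n : ℕ}
variable {G : Type*} [TopologicalSpace G] [ChartedSpace (EuclideanSpace ℝ (Fin n)) G] [Group G]
  [LieGroup (𝓡 n) ∞ G] [T2Space G] [ConnectedSpace G]

/-- In the triangular case, `γ(x, da) = ∑ (U x) d(W a)` for the tensor `∑ U ⊗ W = rᴸ - rᴿ` of
derivations, so that `J2_eq_zero` applies. -/
theorem J2_conn_eq_zero {P : PoissonLieStructure 𝕜 n G} {r : LieC 𝕜 n G ⊗[𝕜] LieC 𝕜 n G}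
    {S : Finset (LieC 𝕜 n G × LieC 𝕜 n G)} (hr : IsQuasitriangular P r)
    (hS : skewPart r = ∑ i ∈ S, i.1 ⊗ₜ[𝕜] i.2) (ht : IsTriangular r) (x y z : Cinf 𝕜 n G) :
    J2 (conn P S) (conn2 P S) x y z = 0 := by
  have e : skewPart r = r := by
    conv_rhs => rw [← symPart_add_skewPart r, show symPart r = 0 from ht, zero_add]
  have hcomm : TensorProduct.comm 𝕜 _ _ r = -r := by
    have h := comm_skewPart r
    rwa [e] at h
  obtain ⟨T, h1, hA, hYB⟩ := exists_derivation_tensor (n := n) hr.yangBaxter hcomm (e ▸ hS)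
  refine J2_eq_zero (T := T) (isPreconnection_conn P S) (isExtension_conn2 P S)
    (fun x a => Form1.ext fun v => ?_) (fun a b => ?_) hA hYB x y z
  · have h2 := h1 (evalDer x) ((leftDer v : _ →ₗ[𝕜] _) ∘ₗ evalDer a)
    rw [comp1_conn, P.ham_eq_sum hr hS, ← Finset.sum_add_distrib, map_sum, LinearMap.sum_apply]
    refine Eq.trans (Finset.sum_congr rfl fun i _ => ?_) h2.symm
    change _ = leftDer i.1 x * leftDer v (leftDer i.2 a) -
      rightDer i.1 x * leftDer v (rightDer i.2 a)
    rw [comp1_d0, comp1_d0, leftDer_lie, leftDer_rightDer_comm]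
    ring
  · exact (P.ham_eq_sum hr hS a b).trans (h1 (evalDer a) (evalDer b)).symm

end Triangular

end PoissonLie

end

theorem theorem4p18 {𝕜 : Type*} [RCLike 𝕜] (n : ℕ) {G : Type*} [TopologicalSpace G]
    [ChartedSpace (EuclideanSpace ℝ (Fin n)) G] [Group G] [LieGroup (𝓡 n) ∞ G]
    [T2Space G] [ConnectedSpace G]
    (P : PoissonLie.PoissonLieStructure 𝕜 n G)
    (r : PoissonLie.LieC 𝕜 n G ⊗[𝕜] PoissonLie.LieC 𝕜 n G)
    (hr : PoissonLie.IsQuasitriangular P r) :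
    ∃ (γ : PoissonLie.Op1 𝕜 n G) (Γ : PoissonLie.Op2 𝕜 n G),
      -- `γ` is the preconnection with `Ξ̂ = 0`; it is compatible and bicovariant
      (PoissonLie.HasXiHatZero P r γ ∧ ∀ γ₁, PoissonLie.HasXiHatZero P r γ₁ → γ₁ = γ) ∧
      PoissonLie.IsPreconnection P γ ∧
      PoissonLie.IsCompatible P γ ∧
      PoissonLie.IsBicovariant P γ ∧
      -- `γ̃(a, s)(g) = {a, s}(g) + a'(g; g r₋¹) ad*_{r₋²} (s(g))` with `s = τ̃`
      (∀ (a : PoissonLie.Cinf 𝕜 n G) (τ : PoissonLie.Form1 𝕜 n G) (g : G)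
          (v : PoissonLie.LieC 𝕜 n G),
        PoissonLie.tilde (γ a τ) g v =
          PoissonLie.pbracket n P.biv a.1 (fun h => PoissonLie.tilde τ h v) g +
            PoissonLie.coadTerm (PoissonLie.skewPart r)
              (PoissonLie.tilde (PoissonLie.d0 a) g) (PoissonLie.tilde τ g) v) ∧
      -- `Γ` is the unique extension of `γ` to 2-forms
      (PoissonLie.IsExtension γ Γ ∧ ∀ Γ₁, PoissonLie.IsExtension γ Γ₁ → Γ₁ = Γ) ∧
      -- semisimple case
      (LieAlgebra.HasTrivialRadical ℝ (GroupLieAlgebra (𝓡 n) G) →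
        ((∀ x y τ, PoissonLie.curvature P γ x y τ = 0) ↔ PoissonLie.IsTriangular r) ∧
        (PoissonLie.IsTriangular r → ∀ x y z : PoissonLie.Cinf 𝕜 n G,
          PoissonLie.J1 P γ x y z = 0 ∧ PoissonLie.J2 γ Γ x y z = 0 ∧
            ∀ (g : G) (u v w : PoissonLie.TC 𝕜 n g), PoissonLie.J3 γ Γ x y z g u v w = 0)) := by
  obtain ⟨S, hS⟩ := TensorProduct.exists_finset (PoissonLie.skewPart r)
  refine ⟨PoissonLie.conn P S, PoissonLie.conn2 P S,
    ⟨PoissonLie.hasXiHatZero_conn hS, fun _ h => h.eq_conn hS⟩, PoissonLie.isPreconnection_conn P S,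
    PoissonLie.isCompatible_conn hr hS,
    ⟨PoissonLie.isLeftCovariant_conn, PoissonLie.isRightCovariant_conn hr hS⟩,
    PoissonLie.tilde_conn hS,
    ⟨PoissonLie.isExtension_conn2 P S, fun _ h => h.unique (PoissonLie.isExtension_conn2 P S)⟩,
    fun _ => ⟨⟨PoissonLie.isTriangular_of_curvature_eq_zero hr hS,
      PoissonLie.curvature_eq_zero hr hS⟩, fun ht x y z => ⟨?_, ?_, ?_⟩⟩⟩
  · exact (PoissonLie.J1_eq_curvature P _ x y z).trans
      (PoissonLie.curvature_eq_zero hr hS ht x y (PoissonLie.d0 z))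
  · exact PoissonLie.J2_conn_eq_zero hr hS ht x y z
  · exact PoissonLie.J3_eq_zero (PoissonLie.isCompatible_conn hr hS)
      (PoissonLie.J2_conn_eq_zero hr hS ht x y z)
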